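/- Let $M\ge 1$ be an integer, $\gamma>0$ and $\alpha_E\in\mathbb R$. For a Hermitian $M\times M$ matrix $X$ with distinct eigenvalues $x_1,\dots,x_M$ put $$\mathcal F(X)=(-1)^{M(M-1)/2}\,\frac{e^{-i\gamma\alpha_E\operatorname{Tr}X}}{\Delta\{X\}}\,\det\bigl[g_{M-i}(x_j)\bigr]_{i,j=1}^{M},\qquad g_{M-n}(x)=e^{-\gamma|x|}\,x^{n-1}\sum_{l=0}^{M-n}\frac{|\gamma x|^l}{l!},$$ where $\Delta\{X\}=\prod_{i<j}(x_i-x_j)$. The matrices with distinct eigenvalues are dense, and $\mathcal F$ extends to a continuous function, again denoted $\mathcal F$, on all Hermitian $M\times M$ matrices. Let $$dK=\frac{\prod_{j=1}^M j!}{\pi^{M(M-1)/2}}\prod_{i}dK_{ii}\prod_{i<j}d\operatorname{Re}K_{ij}\,d\operatorname{Im}K_{ij}$$ be Lebesgue measure on the space of Hermitian $M\times M$ matrices, in the normalization in which $dK=\Delta(k)^2\,dk_1\cdots dk_M\,d\mu(U)$ for $K=U\operatorname{diag}(k_1,\dots,k_M)U^{*}$, with $k\in\mathbb R^M$ and $\mu$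 the Haar probability measure on $U(M)$. Then for every Hermitian $M\times M$ matrix $X$ the following integral over all Hermitian $M\times M$ matrices converges absolutely and $$\int\frac{e^{-i\operatorname{Tr}KX}\,dK}{\det[\gamma^2+(K-\gamma\alpha_E)^2]^{M}}=\frac{\pi^M M!}{\gamma^{M^2}2^{M(M-1)}}\,\mathcal F(X).$$ Consequently $\mathcal F$ is the characteristic function $X\mapsto\mathbb E\,e^{-i\operatorname{Tr}KX}$ of the matrix Cauchy distribution, i.e. of the probability measure on Hermitian $M\times M$ matrices $K$ with density proportional to $\det[\gamma^2+(K-\gamma\alpha_E)^2]^{-M}$. -/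

import Mathlib

open MeasureTheory Filter Topology

noncomputable section

/-- The set of all Hermitian `M × M` complex matrices. -/
abbrev HermMat (M : ℕ) : Type := selfAdjoint (Matrix (Fin M) (Fin M) ℂ)

/-- Hermitian matrices carry the Borel sigma-algebra of their usual topology. -/
instance HermMat.instMeasurableSpace (M : ℕ) : MeasurableSpace (HermMat M) := borel _

instance HermMat.instBorelSpace (M : ℕ) : BorelSpace (HermMat M) := ⟨rfl⟩

theorem HermMat.isHermitian {M : ℕ} (X : HermMat M) :
    (X : Matrix (Fin M) (Fin M) ℂ).IsHermitian := X.2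

/-- The eigenvalues `x_1, …, x_M` of a Hermitian matrix, repeated with multiplicity. -/
def HermMat.eig {M : ℕ} (X : HermMat M) : Fin M → ℝ := X.isHermitian.eigenvalues

/-- Free real coordinates on Hermitian matrices: the real diagonal entries and the complex
entries strictly above the diagonal. -/
abbrev HermCoord (M : ℕ) : Type := (Fin M → ℝ) × ({p : Fin M × Fin M // p.1 < p.2} → ℂ)

/-- The entries of the Hermitian matrix with given coordinates. -/
def HermCoord.toMatrix {M : ℕ} (c : HermCoord M) : Matrix (Fin M) (Fin M) ℂ :=
  Matrix.of fun i j =>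
    if h : i < j then c.2 ⟨(i, j), h⟩
    else if h' : j < i then star (c.2 ⟨(j, i), h'⟩)
    else (c.1 i : ℂ)

theorem HermCoord.toMatrix_mem {M : ℕ} (c : HermCoord M) :
    c.toMatrix ∈ selfAdjoint (Matrix (Fin M) (Fin M) ℂ) := by
  rw [selfAdjoint.mem_iff]
  ext i j
  rw [Matrix.star_apply]
  rcases lt_trichotomy i j with h | h | h
  · simp [HermCoord.toMatrix, h, h.not_gt]
  · subst h
    simp [HermCoord.toMatrix]
  · simp [HermCoord.toMatrix, h, h.not_gt]

/-- The Hermitian matrix with given coordinates. -/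
def HermCoord.toHerm {M : ℕ} (c : HermCoord M) : HermMat M := ⟨c.toMatrix, c.toMatrix_mem⟩

theorem HermCoord.continuous_toHerm {M : ℕ} :
    Continuous (HermCoord.toHerm : HermCoord M → HermMat M) := by
  refine Continuous.subtype_mk ?_ _
  refine continuous_matrix fun i j => ?_
  rcases lt_trichotomy i j with h | h | h
  · simp only [HermCoord.toMatrix, Matrix.of_apply, h, dif_pos]
    fun_prop
  · subst h
    simp only [HermCoord.toMatrix, Matrix.of_apply, lt_irrefl, dif_neg, not_false_eq_true]
    fun_prop
  · simp only [HermCoord.toMatrix, Matrix.of_apply, h, h.not_gt, dif_pos, dif_neg,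
      not_false_eq_true]
    fun_prop

theorem HermCoord.measurable_toHerm {M : ℕ} :
    Measurable (HermCoord.toHerm : HermCoord M → HermMat M) :=
  HermCoord.continuous_toHerm.measurable

/-- The flat Lebesgue measure `∏ᵢ dKᵢᵢ ∏_{i<j} d(Re Kᵢⱼ) d(Im Kᵢⱼ)` on Hermitian matrices. -/
def flatHermMeasure (M : ℕ) : Measure (HermMat M) :=
  Measure.map HermCoord.toHerm (volume : Measure (HermCoord M))

/-- The Lebesgue measure `dK` on Hermitian matrices, with the usual random-matrix normalization,
in which `dK = Δ(k)² dk₁ ⋯ dk_M dμ(U)` for `K = U diag(k₁, …, k_M) U*`, where `k` ranges over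
all of `ℝ^M` and `μ` is the Haar probability measure on the unitary group. It is
`(∏_{j=1}^M j!) / π^(M(M-1)/2)` times the flat measure. -/
def hermMeasure (M : ℕ) : Measure (HermMat M) :=
  ENNReal.ofReal ((∏ j ∈ Finset.Icc 1 M, (j.factorial : ℝ)) / Real.pi ^ (M * (M - 1) / 2)) •
    flatHermMeasure M

/-- The Vandermonde product `Δ{x} = ∏_{i<j} (xᵢ - xⱼ)`. -/
def vandermondeProd {M : ℕ} (x : Fin M → ℝ) : ℝ :=
  ∏ i, ∏ j ∈ Finset.Ioi i, (x i - x j)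

/-- `gFun M γ k` is the function
`g_k(x) = exp(-γ|x|) x^(M-1-k) ∑_{l=0}^{k} |γ x|^l / l!`, for `0 ≤ k ≤ M - 1`. -/
def gFun (M : ℕ) (γ : ℝ) (k : ℕ) (x : ℝ) : ℝ :=
  Real.exp (-γ * |x|) * x ^ (M - 1 - k) *
    ∑ l ∈ Finset.range (k + 1), |γ * x| ^ l / (l.factorial : ℝ)

/-- The Hermitian matrices with pairwise distinct eigenvalues. -/
def simpleSpectrum (M : ℕ) : Set (HermMat M) := {X | Function.Injective X.eig}

/-- The explicit formula for `F(X)`, meaningful when the eigenvalues of `X` are distinct. -/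
def limitCharFormula {M : ℕ} (γ α : ℝ) (X : HermMat M) : ℂ :=
  (-1 : ℂ) ^ (M * (M - 1) / 2) *
    (Complex.exp (-Complex.I * γ * α * Matrix.trace (X : Matrix (Fin M) (Fin M) ℂ)) /
      (vandermondeProd X.eig : ℂ)) *
    ((Matrix.det (Matrix.of fun i j : Fin M => gFun M γ (M - 1 - i) (X.eig j)) : ℝ) : ℂ)

/-- The function `F`: the explicit formula at matrices with distinct eigenvalues, and its
extension by limits (along matrices with distinct eigenvalues) at the others. -/
def limitCharFun {M : ℕ} (γ α : ℝ) : HermMat M → ℂ :=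
  extendFrom (simpleSpectrum M) (limitCharFormula γ α)

/-- The determinant `det[lam² + (K - ε)²]`. -/
def cauchyDet {M : ℕ} (lam ε : ℝ) (K : HermMat M) : ℂ :=
  Matrix.det ((lam : ℂ) ^ 2 • (1 : Matrix (Fin M) (Fin M) ℂ) +
    ((K : Matrix (Fin M) (Fin M) ℂ) - (ε : ℂ) • (1 : Matrix (Fin M) (Fin M) ℂ)) ^ 2)

/-- The measure with density `det[lam² + (K - ε)²]^(-M)` with respect to `dK`
(the determinant is real and nonnegative for Hermitian `K`). -/
def cauchyWeightMeasure (M : ℕ) (lam ε : ℝ) : Measure (HermMat M) :=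
  (hermMeasure M).withDensity fun K => ENNReal.ofReal (((cauchyDet lam ε K).re ^ M)⁻¹)

/-- The matrix Cauchy distribution of width `lam` and mean `ε`: the probability measure with
density proportional to `det[lam² + (K - ε)²]^(-M)`. -/
def matrixCauchy (M : ℕ) (lam ε : ℝ) : Measure (HermMat M) :=
  (cauchyWeightMeasure M lam ε Set.univ)⁻¹ • cauchyWeightMeasure M lam ε

end

noncomputable section

/-! The Cauchy weight is invariant under unitary conjugation, so the matrix `X` may be replaced by
the diagonal matrix of its eigenvalues `x`. Write `V(k)` for the Vandermonde determinant `∏_{i<j}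
(k_j - k_i)`. Two facts then give the formula when the `x_j` are distinct.

The first (`integral_spectral_cexp`) plays the role of Weyl's integration formula and the
Harish-Chandra–Itzykson–Zuber integral together. If `f(K)` depends only on the spectrum of `K`,
then, for flat Lebesgue measure, `Δ{x} ∫ f(K) exp(-i ∑ K_jj x_j)` equals `(-iπ)^(n(n-1)/2)` times
the integral of `f(a) V(a) det[exp(-i a_i x_j)]` over `a_1 < ... < a_n`. The induction is on the
size. Remove the first row and column `(d, b)` and diagonalize the remaining block to `diag(a)`. The
characteristic polynomial is `(t - d) ∏ (t - a_l) - ∑_j |b_j|² ∏_{l≠j} (t - a_l) = ∏ (t - k_i)`.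
Comparing subleading coefficients gives `d = ∑ k - ∑ a`, and evaluating at `t = a_j` gives `|b_j|²`.
Thus `(d, π|b_j|²)` is a bijective function of the sequences `k` interlacing `a`, with Jacobian `π^n
V(k) / V(a)` (`abs_det_borderJac`, `image_borderCoord`). Since `π|z|²` pushes area forward to
length, integrating out the border again leaves a spectral function, now of the smaller block
(`borderIntegral_diag`). For fixed `k` the interlacing `a` fill a box, on which the exponential
determinant integrates to a determinant of the next size (`setIntegral_interlaces_det`).

The second is that the Cauchy weight times one factor `V(k)` is a determinant with one eigenvalue
per column (`eigWeight_mul_vandermonde`). The generating function of the `g` in a parameter `z` is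
`exp(-γ|x|) ∑_{N<M} (zx + γ|x|)^N / N!`. Its Fourier transform is a rational function of `k` with
denominator `(γ² + k²)^M`, and the determinant of these transforms at `M` values of `z` factors into
`V(z)`, `V(k)` and the weights (`det_genHat`). Integrating column by column and inverting the
Fourier transform returns `V(z) det[g] / ∏ n!`, and `V(z)` cancels.

The induction is run on densities cut off to Frobenius balls. Evaluated at `x = t(0, 1, ..., n-1)`
with `t → 0` it bounds the truncated masses uniformly, which gives absolute convergence; the same
limit without the cutoff gives the exact total mass. Finally the Fourier integral is continuous in
`X` and agrees with the explicit formula, up to the mass, on the dense set of simple spectra, so it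
is the mass times the continuous extension. -/

/-! ### Laplace integrals of powers -/

theorem integrableOn_Ioi_pow_mul_cexp_neg {r : ℂ} (hr : 0 < r.re) (N : ℕ) :
    IntegrableOn (fun x : ℝ => (x : ℂ) ^ N * Complex.exp (-r * x)) (Set.Ioi 0) := by
  have h := integrableOn_rpow_mul_exp_neg_mul_rpow (s := N) (p := 1) (b := r.re)
    (by have : (0 : ℝ) ≤ N := N.cast_nonneg
        linarith) one_pos hr
  refine Integrable.mono' h (by fun_prop) ?_
  filter_upwards [self_mem_ae_restrict measurableSet_Ioi] with x hx
  have hx' : (0 : ℝ) < x := hx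
  simp [Complex.norm_exp, abs_of_pos hx']

theorem tendsto_pow_mul_cexp_neg {r : ℂ} (hr : 0 < r.re) (N : ℕ) :
    Tendsto (fun x : ℝ => (x : ℂ) ^ N * Complex.exp (-r * x)) atTop (𝓝 0) := by
  rw [tendsto_zero_iff_norm_tendsto_zero]
  have h := Real.tendsto_pow_mul_exp_neg_atTop_nhds_zero N
  have h2 := (h.comp (tendsto_id.const_mul_atTop hr)).const_mul ((r.re ^ N)⁻¹)
  rw [mul_zero] at h2
  refine h2.congr' ?_
  filter_upwards [eventually_gt_atTop 0] with x hx
  have : r.re ^ N ≠ 0 := by positivity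
  simp only [Function.comp, id, mul_pow, norm_mul, norm_pow, Complex.norm_real, Real.norm_eq_abs,
    abs_of_pos hx, Complex.norm_exp]
  simp
  field_simp

theorem integral_Ioi_pow_mul_cexp_neg {r : ℂ} (hr : 0 < r.re) (N : ℕ) :
    ∫ x in Set.Ioi (0 : ℝ), (x : ℂ) ^ N * Complex.exp (-r * x) =
      (N.factorial : ℂ) / r ^ (N + 1) := by
  have hr0 : r ≠ 0 := by
    rintro rfl
    simp at hr
  have hE : ∀ x : ℝ, HasDerivAt (fun x : ℝ => Complex.exp (-r * x))
      (-r * Complex.exp (-r * x)) x := fun x => by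
    have h1 : HasDerivAt (fun x : ℝ => -r * (x : ℂ)) (-r) x := by
      simpa using (Complex.ofRealCLM.hasDerivAt (x := x)).const_mul (-r)
    simpa [mul_comm] using h1.cexp
  induction N with
  | zero =>
    have hd : ∀ x ∈ Set.Ici (0 : ℝ), HasDerivAt (fun x : ℝ => -r⁻¹ * Complex.exp (-r * x))
        ((x : ℂ) ^ 0 * Complex.exp (-r * x)) x := fun x _ => by
      refine ((hE x).const_mul (-r⁻¹)).congr_deriv ?_
      rw [pow_zero, one_mul, ← mul_assoc, neg_mul_neg, inv_mul_cancel₀ hr0, one_mul]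
    have ht := (tendsto_pow_mul_cexp_neg hr 0).const_mul (-r⁻¹)
    simp only [pow_zero, one_mul, mul_zero] at ht
    rw [integral_Ioi_of_hasDerivAt_of_tendsto' hd (integrableOn_Ioi_pow_mul_cexp_neg hr 0) ht]
    simp
  | succ N ih =>
    have hd : ∀ x ∈ Set.Ici (0 : ℝ),
        HasDerivAt (fun x : ℝ => (x : ℂ) ^ (N + 1) * Complex.exp (-r * x))
        ((N + 1 : ℂ) * ((x : ℂ) ^ N * Complex.exp (-r * x)) -
          r * ((x : ℂ) ^ (N + 1) * Complex.exp (-r * x))) x := fun x _ => by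
      have h1 : HasDerivAt (fun x : ℝ => (x : ℂ) ^ (N + 1)) ((N + 1 : ℂ) * (x : ℂ) ^ N) x := by
        have h2 := HasDerivAt.fun_pow (Complex.ofRealCLM.hasDerivAt (x := x)) (N + 1)
        refine h2.congr_deriv ?_
        simp
      refine (h1.mul (hE x)).congr_deriv ?_
      ring
    have i1 := (integrableOn_Ioi_pow_mul_cexp_neg hr N).const_mul (N + 1 : ℂ)
    have i2 := (integrableOn_Ioi_pow_mul_cexp_neg hr (N + 1)).const_mul r
    have key := integral_Ioi_of_hasDerivAt_of_tendsto' hd (i1.sub i2)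
      (tendsto_pow_mul_cexp_neg hr (N + 1))
    rw [integral_sub i1 i2, integral_const_mul, integral_const_mul, ih] at key
    simp only [Complex.ofReal_zero, ne_eq, Nat.succ_ne_zero, not_false_eq_true, zero_pow, zero_mul,
      sub_zero] at key
    have : r * (∫ x in Set.Ioi (0 : ℝ), (x : ℂ) ^ (N + 1) * Complex.exp (-r * x)) =
      (N + 1 : ℂ) * ((N.factorial : ℂ) / r ^ (N + 1)) := (sub_eq_zero.mp key).symm
    rw [← mul_right_inj' hr0, this, Nat.factorial_succ]
    push_cast
    field_simp
    ring

/-! ### The generating function of the `g` and its Fourier transform -/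

/-- The generating function `∑ₙ zⁿ gₙ(x) / n!` of the functions `gFun`, in closed form. -/
def genFun (M : ℕ) (γ z x : ℝ) : ℝ :=
  Real.exp (-γ * |x|) * ∑ N ∈ Finset.range M, (z * x + γ * |x|) ^ N / (N.factorial : ℝ)

theorem continuous_genFun (M : ℕ) (γ z : ℝ) : Continuous (genFun M γ z) := by
  unfold genFun
  fun_prop

/-- Expand each power by the binomial theorem and put `l = N - n`. The coefficient of `z ^ n` is
then `x ^ n / n!` times the exponential sum truncated at `l < M - n`, which is exactly the
truncation in `gFun`. Positivity of `γ` identifies `γ|x|` with `|γx|`. -/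
theorem genFun_eq_sum (M : ℕ) {γ : ℝ} (hγ : 0 < γ) (z x : ℝ) :
    genFun M γ z x =
      ∑ n ∈ Finset.range M, z ^ n / (n.factorial : ℝ) * gFun M γ (M - 1 - n) x := by
  have hL : ∀ N ∈ Finset.range M, (z * x + γ * |x|) ^ N / (N.factorial : ℝ) =
      ∑ p ∈ Finset.range M with p ≤ N, z ^ p * x ^ p / (p.factorial : ℝ) *
        (|γ * x| ^ (N - p) / ((N - p).factorial : ℝ)) := fun N hN => by
    rw [add_pow, Finset.sum_div]
    have : (Finset.range M).filter (· ≤ N) = Finset.range (N + 1) := by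
      ext p
      simp only [Finset.mem_filter, Finset.mem_range] at hN ⊢
      omega
    rw [this]
    refine Finset.sum_congr rfl fun p hp => ?_
    have hp' : p ≤ N := by simpa [Nat.lt_succ_iff] using hp
    have := Nat.choose_mul_factorial_mul_factorial hp'
    have h2 : (N.choose p : ℝ) * p.factorial * (N - p).factorial = N.factorial := by
      exact_mod_cast this
    rw [← h2, abs_mul, abs_of_pos hγ, mul_pow]
    have : (N.choose p : ℝ) ≠ 0 := by exact_mod_cast (Nat.choose_pos hp').ne'
    field_simp
  rw [genFun, Finset.sum_congr rfl hL]
  simp only [Finset.sum_filter]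
  rw [Finset.sum_comm, Finset.mul_sum]
  refine Finset.sum_congr rfl fun n hn => ?_
  have hn' : n < M := by simpa using hn
  rw [gFun, ← Finset.sum_filter]
  have e1 : M - 1 - (M - 1 - n) = n := by omega
  have e2 : M - 1 - n + 1 = M - n := by omega
  rw [e1, e2]
  have : (Finset.range M).filter (n ≤ ·) = (Finset.range (M - n)).map (addLeftEmbedding n) := by
    ext p
    simp only [Finset.mem_filter, Finset.mem_range, Finset.mem_map, addLeftEmbedding_apply]
    constructor
    · rintro ⟨h1, h2⟩
      exact ⟨p - n, by omega, by omega⟩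
    · rintro ⟨a, h1, rfl⟩
      omega
  rw [this, Finset.sum_map]
  simp only [addLeftEmbedding_apply, Nat.add_sub_cancel_left]
  rw [← Finset.mul_sum]
  ring

/-- The Fourier transform of `genFun`, as a rational function. -/
def genHat (M : ℕ) (γ z k : ℝ) : ℂ :=
  2 * γ * (∑ i ∈ Finset.range M, (((γ : ℂ) + z) * (γ + Complex.I * k)) ^ i *
    (((γ : ℂ) - z) * (γ - Complex.I * k)) ^ (M - 1 - i)) / ((γ : ℂ) ^ 2 + (k : ℂ) ^ 2) ^ M

theorem sum_pow_div_pow_eq (M : ℕ) (u r : ℂ) (hr : r ≠ 0) (hur : r ≠ u) :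
    ∑ N ∈ Finset.range M, u ^ N / r ^ (N + 1) = (1 - u ^ M / r ^ M) / (r - u) := by
  have h1 : r - u ≠ 0 := sub_ne_zero.mpr hur
  induction M with
  | zero => simp
  | succ M ih =>
    rw [Finset.sum_range_succ, ih]
    field_simp
    ring

/-- The sums are the contributions of the half-lines `x > 0` and `x < 0`. Both are geometric, with
denominators `-(z + ik)` and `z + ik`, so their constant terms cancel. What remains is `(u^M - v^M)
/ ((z + ik)(γ² + k²)^M)` with `u = (γ + z)(γ + ik)` and `v = (γ - z)(γ - ik)`. Since `u - v = 2γ(z +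
ik)`, the division is exact. The condition `z ≠ 0` keeps `z + ik` away from zero for every real `k`.
-/
theorem genHat_eq_sum (M : ℕ) {γ z : ℝ} (hγ : 0 < γ) (hz : z ≠ 0) (k : ℝ) :
    genHat M γ z k =
      ∑ N ∈ Finset.range M, ((γ : ℂ) + z) ^ N / (γ - Complex.I * k) ^ (N + 1) +
      ∑ N ∈ Finset.range M, ((γ : ℂ) - z) ^ N / (γ + Complex.I * k) ^ (N + 1) := by
  have h1 : (γ : ℂ) - Complex.I * k ≠ 0 := fun h => by
    have := congrArg Complex.re h
    simp at this
    exact hγ.ne' this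
  have h2 : (γ : ℂ) + Complex.I * k ≠ 0 := fun h => by
    have := congrArg Complex.re h
    simp at this
    exact hγ.ne' this
  have h3 : (z : ℂ) + Complex.I * k ≠ 0 := fun h => by
    have := congrArg Complex.re h
    simp at this
    exact hz this
  have h4 : (γ : ℂ) ≠ 0 := by exact_mod_cast hγ.ne'
  rw [sum_pow_div_pow_eq M _ _ h1 (fun h => h3 (by linear_combination -h)),
    sum_pow_div_pow_eq M _ _ h2 (fun h => h3 (by linear_combination h))]
  have hq : (γ : ℂ) ^ 2 + (k : ℂ) ^ 2 = (γ - Complex.I * k) * (γ + Complex.I * k) := by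
    linear_combination (k : ℂ) ^ 2 * Complex.I_sq
  have hd : ((γ : ℂ) + z) * (γ + Complex.I * k) - (γ - z) * (γ - Complex.I * k) =
      2 * γ * (z + Complex.I * k) := by ring
  have hg := (Commute.all (((γ : ℂ) + z) * (γ + Complex.I * k))
    (((γ : ℂ) - z) * (γ - Complex.I * k))).mul_geom_sum₂ M
  rw [hd] at hg
  have e1 : (γ : ℂ) - Complex.I * k - (γ + z) = -(z + Complex.I * k) := by ring
  have e2 : (γ : ℂ) + Complex.I * k - (γ - z) = z + Complex.I * k := by ring
  rw [genHat, hq, e1, e2]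
  rw [← mul_right_inj' h3]
  rw [mul_div_assoc', ← mul_assoc (z + Complex.I * k : ℂ), mul_comm (z + Complex.I * k : ℂ), hg]
  simp only [mul_pow]
  field_simp
  ring

theorem genFun_cexp_pos (M : ℕ) (γ z k : ℝ) {x : ℝ} (hx : 0 < x) :
    (genFun M γ z x : ℂ) * Complex.exp (Complex.I * k * x) =
      ∑ N ∈ Finset.range M, ((γ : ℂ) + z) ^ N / N.factorial *
        ((x : ℂ) ^ N * Complex.exp (-(γ - Complex.I * k) * x)) := by
  rw [genFun, abs_of_pos hx]
  have : Complex.exp (-(γ - Complex.I * k) * x) =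
      Complex.exp (-γ * x) * Complex.exp (Complex.I * k * x) := by
    rw [← Complex.exp_add]
    ring_nf
  rw [this]
  push_cast
  rw [Finset.mul_sum, Finset.sum_mul]
  refine Finset.sum_congr rfl fun N _ => ?_
  rw [← add_mul, mul_pow, add_comm (z : ℂ)]
  ring

theorem genFun_neg (M : ℕ) (γ z x : ℝ) : genFun M γ z (-x) = genFun M γ (-z) x := by
  simp [genFun]

theorem integrableOn_Ioi_genFun_cexp (M : ℕ) {γ : ℝ} (hγ : 0 < γ) (z k : ℝ) :
    IntegrableOn (fun x : ℝ => (genFun M γ z x : ℂ) * Complex.exp (Complex.I * k * x))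
      (Set.Ioi 0) := by
  have hr : 0 < ((γ : ℂ) - Complex.I * k).re := by simpa using hγ
  refine (integrableOn_congr_fun (fun x hx => genFun_cexp_pos M γ z k hx)
    measurableSet_Ioi).mpr ?_
  exact integrable_finsetSum _ fun N _ => (integrableOn_Ioi_pow_mul_cexp_neg hr N).const_mul _

theorem integral_Ioi_genFun_cexp (M : ℕ) {γ : ℝ} (hγ : 0 < γ) (z k : ℝ) :
    ∫ x in Set.Ioi (0 : ℝ), (genFun M γ z x : ℂ) * Complex.exp (Complex.I * k * x) =
      ∑ N ∈ Finset.range M, ((γ : ℂ) + z) ^ N / (γ - Complex.I * k) ^ (N + 1) := by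
  have hr : 0 < ((γ : ℂ) - Complex.I * k).re := by simpa using hγ
  rw [setIntegral_congr_fun measurableSet_Ioi (fun x hx => genFun_cexp_pos M γ z k hx),
    integral_finsetSum _ fun N _ => (integrableOn_Ioi_pow_mul_cexp_neg hr N).const_mul _]
  refine Finset.sum_congr rfl fun N _ => ?_
  rw [integral_const_mul, integral_Ioi_pow_mul_cexp_neg hr N]
  have : (N.factorial : ℂ) ≠ 0 := by exact_mod_cast N.factorial_ne_zero
  field_simp

/-- Reflecting `x` amounts to changing the signs of `z` and `k`, so only the positive half-line has
to be computed. -/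
theorem genFun_cexp_comp_neg (M : ℕ) (γ z k x : ℝ) :
    (genFun M γ (-z) (-x) : ℂ) * Complex.exp (Complex.I * ↑(-k) * ↑(-x)) =
      (genFun M γ z x : ℂ) * Complex.exp (Complex.I * k * x) := by
  rw [genFun_neg, neg_neg]
  push_cast
  ring_nf

theorem integrableOn_Iic_genFun_cexp (M : ℕ) {γ : ℝ} (hγ : 0 < γ) (z k : ℝ) :
    IntegrableOn (fun x : ℝ => (genFun M γ z x : ℂ) * Complex.exp (Complex.I * k * x))
      (Set.Iic 0) := by
  have h := integrableOn_Ioi_genFun_cexp M hγ (-z) (-k)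
  rw [← integrableOn_Ici_iff_integrableOn_Ioi,
    ← (Measure.measurePreserving_neg volume).integrableOn_comp_preimage
      (Homeomorph.neg ℝ).measurableEmbedding, Set.neg_preimage, Set.neg_Ici, neg_zero] at h
  refine (integrableOn_congr_fun (fun x _ => ?_) measurableSet_Iic).mp h
  exact genFun_cexp_comp_neg M γ z k x

theorem integrable_genFun_cexp (M : ℕ) {γ : ℝ} (hγ : 0 < γ) (z k : ℝ) :
    Integrable (fun x : ℝ => (genFun M γ z x : ℂ) * Complex.exp (Complex.I * k * x)) := by
  rw [← integrableOn_univ, ← Set.Iic_union_Ioi (a := (0 : ℝ))]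
  exact (integrableOn_Iic_genFun_cexp M hγ z k).union (integrableOn_Ioi_genFun_cexp M hγ z k)

theorem integral_genFun_cexp (M : ℕ) {γ z : ℝ} (hγ : 0 < γ) (hz : z ≠ 0) (k : ℝ) :
    ∫ x : ℝ, (genFun M γ z x : ℂ) * Complex.exp (Complex.I * k * x) = genHat M γ z k := by
  rw [← intervalIntegral.integral_Iic_add_Ioi (integrableOn_Iic_genFun_cexp M hγ z k)
    (integrableOn_Ioi_genFun_cexp M hγ z k), integral_Ioi_genFun_cexp M hγ z k,
    genHat_eq_sum M hγ hz, add_comm]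
  congr 1
  have h := integral_Ioi_genFun_cexp M hγ (-z) (-k)
  rw [← neg_zero, ← integral_comp_neg_Iic (c := 0)
    (f := fun x : ℝ => (genFun M γ (-z) x : ℂ) * Complex.exp (Complex.I * ↑(-k) * x))] at h
  simp only [genFun_cexp_comp_neg] at h
  rw [h]
  push_cast
  refine Finset.sum_congr rfl fun N _ => ?_
  congr 2
  ring

theorem gamma_sq_add_ne_zero {γ : ℝ} (hγ : 0 < γ) (k : ℝ) : (γ : ℂ) ^ 2 + (k : ℂ) ^ 2 ≠ 0 := by
  have : γ ^ 2 + k ^ 2 ≠ 0 := by positivity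
  exact_mod_cast this

theorem continuous_genHat (M : ℕ) {γ : ℝ} (hγ : 0 < γ) (z : ℝ) : Continuous (genHat M γ z) := by
  unfold genHat
  refine Continuous.div (by fun_prop) (by fun_prop) fun k => ?_
  exact pow_ne_zero _ (gamma_sq_add_ne_zero hγ k)

theorem integrable_inv_sq_add_sq {γ : ℝ} (hγ : 0 < γ) :
    Integrable fun k : ℝ => (γ ^ 2 + k ^ 2)⁻¹ := by
  have h := (integrable_inv_one_add_sq.comp_div hγ.ne').const_mul ((γ ^ 2)⁻¹)
  refine h.congr (Eventually.of_forall fun k => ?_)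
  simp only
  rw [← mul_inv]
  congr 1
  field_simp

/-- With `s = √(γ² + k²)`, both `γ + ik` and `γ - ik` have modulus `s`. The numerator is therefore
`O(s^(M-1))` and the quotient `O(s^(-M-1))`. Since `s ≥ γ`, this is at most a constant times `s⁻²`.
For `M = 0` the exponent `M - 1` would be truncated, but then the function vanishes. -/
theorem integrable_genHat (M : ℕ) {γ : ℝ} (hγ : 0 < γ) (z : ℝ) : Integrable (genHat M γ z) := by
  rcases Nat.eq_zero_or_pos M with rfl | hM
  · have : genHat 0 γ z = fun _ => 0 := by
      ext k
      simp [genHat]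
    rw [this]
    exact integrable_zero _ _ _
  set C : ℝ := 2 * γ * ∑ i ∈ Finset.range M, |γ + z| ^ i * |γ - z| ^ (M - 1 - i) * (γ ^ (M - 1))⁻¹
  refine ((integrable_inv_sq_add_sq hγ).const_mul C).mono'
    (continuous_genHat M hγ z).aestronglyMeasurable (Eventually.of_forall fun k => ?_)
  set s : ℝ := Real.sqrt (γ ^ 2 + k ^ 2) with hs
  have hs2 : s ^ 2 = γ ^ 2 + k ^ 2 := Real.sq_sqrt (by positivity)
  have hs0 : 0 < s := Real.sqrt_pos.mpr (by positivity)
  have hγs : γ ≤ s := Real.le_sqrt_of_sq_le (by nlinarith [sq_nonneg k])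
  have n1 : ‖(γ : ℂ) + Complex.I * k‖ = s := by
    rw [Complex.norm_def, Complex.normSq_apply]
    simp [hs, sq]
  have n2 : ‖(γ : ℂ) - Complex.I * k‖ = s := by
    rw [Complex.norm_def, Complex.normSq_apply]
    simp [hs, sq]
  have n3 : ‖(γ : ℂ) ^ 2 + (k : ℂ) ^ 2‖ = s ^ 2 := by
    rw [hs2]
    have : (γ : ℂ) ^ 2 + (k : ℂ) ^ 2 = ((γ ^ 2 + k ^ 2 : ℝ) : ℂ) := by push_cast; rfl
    rw [this, Complex.norm_real, Real.norm_of_nonneg (by positivity)]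
  have n4 : ‖(γ : ℂ) + z‖ = |γ + z| := by
    rw [← Complex.ofReal_add, Complex.norm_real, Real.norm_eq_abs]
  have n5 : ‖(γ : ℂ) - z‖ = |γ - z| := by
    rw [← Complex.ofReal_sub, Complex.norm_real, Real.norm_eq_abs]
  rw [genHat, norm_div, norm_mul, norm_pow, n3, ← hs2]
  have hb : ‖∑ i ∈ Finset.range M, (((γ : ℂ) + z) * (γ + Complex.I * k)) ^ i *
      (((γ : ℂ) - z) * (γ - Complex.I * k)) ^ (M - 1 - i)‖ ≤
      ∑ i ∈ Finset.range M, |γ + z| ^ i * |γ - z| ^ (M - 1 - i) * s ^ (M - 1) := by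
    refine norm_sum_le_of_le _ fun i hi => ?_
    have hi' : i < M := by simpa using hi
    rw [norm_mul, norm_pow, norm_pow, norm_mul, norm_mul, n1, n2, n4, n5, mul_pow, mul_pow]
    have : s ^ (M - 1) = s ^ i * s ^ (M - 1 - i) := by
      rw [← pow_add]
      congr 1
      omega
    rw [this]
    apply le_of_eq
    ring
  have h2g : ‖(2 * γ : ℂ)‖ = 2 * γ := by
    simp [abs_of_pos hγ]
  rw [h2g]
  have hpow : s ^ (M - 1) * ((s ^ 2) ^ M)⁻¹ ≤ (γ ^ (M - 1))⁻¹ * (s ^ 2)⁻¹ := by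
    have e : (s ^ 2) ^ M = s ^ (M - 1) * (s ^ (M - 1) * s ^ 2) := by
      rw [← pow_mul, ← pow_add, ← pow_add]
      congr 1
      omega
    rw [e, mul_inv, mul_inv, ← mul_assoc, mul_inv_cancel₀ (by positivity), one_mul]
    gcongr
  rw [← Finset.sum_mul] at hb
  simp only [C]
  rw [← Finset.sum_mul]
  set S := ∑ i ∈ Finset.range M, |γ + z| ^ i * |γ - z| ^ (M - 1 - i)
  have hS : 0 ≤ S := Finset.sum_nonneg fun i _ => by positivity
  calc _ ≤ 2 * γ * (S * s ^ (M - 1)) / (s ^ 2) ^ M := by gcongr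
    _ = 2 * γ * S * (s ^ (M - 1) * ((s ^ 2) ^ M)⁻¹) := by ring
    _ ≤ 2 * γ * S * ((γ ^ (M - 1))⁻¹ * (s ^ 2)⁻¹) := by gcongr
    _ = _ := by ring

/-- This is Fourier inversion, available because `genFun` is continuous and integrable with
integrable transform. The factor `2π` comes from the substitution `k = -2πξ` between the two
normalizations of the transform. -/
theorem integral_genHat_cexp (M : ℕ) {γ z : ℝ} (hγ : 0 < γ) (hz : z ≠ 0) (x : ℝ) :
    ∫ k : ℝ, genHat M γ z k * Complex.exp (-Complex.I * k * x) =
      2 * Real.pi * genFun M γ z x := by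
  set f : ℝ → ℂ := fun x => (genFun M γ z x : ℂ)
  have hpi : (Real.pi : ℂ) ≠ 0 := by exact_mod_cast Real.pi_ne_zero
  have hf : Integrable f := by
    simpa using integrable_genFun_cexp M hγ z 0
  have hfc : Continuous f := Complex.continuous_ofReal.comp (continuous_genFun M γ z)
  have hF : FourierTransform.fourier f = fun ξ : ℝ => genHat M γ z (-2 * Real.pi * ξ) := by
    ext ξ
    rw [Real.fourier_real_eq_integral_exp_smul, ← integral_genFun_cexp M hγ hz]
    congr 1
    ext v
    rw [smul_eq_mul, mul_comm]
    push_cast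
    congr 2
    ring
  have hFi : Integrable (FourierTransform.fourier f) := by
    rw [hF]
    exact (integrable_genHat M hγ z).comp_mul_left' (by simp [Real.pi_ne_zero])
  have h := congrFun (hfc.fourierInv_fourier_eq hf hFi) x
  rw [hF, Real.fourierInv_eq'] at h
  set G : ℝ → ℂ := fun k => genHat M γ z k * Complex.exp (-Complex.I * k * x)
  have h2 : ∫ ξ : ℝ, G ((-2 * Real.pi) * ξ) = f x := by
    rw [← h]
    congr 1
    ext v
    simp only [G, RCLike.inner_apply, conj_trivial, smul_eq_mul]
    rw [mul_comm]
    push_cast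
    congr 2
    ring
  rw [Measure.integral_comp_mul_left G (-2 * Real.pi)] at h2
  have h3 : |(-2 * Real.pi)⁻¹| = (2 * Real.pi)⁻¹ := by
    rw [abs_inv, neg_mul, abs_neg, abs_of_pos (by positivity)]
  rw [h3] at h2
  change ∫ k, G k = 2 * Real.pi * f x
  rw [← h2, Complex.real_smul]
  push_cast
  field_simp

/-! ### Vandermonde determinants -/

theorem prod_prod_Ioi_const {R : Type*} [CommMonoid R] (M : ℕ) (c : R) :
    ∏ i : Fin M, ∏ _j ∈ Finset.Ioi i, c = c ^ (M * (M - 1) / 2) := by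
  simp only [Finset.prod_const, Fin.card_Ioi]
  rw [Finset.prod_pow_eq_pow_sum, Fin.sum_univ_eq_sum_range (fun i => M - 1 - i),
    Finset.sum_range_reflect (fun i => i), Finset.sum_range_id]

theorem prod_prod_Ioi_mul {R : Type*} [CommMonoid R] {M : ℕ} (c : R) (f : Fin M → Fin M → R) :
    ∏ i : Fin M, ∏ j ∈ Finset.Ioi i, (c * f i j) =
      c ^ (M * (M - 1) / 2) * ∏ i : Fin M, ∏ j ∈ Finset.Ioi i, f i j := by
  rw [← prod_prod_Ioi_const]
  simp only [Finset.prod_mul_distrib]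

theorem det_vandermonde_ofReal {M : ℕ} (k : Fin M → ℝ) :
    (Matrix.vandermonde fun i => (k i : ℂ)).det = ((Matrix.vandermonde k).det : ℂ) := by
  simp [Matrix.det_vandermonde]

theorem det_vandermonde_eq_vandermondeProd {M : ℕ} (x : Fin M → ℝ) :
    (Matrix.vandermonde x).det = (-1) ^ (M * (M - 1) / 2) * vandermondeProd x := by
  rw [Matrix.det_vandermonde, vandermondeProd, ← prod_prod_Ioi_mul]
  simp

theorem det_vandermonde_pos {M : ℕ} {k : Fin M → ℝ} (hk : StrictMono k) :
    0 < (Matrix.vandermonde k).det := by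
  rw [Matrix.det_vandermonde]
  refine Finset.prod_pos fun i _ => Finset.prod_pos fun j hj => ?_
  exact sub_pos.mpr (hk (Finset.mem_Ioi.mp hj))

theorem det_vandermonde_comp_perm {M : ℕ} {R : Type*} [CommRing R] (k : Fin M → R)
    (σ : Equiv.Perm (Fin M)) :
    (Matrix.vandermonde (k ∘ σ)).det = Equiv.Perm.sign σ * (Matrix.vandermonde k).det :=
  Matrix.det_permute σ (Matrix.vandermonde k)

theorem continuous_det_vandermonde (M : ℕ) :
    Continuous fun k : Fin M → ℝ => (Matrix.vandermonde k).det := by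
  simp only [Matrix.det_vandermonde]
  fun_prop

/-- The numerator of `genHat` is a sum over `i` of a function of `z` times a function of `k`, so the
matrix is a product of two projective Vandermonde matrices, up to column factors and the scalar
`2γ`. The factors of their determinants are differences such as `(γ + z_j)(γ - z_i) - (γ + z_i)(γ -
z_j) = 2γ(z_j - z_i)`, which makes each determinant a multiple of an ordinary Vandermonde
determinant. -/
theorem det_genHat {M : ℕ} (γ : ℝ) (z k : Fin M → ℝ) :
    (Matrix.of fun a b => genHat M γ (z a) (k b)).det =
      (2 * γ) ^ M * ((2 * γ) ^ (M * (M - 1) / 2) * (Matrix.vandermonde z).det) *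
      ((2 * γ * Complex.I) ^ (M * (M - 1) / 2) * (Matrix.vandermonde k).det) *
      ∏ b, (((γ : ℂ) ^ 2 + (k b : ℂ) ^ 2) ^ M)⁻¹ := by
  have hm : (Matrix.of fun a b => genHat M γ (z a) (k b)) = Matrix.of fun a b =>
      ((((γ : ℂ) ^ 2 + (k b : ℂ) ^ 2) ^ M)⁻¹) * ((2 * γ : ℂ) •
      (Matrix.projVandermonde (fun a => (γ : ℂ) + z a) (fun a => (γ : ℂ) - z a) *
      (Matrix.projVandermonde (fun b => (γ : ℂ) + Complex.I * k b)
        (fun b => (γ : ℂ) - Complex.I * k b)).transpose)) a b := by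
    ext a b
    simp only [Matrix.of_apply, Matrix.smul_apply, Matrix.mul_apply, Matrix.transpose_apply,
      Matrix.projVandermonde_apply, genHat, smul_eq_mul]
    rw [← Fin.sum_univ_eq_sum_range (fun i => (((γ : ℂ) + z a) * (γ + Complex.I * k b)) ^ i *
      (((γ : ℂ) - z a) * (γ - Complex.I * k b)) ^ (M - 1 - i)), div_eq_inv_mul]
    congr 2
    refine Finset.sum_congr rfl fun i _ => ?_
    rw [mul_pow, mul_pow, Fin.val_rev, Nat.sub_sub, Nat.add_comm 1]
    ring
  rw [hm, Matrix.det_mul_row, Matrix.det_smul, Matrix.det_mul, Matrix.det_transpose,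
    Matrix.det_projVandermonde, Matrix.det_projVandermonde, Fintype.card_fin,
    ← det_vandermonde_ofReal, ← det_vandermonde_ofReal, Matrix.det_vandermonde,
    Matrix.det_vandermonde, ← prod_prod_Ioi_mul, ← prod_prod_Ioi_mul, mul_comm, mul_assoc]
  have e1 : ∀ i j : Fin M, ((γ : ℂ) + z j) * (γ - z i) - (γ + z i) * (γ - z j) =
    2 * γ * (z j - z i) := fun i j => by ring
  have e2 : ∀ i j : Fin M, ((γ : ℂ) + Complex.I * k j) * (γ - Complex.I * k i) -
    (γ + Complex.I * k i) * (γ - Complex.I * k j) =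
    2 * γ * Complex.I * (k j - k i) := fun i j => by ring
  simp only [e1, e2]
  ring

/-! ### Integrals of determinants and symmetrization -/

theorem integrable_prod_perm {ι : Type*} [Fintype ι] [DecidableEq ι]
    {μ : ι → Measure ℝ} [∀ i, SigmaFinite (μ i)]
    {F : ι → ι → ℝ → ℂ} (hF : ∀ a b, Integrable (F a b) (μ b)) (σ : Equiv.Perm ι) :
    Integrable (fun k : ι → ℝ => ∏ b, F (σ b) b (k b)) (Measure.pi μ) :=
  Integrable.fintype_prod_dep fun b => hF (σ b) b

theorem integrable_det {ι : Type*} [Fintype ι] [DecidableEq ι]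
    {μ : ι → Measure ℝ} [∀ i, SigmaFinite (μ i)]
    {F : ι → ι → ℝ → ℂ} (hF : ∀ a b, Integrable (F a b) (μ b)) :
    Integrable (fun k : ι → ℝ => (Matrix.of fun a b => F a b (k b)).det) (Measure.pi μ) := by
  simp only [Matrix.det_apply', Matrix.of_apply]
  exact integrable_finsetSum _ fun σ _ => (integrable_prod_perm hF σ).const_mul _

/-- The integral of a determinant whose columns depend on separate variables. -/
theorem integral_det {ι : Type*} [Fintype ι] [DecidableEq ι]
    {μ : ι → Measure ℝ} [∀ i, SigmaFinite (μ i)]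
    {F : ι → ι → ℝ → ℂ} (hF : ∀ a b, Integrable (F a b) (μ b)) :
    ∫ k : ι → ℝ, (Matrix.of fun a b => F a b (k b)).det ∂(Measure.pi μ) =
      (Matrix.of fun a b => ∫ x, F a b x ∂(μ b)).det := by
  simp only [Matrix.det_apply', Matrix.of_apply]
  rw [integral_finsetSum _ fun σ _ => (integrable_prod_perm hF σ).const_mul _]
  refine Finset.sum_congr rfl fun σ _ => ?_
  rw [integral_const_mul, integral_fintype_prod_eq_prod (fun b => F (σ b) b)]

theorem measurableSet_strictMono (n : ℕ) : MeasurableSet {k : Fin n → ℝ | StrictMono k} := by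
  have : {k : Fin n → ℝ | StrictMono k} = ⋂ i, ⋂ j, ⋂ (_ : i < j), {k | k i < k j} := by
    ext k
    simp [StrictMono]
  rw [this]
  exact MeasurableSet.iInter fun i => MeasurableSet.iInter fun j => MeasurableSet.iInter fun _ =>
    measurableSet_lt (measurable_pi_apply i) (measurable_pi_apply j)

/-- Each coincidence `k i = k j` confines `k` to a proper subspace, which is null. -/
theorem ae_injective (n : ℕ) : ∀ᵐ k : Fin n → ℝ, Function.Injective k := by
  have h : ∀ i j : Fin n, i ≠ j → ∀ᵐ k : Fin n → ℝ, k i ≠ k j := fun i j hij => by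
    let S : Submodule ℝ (Fin n → ℝ) :=
      LinearMap.ker (LinearMap.proj (R := ℝ) (φ := fun _ : Fin n => ℝ) i - LinearMap.proj j)
    have hS : S ≠ ⊤ := fun hS => by
      have : Pi.single i (1 : ℝ) ∈ S := hS ▸ Submodule.mem_top
      simp [S, hij.symm] at this
    have := Measure.addHaar_submodule (volume : Measure (Fin n → ℝ)) S hS
    rw [ae_iff]
    convert this using 2
    ext k
    simp [S, sub_eq_zero]
  have h2 : ∀ᵐ k : Fin n → ℝ, ∀ i j : Fin n, i ≠ j → k i ≠ k j := by
    simp only [ae_all_iff]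
    exact h
  filter_upwards [h2] with k hk i j hij
  by_contra hne
  exact hk i j hne hij

/-- Off a null set the space is the disjoint union of the chambers on which `k ∘ σ` is increasing,
and permuting coordinates preserves Lebesgue measure. -/
theorem integral_strictMono_sum_perm {n : ℕ} {Ψ : (Fin n → ℝ) → ℂ} (hΨ : Integrable Ψ) :
    ∫ k in {k : Fin n → ℝ | StrictMono k}, ∑ σ : Equiv.Perm (Fin n), Ψ (k ∘ σ) =
      ∫ k, Ψ k := by
  have hpres : ∀ σ : Equiv.Perm (Fin n),
      MeasurePreserving (MeasurableEquiv.piCongrLeft (fun _ : Fin n => ℝ) σ.symm)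
        (volume : Measure (Fin n → ℝ)) volume := fun σ =>
    volume_measurePreserving_piCongrLeft (fun _ : Fin n => ℝ) σ.symm
  have happ : ∀ (σ : Equiv.Perm (Fin n)) (k : Fin n → ℝ),
      MeasurableEquiv.piCongrLeft (fun _ : Fin n => ℝ) σ.symm k = k ∘ σ := fun σ k => by
    ext i
    have := Equiv.piCongrLeft_apply_apply (fun _ : Fin n => ℝ) σ.symm k (σ i)
    rw [σ.symm_apply_apply] at this
    exact this
  have hcomp : ∀ σ : Equiv.Perm (Fin n), Integrable fun k : Fin n → ℝ => Ψ (k ∘ σ) := fun σ => by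
    have := ((hpres σ).integrable_comp_emb (MeasurableEquiv.measurableEmbedding _)).mpr hΨ
    refine this.congr (Eventually.of_forall fun k => ?_)
    simp only [Function.comp_apply (f := Ψ), happ]
  let S : Equiv.Perm (Fin n) → Set (Fin n → ℝ) := fun σ => {k | StrictMono (k ∘ σ)}
  have hSm : ∀ σ, MeasurableSet (S σ) := fun σ => by
    have : Measurable fun k : Fin n → ℝ => k ∘ σ :=
      measurable_pi_lambda _ fun i => measurable_pi_apply (σ i)
    exact this (measurableSet_strictMono n)
  have hSd : Pairwise (Function.onFun Disjoint S) := fun σ τ hστ => by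
    refine Set.disjoint_left.mpr fun k h1 h2 => hστ ?_
    have h3 : (k ∘ σ) = k ∘ τ := by
      refine (StrictMono.range_inj h1 h2).mp ?_
      rw [Set.range_comp, Set.range_comp, σ.range_eq_univ, τ.range_eq_univ]
    have hk : Function.Injective k := by
      have := h1.injective.comp σ.symm.injective
      rwa [Function.comp_assoc, σ.self_comp_symm, Function.comp_id] at this
    ext i
    exact congrArg Fin.val (hk (congrFun h3 i))
  have hSu : (⋃ σ, S σ) =ᵐ[volume] Set.univ := by
    rw [eventuallyEq_univ]
    filter_upwards [ae_injective n] with k hk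
    refine Set.mem_iUnion.mpr ⟨Tuple.sort k, ?_⟩
    exact (Tuple.monotone_sort k).strictMono_of_injective (hk.comp (Tuple.sort k).injective)
  -- The sum is reindexed by inversion: pulling the ordered chamber back along `k ↦ k ∘ σ` gives the
  -- chamber of `σ`, and the integrand matches there only if it carries `σ⁻¹`.
  rw [integral_finsetSum _ fun σ _ => (hcomp σ).integrableOn, ← setIntegral_univ,
    ← setIntegral_congr_set hSu, integral_iUnion_fintype hSm hSd fun σ => hΨ.integrableOn,
    ← Equiv.sum_comp (Equiv.inv (Equiv.Perm (Fin n)))]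
  refine Finset.sum_congr rfl fun σ _ => ?_
  rw [← (hpres σ).setIntegral_preimage_emb (MeasurableEquiv.measurableEmbedding _)]
  have hset : MeasurableEquiv.piCongrLeft (fun _ : Fin n => ℝ) σ.symm ⁻¹' {k | StrictMono k} =
      S σ := by
    ext k
    simp only [S, Set.mem_preimage, Set.mem_ofPred_eq, happ]
  rw [hset]
  refine setIntegral_congr_fun (hSm σ) fun k _ => ?_
  simp only [happ]
  congr 1
  ext i
  simp

/-! ### The eigenvalue integral of the Cauchy weight -/

/-- The Cauchy weight `∏ (γ² + (k - s)²)^(-M)` in terms of eigenvalues. -/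
def eigWeight {M : ℕ} (γ s : ℝ) (k : Fin M → ℝ) : ℝ := ∏ b, ((γ ^ 2 + (k b - s) ^ 2) ^ M)⁻¹

theorem eigWeight_nonneg {M : ℕ} (γ s : ℝ) (k : Fin M → ℝ) : 0 ≤ eigWeight γ s k :=
  Finset.prod_nonneg fun b _ => by positivity

theorem continuous_eigWeight {M : ℕ} {γ : ℝ} (hγ : 0 < γ) (s : ℝ) :
    Continuous (eigWeight γ s : (Fin M → ℝ) → ℝ) := by
  unfold eigWeight
  refine continuous_finsetProd _ fun b _ => Continuous.inv₀ (by fun_prop) fun k => ?_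
  positivity

theorem eigWeight_comp_perm {M : ℕ} (γ s : ℝ) (k : Fin M → ℝ) (σ : Equiv.Perm (Fin M)) :
    eigWeight γ s (k ∘ σ) = eigWeight γ s k :=
  Equiv.prod_comp σ fun b => ((γ ^ 2 + (k b - s) ^ 2) ^ M)⁻¹

/-- Sample points at which generating functions are evaluated. -/
def samplePoint {M : ℕ} (a : Fin M) : ℝ := (a : ℝ) + 1

theorem samplePoint_ne_zero {M : ℕ} (a : Fin M) : samplePoint a ≠ 0 := by
  unfold samplePoint
  positivity

theorem strictMono_samplePoint (M : ℕ) : StrictMono (samplePoint : Fin M → ℝ) := fun a b h => by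
  have : (a : ℝ) < b := by exact_mod_cast h
  simpa [samplePoint] using this

/-- The constant relating `eigWeight` times the Vandermonde determinant to `genHat`. -/
def genConst (M : ℕ) (γ : ℝ) : ℂ :=
  (2 * γ) ^ M * ((2 * γ) ^ (M * (M - 1) / 2) *
    (Matrix.vandermonde (samplePoint : Fin M → ℝ)).det) * (2 * γ * Complex.I) ^ (M * (M - 1) / 2)

theorem genConst_ne_zero (M : ℕ) {γ : ℝ} (hγ : 0 < γ) : genConst M γ ≠ 0 := by
  have h1 : (γ : ℂ) ≠ 0 := by exact_mod_cast hγ.ne'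
  have h2 : ((Matrix.vandermonde (samplePoint : Fin M → ℝ)).det : ℂ) ≠ 0 := by
    exact_mod_cast (det_vandermonde_pos (strictMono_samplePoint M)).ne'
  simp [genConst, h1, h2]

/-- This separates the eigenvalues: the product weight and one Vandermonde factor merge into a
single determinant whose column `b` involves only `k b`. The Vandermonde determinant is unchanged by
the shift by `s`. -/
theorem eigWeight_mul_vandermonde {M : ℕ} {γ : ℝ} (hγ : 0 < γ) (s : ℝ) (k : Fin M → ℝ) :
    ((eigWeight γ s k * (Matrix.vandermonde k).det : ℝ) : ℂ) = (genConst M γ)⁻¹ *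
      (Matrix.of fun a b => genHat M γ (samplePoint a) (k b - s)).det := by
  rw [det_genHat γ samplePoint fun b => k b - s, Matrix.det_vandermonde_sub,
    eq_inv_mul_iff_mul_eq₀ (genConst_ne_zero M hγ), genConst, eigWeight]
  push_cast
  ring

theorem integrable_genHat_sub_cexp (M : ℕ) {γ : ℝ} (hγ : 0 < γ) (s z x : ℝ) :
    Integrable fun k : ℝ => genHat M γ z (k - s) * Complex.exp (-Complex.I * k * x) := by
  refine ((integrable_genHat M hγ z).comp_sub_right s).mul_bdd (c := 1)
    (by fun_prop) (Eventually.of_forall fun k => ?_)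
  simp [Complex.norm_exp]

theorem integral_genHat_sub_cexp (M : ℕ) {γ z : ℝ} (hγ : 0 < γ) (hz : z ≠ 0) (s x : ℝ) :
    ∫ k : ℝ, genHat M γ z (k - s) * Complex.exp (-Complex.I * k * x) =
      2 * Real.pi * Complex.exp (-Complex.I * s * x) * genFun M γ z x := by
  have h : ∀ k : ℝ, genHat M γ z (k - s) * Complex.exp (-Complex.I * k * x) =
      (fun k : ℝ => Complex.exp (-Complex.I * s * x) *
        (genHat M γ z k * Complex.exp (-Complex.I * k * x))) (k - s) := fun k => by
    simp only
    rw [mul_left_comm, ← Complex.exp_add]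
    congr 2
    push_cast
    ring
  simp_rw [h]
  rw [integral_sub_right_eq_self (fun k : ℝ => Complex.exp (-Complex.I * s * x) *
        (genHat M γ z k * Complex.exp (-Complex.I * k * x))) s, integral_const_mul,
    integral_genHat_cexp M hγ hz]
  ring

/-- By `genFun_eq_sum` the matrix is the Vandermonde matrix in `z` times the matrix of the `g`, with
row `n` divided by `n!`. -/
theorem det_genFun {M : ℕ} {γ : ℝ} (hγ : 0 < γ) (z x : Fin M → ℝ) :
    (Matrix.of fun a b => genFun M γ (z a) (x b)).det =
      (Matrix.vandermonde z).det * (∏ n : Fin M, ((n : ℕ).factorial : ℝ))⁻¹ *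
      (Matrix.of fun i j : Fin M => gFun M γ (M - 1 - i) (x j)).det := by
  have : (Matrix.of fun a b => genFun M γ (z a) (x b)) =
      Matrix.vandermonde z * Matrix.of fun i j : Fin M =>
        ((i : ℕ).factorial : ℝ)⁻¹ * (Matrix.of fun i j : Fin M => gFun M γ (M - 1 - i) (x j)) i j
      := by
    ext a b
    simp only [Matrix.of_apply, Matrix.mul_apply, Matrix.vandermonde_apply, genFun_eq_sum M hγ]
    rw [← Fin.sum_univ_eq_sum_range
      (fun n => z a ^ n / (n.factorial : ℝ) * gFun M γ (M - 1 - n) (x b))]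
    refine Finset.sum_congr rfl fun i _ => ?_
    ring
  rw [this, Matrix.det_mul, Matrix.det_mul_column, Finset.prod_inv_distrib]
  ring

theorem det_mul_prod_column {M : ℕ} (A : Fin M → Fin M → ℂ) (v : Fin M → ℂ) :
    (Matrix.of fun a b => A a b).det * ∏ b, v b = (Matrix.of fun a b => A a b * v b).det := by
  rw [mul_comm, ← Matrix.det_mul_row]
  simp [mul_comm]

theorem eigWeight_mul_vandermonde_mul_prod {M : ℕ} {γ : ℝ} (hγ : 0 < γ) (s : ℝ)
    (x k : Fin M → ℝ) :
    ((eigWeight γ s k * (Matrix.vandermonde k).det : ℝ) : ℂ) *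
      ∏ b, Complex.exp (-Complex.I * k b * x b) = (genConst M γ)⁻¹ *
    (Matrix.of fun a b => genHat M γ (samplePoint a) (k b - s) *
      Complex.exp (-Complex.I * k b * x b)).det := by
  rw [eigWeight_mul_vandermonde hγ, mul_assoc, det_mul_prod_column]

theorem integrable_eigWeight_mul_vandermonde_cexp {M : ℕ} {γ : ℝ} (hγ : 0 < γ) (s : ℝ)
    (x : Fin M → ℝ) :
    Integrable fun k : Fin M → ℝ => ((eigWeight γ s k * (Matrix.vandermonde k).det : ℝ) : ℂ) *
      ∏ b, Complex.exp (-Complex.I * k b * x b) := by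
  simp_rw [eigWeight_mul_vandermonde_mul_prod hγ]
  exact (integrable_det fun a b => integrable_genHat_sub_cexp M hγ s (samplePoint a) (x b)).const_mul _

/-- Integrating column by column turns each `genHat` back into `genFun`. The Vandermonde determinant
of the sample points occurs both in `genConst` and in `det_genFun` and cancels, so their choice is
immaterial. The exponent of `2γ` is `M + 2 · M(M-1)/2 = M²`. -/
theorem integral_eigWeight_mul_vandermonde_cexp {M : ℕ} {γ : ℝ} (hγ : 0 < γ) (s : ℝ)
    (x : Fin M → ℝ) :
    ∫ k : Fin M → ℝ, ((eigWeight γ s k * (Matrix.vandermonde k).det : ℝ) : ℂ) *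
      ∏ b, Complex.exp (-Complex.I * k b * x b) =
    (2 * Real.pi) ^ M / ((2 * γ) ^ (M ^ 2) * Complex.I ^ (M * (M - 1) / 2) *
      ∏ n : Fin M, ((n : ℕ).factorial : ℂ)) * Complex.exp (-Complex.I * s * ∑ b, (x b : ℂ)) *
      ((Matrix.of fun i j : Fin M => gFun M γ (M - 1 - i) (x j)).det : ℝ) := by
  simp_rw [eigWeight_mul_vandermonde_mul_prod hγ]
  rw [integral_const_mul]
  have h := integral_det (μ := fun _ : Fin M => (volume : Measure ℝ))
    fun a b => integrable_genHat_sub_cexp M hγ s (samplePoint a) (x b)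
  rw [← volume_pi] at h
  rw [h]
  simp_rw [integral_genHat_sub_cexp M hγ (samplePoint_ne_zero _) s]
  have hdet := Matrix.det_mul_row (fun b => 2 * Real.pi * Complex.exp (-Complex.I * s * x b))
    (Matrix.of fun a b : Fin M => (genFun M γ (samplePoint a) (x b) : ℂ))
  simp only [Matrix.of_apply] at hdet
  rw [hdet]
  have hc : (Matrix.of fun a b : Fin M => (genFun M γ (samplePoint a) (x b) : ℂ)).det =
      ((Matrix.of fun a b : Fin M => genFun M γ (samplePoint a) (x b)).det : ℝ) := by
    have := (Complex.ofRealHom.map_det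
      (Matrix.of fun a b : Fin M => genFun M γ (samplePoint a) (x b))).symm
    simpa [RingHom.mapMatrix_apply, Matrix.map] using this
  rw [hc, det_genFun hγ, Finset.prod_mul_distrib, Finset.prod_const, Finset.card_univ,
    Fintype.card_fin, ← Complex.exp_sum, ← Finset.mul_sum]
  have h1 : (γ : ℂ) ≠ 0 := by exact_mod_cast hγ.ne'
  have h2 : ((Matrix.vandermonde (samplePoint : Fin M → ℝ)).det : ℂ) ≠ 0 := by
    exact_mod_cast (det_vandermonde_pos (strictMono_samplePoint M)).ne'
  have h3 : (∏ n : Fin M, ((n : ℕ).factorial : ℂ)) ≠ 0 :=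
    Finset.prod_ne_zero_iff.mpr fun n _ => by exact_mod_cast Nat.factorial_ne_zero _
  have hN : M * (M - 1) / 2 * 2 = M * (M - 1) :=
    Nat.div_mul_cancel (Nat.even_mul_pred_self M).two_dvd
  have hsq : M ^ 2 = M + M * (M - 1) / 2 + M * (M - 1) / 2 := by
    have : M ^ 2 = M + M * (M - 1) := by
      rcases M with _ | m
      · simp
      · simp only [Nat.add_sub_cancel]
        ring
    omega
  rw [hsq, genConst, pow_add, pow_add, mul_pow _ Complex.I]
  push_cast
  have hI := Complex.I_ne_zero
  field_simp

/-- In the Leibniz expansion of the exponential determinant, the sign of each permutation is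
absorbed by the antisymmetry of the Vandermonde factor. The integral over ordered sequences thereby
becomes one over the whole space. -/
theorem strictMono_integrand_eq_sum {M : ℕ} (γ s : ℝ) (x k : Fin M → ℝ) :
    ((eigWeight γ s k * (Matrix.vandermonde k).det : ℝ) : ℂ) *
      (Matrix.of fun i j : Fin M => Complex.exp (-Complex.I * k i * x j)).det =
    ∑ σ : Equiv.Perm (Fin M), (fun k : Fin M → ℝ =>
      ((eigWeight γ s k * (Matrix.vandermonde k).det : ℝ) : ℂ) *
      ∏ b, Complex.exp (-Complex.I * k b * x b)) (k ∘ σ) := by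
  rw [Matrix.det_apply' (Matrix.of fun i j : Fin M => Complex.exp (-Complex.I * k i * x j)),
    Finset.mul_sum]
  refine Finset.sum_congr rfl fun σ _ => ?_
  simp only [eigWeight_comp_perm, det_vandermonde_comp_perm, Matrix.of_apply, Function.comp_apply]
  push_cast
  ring

/-- The weight times one Vandermonde factor is integrable (take all frequencies zero in the
preceding result), and a determinant with unimodular entries is at most `M!` in modulus. -/
theorem integrableOn_strictMono_eigWeight {M : ℕ} {γ : ℝ} (hγ : 0 < γ) (s : ℝ)
    (x : Fin M → ℝ) :
    Integrable fun k : Fin M → ℝ => ((eigWeight γ s k * (Matrix.vandermonde k).det : ℝ) : ℂ) *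
      (Matrix.of fun i j : Fin M => Complex.exp (-Complex.I * k i * x j)).det := by
  have h := (integrable_eigWeight_mul_vandermonde_cexp (M := M) hγ s 0).mul_bdd
    (c := Fintype.card (Equiv.Perm (Fin M)))
    (g := fun k : Fin M → ℝ =>
      (Matrix.of fun i j : Fin M => Complex.exp (-Complex.I * k i * x j)).det)
    (Continuous.aestronglyMeasurable (by fun_prop)) (Eventually.of_forall fun k => ?_)
  · simpa only [Pi.zero_apply, Complex.ofReal_zero, mul_zero, Complex.exp_zero,
      Finset.prod_const_one, mul_one] using h
  · rw [Matrix.det_apply']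
    have hle : ∀ σ ∈ (Finset.univ : Finset (Equiv.Perm (Fin M))), ‖(Equiv.Perm.sign σ : ℂ) *
        ∏ i, (Matrix.of fun i j : Fin M => Complex.exp (-Complex.I * k i * x j)) (σ i) i‖ ≤
        (1 : ℝ) := fun σ _ => by
      rw [norm_mul, norm_prod]
      rcases Int.units_eq_one_or (Equiv.Perm.sign σ) with h | h <;> simp [h, Complex.norm_exp]
    have := norm_sum_le_of_le _ hle
    rwa [Finset.sum_const, nsmul_eq_mul, mul_one, Finset.card_univ] at this

theorem integral_strictMono_eigWeight {M : ℕ} {γ : ℝ} (hγ : 0 < γ) (s : ℝ)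
    (x : Fin M → ℝ) :
    ∫ k in {k : Fin M → ℝ | StrictMono k},
      ((eigWeight γ s k * (Matrix.vandermonde k).det : ℝ) : ℂ) *
      (Matrix.of fun i j : Fin M => Complex.exp (-Complex.I * k i * x j)).det =
    (2 * Real.pi) ^ M / ((2 * γ) ^ (M ^ 2) * Complex.I ^ (M * (M - 1) / 2) *
      ∏ n : Fin M, ((n : ℕ).factorial : ℂ)) * Complex.exp (-Complex.I * s * ∑ b, (x b : ℂ)) *
      ((Matrix.of fun i j : Fin M => gFun M γ (M - 1 - i) (x j)).det : ℝ) := by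
  simp_rw [strictMono_integrand_eq_sum]
  rw [integral_strictMono_sum_perm (integrable_eigWeight_mul_vandermonde_cexp hγ s x),
    integral_eigWeight_mul_vandermonde_cexp hγ]

/-- With `q(t) = γ² + (t - s)²`, each pair satisfies `(k_j - k_i)² ≤ γ⁻² q(k_i) q(k_j)`. Every index
lies in `M - 1` pairs, so the squared Vandermonde uses up `M - 1` of the `M` powers of `q⁻¹` and
leaves the integrable `∏ q(k_b)⁻¹`. -/
theorem integrable_eigWeight_mul_vandermonde_sq {M : ℕ} (hM : 1 ≤ M) {γ : ℝ} (hγ : 0 < γ)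
    (s : ℝ) :
    Integrable fun k : Fin M → ℝ => eigWeight γ s k * (Matrix.vandermonde k).det ^ 2 := by
  set q : ℝ → ℝ := fun t => γ ^ 2 + (t - s) ^ 2
  have hq : ∀ t, 0 < q t := fun t => by positivity
  have hI : Integrable fun k : Fin M → ℝ => ∏ b, (q (k b))⁻¹ :=
    Integrable.fintype_prod fun _ => (integrable_inv_sq_add_sq hγ).comp_sub_right s
  refine (hI.const_mul ((γ ^ 2)⁻¹ ^ (M * (M - 1) / 2))).mono'
    ((continuous_eigWeight hγ s).mul ((continuous_det_vandermonde M).pow 2)).aestronglyMeasurable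
    (Eventually.of_forall fun k => ?_)
  have hV : (Matrix.vandermonde k).det ^ 2 ≤
      (γ ^ 2)⁻¹ ^ (M * (M - 1) / 2) * ∏ b, q (k b) ^ (M - 1) := by
    have hprod : ∏ b, q (k b) ^ (M - 1) = ∏ i, ∏ j ∈ Finset.Ioi i, (q (k i) * q (k j)) := by
      rw [Finset.prod_congr rfl fun i _ => Finset.prod_mul_distrib, Finset.prod_mul_distrib]
      have : ∏ i, ∏ j ∈ Finset.Ioi i, q (k j) = ∏ j, ∏ _i ∈ Finset.Iio j, q (k j) :=
        Finset.prod_comm' fun i j => by simp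
      rw [this, ← Finset.prod_mul_distrib]
      refine Finset.prod_congr rfl fun i _ => ?_
      rw [Finset.prod_const, Finset.prod_const, ← pow_add, Fin.card_Ioi, Fin.card_Iio]
      congr 1
      omega
    rw [hprod, Matrix.det_vandermonde, ← Finset.prod_pow, ← prod_prod_Ioi_mul]
    refine Finset.prod_le_prod (fun i _ => sq_nonneg _) fun i _ => ?_
    rw [← Finset.prod_pow]
    refine Finset.prod_le_prod (fun j _ => sq_nonneg _) fun j _ => ?_
    rw [le_inv_mul_iff₀ (by positivity)]
    simp only [q]
    -- With `u = k i - s` and `v = k j - s`: `(γ² + u²)(γ² + v²) - γ²(u - v)² = (γ² + uv)²`.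
    nlinarith [sq_nonneg (γ ^ 2 + (k i - s) * (k j - s))]
  rw [Real.norm_of_nonneg (mul_nonneg (eigWeight_nonneg _ _ _) (sq_nonneg _))]
  calc eigWeight γ s k * (Matrix.vandermonde k).det ^ 2
      ≤ eigWeight γ s k * ((γ ^ 2)⁻¹ ^ (M * (M - 1) / 2) * ∏ b, q (k b) ^ (M - 1)) :=
        mul_le_mul_of_nonneg_left hV (eigWeight_nonneg _ _ _)
    _ = (γ ^ 2)⁻¹ ^ (M * (M - 1) / 2) * (eigWeight γ s k * ∏ b, q (k b) ^ (M - 1)) := by ring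
    _ = _ := by
      rw [eigWeight, ← Finset.prod_mul_distrib]
      congr 1
      refine Finset.prod_congr rfl fun b _ => ?_
      change (q (k b) ^ M)⁻¹ * q (k b) ^ (M - 1) = _
      have : q (k b) ^ M = q (k b) ^ (M - 1) * q (k b) := by
        rw [← pow_succ, Nat.sub_add_cancel hM]
      have := (hq (k b)).ne'
      rw [‹q (k b) ^ M = _›]
      field_simp

/-! ### Interlacing sequences and the change of variables from the border to the eigenvalues -/

/-- The real sequence `k` strictly interlaces `a`. -/
def Interlaces {n : ℕ} (a : Fin n → ℝ) (k : Fin (n + 1) → ℝ) : Prop :=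
  ∀ i : Fin n, k i.castSucc < a i ∧ a i < k i.succ

theorem Interlaces.strictMono_right {n : ℕ} {a : Fin n → ℝ} {k : Fin (n + 1) → ℝ}
    (h : Interlaces a k) : StrictMono k :=
  Fin.strictMono_iff_lt_succ.mpr fun i => (h i).1.trans (h i).2

theorem Interlaces.strictMono_left {n : ℕ} {a : Fin n → ℝ} {k : Fin (n + 1) → ℝ}
    (h : Interlaces a k) : StrictMono a := fun i j hij =>
  (h i).2.trans_le ((h.strictMono_right.monotone (by
    rw [Fin.le_def]
    simpa using hij)).trans (h j).1.le)

theorem Interlaces.sub_pos {n : ℕ} {a : Fin n → ℝ} {k : Fin (n + 1) → ℝ}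
    (h : Interlaces a k) (j : Fin n) {i : Fin (n + 1)} (hi : (i : ℕ) < j + 1) : 0 < a j - k i :=
  _root_.sub_pos.mpr ((h.strictMono_right.monotone (by
    rw [Fin.le_def]
    simpa using Nat.lt_succ_iff.mp hi)).trans_lt (h j).1)

theorem Interlaces.sub_neg {n : ℕ} {a : Fin n → ℝ} {k : Fin (n + 1) → ℝ}
    (h : Interlaces a k) (j : Fin n) {i : Fin (n + 1)} (hi : (j : ℕ) + 1 ≤ i) : a j - k i < 0 :=
  _root_.sub_neg.mpr ((h j).2.trans_le (h.strictMono_right.monotone (by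
    rw [Fin.le_def]
    simpa using hi)))

theorem neg_one_pow_mul_prod_pos {m c : ℕ} (hc : c ≤ m) {f : Fin m → ℝ}
    (hpos : ∀ i : Fin m, (i : ℕ) < c → 0 < f i) (hneg : ∀ i : Fin m, c ≤ (i : ℕ) → f i < 0) :
    0 < (-1) ^ (m - c) * ∏ i, f i := by
  have h : ∏ i : Fin m, (if (i : ℕ) < c then (1 : ℝ) else -1) = (-1) ^ (m - c) := by
    rw [Fin.prod_univ_eq_prod_range (fun i => if i < c then (1 : ℝ) else -1),
      ← Finset.prod_range_mul_prod_Ico _ hc,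
      Finset.prod_eq_one fun i hi => if_pos (Finset.mem_range.mp hi), one_mul,
      Finset.prod_congr rfl fun i hi => if_neg (not_lt.mpr (Finset.mem_Ico.mp hi).1)]
    simp
  rw [← h, ← Finset.prod_mul_distrib]
  refine Finset.prod_pos fun i _ => ?_
  split_ifs with hi
  · simpa using hpos i hi
  · simpa using hneg i (not_lt.mp hi)

/-- The derivative at the node `a j` of the monic polynomial with roots `a`. -/
def nodeDeriv {n : ℕ} (a : Fin n → ℝ) (j : Fin n) : ℝ := ∏ l ∈ Finset.univ.erase j, (a j - a l)

theorem nodeDeriv_sign {n : ℕ} {a : Fin n → ℝ} (ha : StrictMono a) (j : Fin n) :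
    0 < (-1) ^ (n - (j + 1)) * nodeDeriv a j := by
  have h : nodeDeriv a j = ∏ l, if l = j then 1 else a j - a l := by
    rw [nodeDeriv, ← Finset.mul_prod_erase Finset.univ _ (Finset.mem_univ j), if_pos rfl, one_mul]
    exact Finset.prod_congr rfl fun l hl => (if_neg (Finset.ne_of_mem_erase hl)).symm
  rw [h]
  refine neg_one_pow_mul_prod_pos j.2 (fun i hi => ?_) fun i hi => ?_
  · split_ifs with hij
    · exact one_pos
    · refine sub_pos.mpr (ha (lt_of_le_of_ne ?_ hij))
      exact Fin.le_def.mpr (Nat.lt_succ_iff.mp hi)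
  · have : j < i := Fin.lt_def.mpr hi
    rw [if_neg this.ne']
    exact sub_neg.mpr (ha this)

theorem nodeDeriv_ne_zero {n : ℕ} {a : Fin n → ℝ} (ha : StrictMono a) (j : Fin n) :
    nodeDeriv a j ≠ 0 := fun h => by
  have := nodeDeriv_sign ha j
  simp [h] at this

/-- The product runs over ordered pairs, so it contains every difference twice, up to sign. -/
theorem abs_prod_nodeDeriv {n : ℕ} (a : Fin n → ℝ) :
    |∏ j, nodeDeriv a j| = (Matrix.vandermonde a).det ^ 2 := by
  have h : ∀ j, nodeDeriv a j = (∏ l ∈ Finset.Iio j, (a j - a l)) *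
      ∏ l ∈ Finset.Ioi j, (a j - a l) := fun j => by
    rw [nodeDeriv, ← Finset.prod_union]
    · congr 1
      ext l
      simp [lt_or_lt_iff_ne]
    · exact Finset.disjoint_left.mpr fun l h1 h2 =>
        lt_asymm (Finset.mem_Iio.mp h1) (Finset.mem_Ioi.mp h2)
  simp_rw [h]
  rw [Finset.prod_mul_distrib]
  have h2 : ∏ j, ∏ l ∈ Finset.Iio j, (a j - a l) = (Matrix.vandermonde a).det := by
    rw [Matrix.det_vandermonde]
    exact Finset.prod_comm' fun i j => by simp
  have h3 : |∏ j, ∏ l ∈ Finset.Ioi j, (a j - a l)| = |(Matrix.vandermonde a).det| := by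
    rw [Matrix.det_vandermonde]
    simp only [Finset.abs_prod]
    exact Finset.prod_congr rfl fun i _ => Finset.prod_congr rfl fun j _ => abs_sub_comm _ _
  rw [abs_mul, h2, h3, ← sq, sq_abs]

/-- Coordinates `(d, π|b|²)` of the last step of a bordered matrix in terms of its eigenvalues. -/
def borderCoord {n : ℕ} (a : Fin n → ℝ) (k : Fin (n + 1) → ℝ) : Fin (n + 1) → ℝ :=
  Fin.cons (∑ i, k i - ∑ j, a j) fun j => -Real.pi * (∏ i, (a j - k i)) / nodeDeriv a j

/-- The Jacobian matrix of `borderCoord`. -/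
def borderJac {n : ℕ} (a : Fin n → ℝ) (k : Fin (n + 1) → ℝ) :
    Matrix (Fin (n + 1)) (Fin (n + 1)) ℝ :=
  Matrix.of fun m i => (Fin.cons (1 : ℝ) fun j =>
    Real.pi * (∏ l ∈ Finset.univ.erase i, (a j - k l)) / nodeDeriv a j : Fin (n + 1) → ℝ) m

theorem hasFDerivAt_borderCoord {n : ℕ} (a : Fin n → ℝ) (k : Fin (n + 1) → ℝ) :
    HasFDerivAt (borderCoord a) (Matrix.toLin' (borderJac a k)).toContinuousLinearMap k := by
  rw [hasFDerivAt_pi']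
  intro m
  have happ : ∀ v, (Matrix.toLin' (borderJac a k)).toContinuousLinearMap v m =
      ∑ i, borderJac a k m i * v i := fun v => by
    simp [Matrix.mulVec, dotProduct]
  refine Fin.cases ?_ (fun j => ?_) m
  · have h : HasFDerivAt (fun k : Fin (n + 1) → ℝ => ∑ i, k i - ∑ j, a j)
        (∑ i, ContinuousLinearMap.proj (R := ℝ) (φ := fun _ : Fin (n + 1) => ℝ) i) k :=
      (HasFDerivAt.fun_sum fun i _ =>
        (ContinuousLinearMap.proj (R := ℝ) (φ := fun _ : Fin (n + 1) => ℝ) i).hasFDerivAt).sub_const _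
    refine h.congr_fderiv ?_
    ext v
    simp [borderJac, Matrix.mulVec, dotProduct]
  · have h : HasFDerivAt (fun k : Fin (n + 1) → ℝ => -Real.pi * (∏ i, (a j - k i)) / nodeDeriv a j)
        ((nodeDeriv a j)⁻¹ • (-Real.pi) • ∑ i, (∏ l ∈ Finset.univ.erase i, (a j - k l)) •
          (-ContinuousLinearMap.proj (R := ℝ) (φ := fun _ : Fin (n + 1) => ℝ) i)) k := by
      have h1 := HasFDerivAt.finsetProd (u := Finset.univ) (x := k)
        (g := fun (i : Fin (n + 1)) (k : Fin (n + 1) → ℝ) => a j - k i)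
        (g' := fun i => -ContinuousLinearMap.proj (R := ℝ) (φ := fun _ : Fin (n + 1) => ℝ) i)
        fun i _ => (ContinuousLinearMap.proj (R := ℝ)
          (φ := fun _ : Fin (n + 1) => ℝ) i).hasFDerivAt.const_sub _
      have h2 := (h1.const_mul (-Real.pi)).const_mul ((nodeDeriv a j)⁻¹)
      refine h2.congr_of_eventuallyEq (Eventually.of_forall fun k => ?_)
      simp only
      ring
    refine h.congr_fderiv ?_
    ext v
    simp [borderJac, Matrix.mulVec, dotProduct, Finset.mul_sum]
    refine Finset.sum_congr rfl fun i _ => ?_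
    ring

/-- Column `i` records the polynomial `L i = ∏_{l≠i} (t - k l)`: its leading coefficient in the
first row and its values at the nodes `a j` below, scaled by `π / nodeDeriv a j`. The matrix is thus
a row scaling of `W * C`, with `C` the coefficients of the `L i`. The factors contribute `π^n /
V(a)²`, `V(a)` and `V(k)` in absolute value. -/
theorem abs_det_borderJac {n : ℕ} {a : Fin n → ℝ} {k : Fin (n + 1) → ℝ} (h : Interlaces a k) :
    |(borderJac a k).det| =
      Real.pi ^ n * (Matrix.vandermonde k).det / (Matrix.vandermonde a).det := by
  have ha := h.strictMono_left
  have hk := h.strictMono_right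
  let L : Fin (n + 1) → Polynomial ℝ := fun i =>
    ∏ l ∈ Finset.univ.erase i, (Polynomial.X - Polynomial.C (k l))
  have hcard : ∀ i : Fin (n + 1), (Finset.univ.erase i).card = n := fun i => by simp
  have hLm : ∀ i, (L i).Monic := fun i =>
    Polynomial.monic_prod_of_monic _ _ fun l _ => Polynomial.monic_X_sub_C _
  have hLd : ∀ i, (L i).natDegree = n := fun i => by
    rw [Polynomial.natDegree_finsetProd_X_sub_C_eq_card, hcard]
  have hLe : ∀ i t, (L i).eval t = ∏ l ∈ Finset.univ.erase i, (t - k l) := fun i t => by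
    simp [L, Polynomial.eval_prod]
  have hLs : ∀ i t, (L i).eval t = ∑ m : Fin (n + 1), t ^ (m : ℕ) * (L i).coeff m := fun i t => by
    rw [Polynomial.eval_eq_sum_range, hLd,
      Fin.sum_univ_eq_sum_range (fun m => t ^ m * (L i).coeff m)]
    exact Finset.sum_congr rfl fun m _ => mul_comm _ _
  let C : Matrix (Fin (n + 1)) (Fin (n + 1)) ℝ := Matrix.of fun m i => (L i).coeff m
  -- The extra node `(1 : 0)` is the point at infinity, and its row picks out the leading
  -- coefficient.
  let W := Matrix.projVandermonde (Fin.cons 1 a : Fin (n + 1) → ℝ)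
    (Fin.cons 0 fun _ => 1 : Fin (n + 1) → ℝ)
  have hJ : borderJac a k = Matrix.of fun m i =>
      (Fin.cons 1 fun j => Real.pi * (nodeDeriv a j)⁻¹ : Fin (n + 1) → ℝ) m * (W * C) m i := by
    ext m i
    simp only [borderJac, Matrix.of_apply, Matrix.mul_apply, W, C, Matrix.projVandermonde_apply]
    refine Fin.cases ?_ (fun j => ?_) m
    · simp only [Fin.cons_zero, one_pow, one_mul]
      rw [Finset.sum_eq_single (Fin.last n)]
      · have := (hLm i).coeff_natDegree
        rw [hLd] at this
        simp [this]
      · intro b _ hb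
        have : ((Fin.rev b : Fin (n + 1)) : ℕ) ≠ 0 := by
          intro h0
          apply hb
          rw [← Fin.rev_rev b]
          have : Fin.rev b = 0 := Fin.ext h0
          rw [this, Fin.rev_zero]
        rw [zero_pow this, zero_mul]
      · simp
    · simp only [Fin.cons_succ, one_pow, mul_one]
      rw [← hLs, hLe]
      ring
  have hC : |C.det| = (Matrix.vandermonde k).det := by
    -- `L i` vanishes at every `k l` with `l ≠ i`, so its values at the nodes `k` form a diagonal
    -- matrix. Taking determinants gives `V(k) |det C| = V(k)²`.
    have h1 : Matrix.vandermonde k * C = Matrix.diagonal fun i => nodeDeriv k i := by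
      ext l i
      simp only [Matrix.mul_apply, Matrix.vandermonde_apply, C, Matrix.of_apply]
      rw [← hLs, hLe]
      by_cases hli : l = i
      · subst hli
        simp [nodeDeriv]
      · rw [Matrix.diagonal_apply_ne _ hli]
        exact Finset.prod_eq_zero (Finset.mem_erase.mpr ⟨hli, Finset.mem_univ _⟩) (sub_self _)
    have h2 := congrArg (fun A => |A.det|) h1
    simp only [Matrix.det_mul, Matrix.det_diagonal, abs_mul, abs_prod_nodeDeriv] at h2
    have hp := det_vandermonde_pos hk
    rw [abs_of_pos hp, sq] at h2
    exact mul_left_cancel₀ hp.ne' h2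
  have hW : |W.det| = (Matrix.vandermonde a).det := by
    rw [Matrix.det_projVandermonde, Fin.prod_univ_succ, abs_mul]
    have h1 : |∏ j ∈ Finset.Ioi (0 : Fin (n + 1)), ((Fin.cons 1 a : Fin (n + 1) → ℝ) j *
        (Fin.cons 0 fun _ => 1 : Fin (n + 1) → ℝ) 0 - (Fin.cons 1 a : Fin (n + 1) → ℝ) 0 *
        (Fin.cons 0 fun _ => 1 : Fin (n + 1) → ℝ) j)| = 1 := by
      rw [Finset.abs_prod]
      refine Finset.prod_eq_one fun j hj => ?_
      obtain ⟨j', rfl⟩ := Fin.exists_succ_eq.mpr (Finset.mem_Ioi.mp hj).ne'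
      simp
    rw [h1, one_mul, ← abs_of_pos (det_vandermonde_pos ha), Matrix.det_vandermonde]
    congr 1
    refine Finset.prod_congr rfl fun i _ => ?_
    rw [Fin.prod_Ioi_succ]
    simp
  rw [hJ, Matrix.det_mul_column, Matrix.det_mul, abs_mul, abs_mul, hC, hW, Fin.prod_univ_succ]
  simp only [Fin.cons_zero, Fin.cons_succ, one_mul]
  rw [Finset.prod_mul_distrib, Finset.prod_const, Finset.prod_inv_distrib, abs_mul, abs_inv,
    abs_prod_nodeDeriv, Finset.card_univ, Fintype.card_fin, abs_of_pos (pow_pos Real.pi_pos n)]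
  have := (det_vandermonde_pos ha).ne'
  field_simp

/-- Two monic polynomials of degree `n + 1` agree if they agree at `n` points and in the
coefficient of degree `n`. -/
theorem monic_eq_of_eval_eq {K : Type*} [Field K] {n : ℕ} {P Q : Polynomial K}
    (hP : P.Monic) (hQ : Q.Monic) (hPd : P.natDegree = n + 1) (hQd : Q.natDegree = n + 1)
    (hc : P.coeff n = Q.coeff n) {a : Fin n → K} (ha : Function.Injective a)
    (he : ∀ j, P.eval (a j) = Q.eval (a j)) : P = Q := by
  refine Polynomial.eq_of_degree_sub_lt_of_eval_index_eq (s := Finset.univ) (v := a)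
    (ha.injOn) ?_ fun j _ => he j
  rw [Finset.card_univ, Fintype.card_fin, Polynomial.degree_lt_iff_coeff_zero]
  intro m hm
  rw [Polynomial.coeff_sub, sub_eq_zero]
  rcases Nat.lt_trichotomy m (n + 1) with h | h | h
  · have : m = n := by omega
    rw [this, hc]
  · have h1 := hP.coeff_natDegree
    have h2 := hQ.coeff_natDegree
    rw [hPd] at h1
    rw [hQd] at h2
    rw [h, h1, h2]
  · rw [Polynomial.coeff_eq_zero_of_natDegree_lt (by omega),
      Polynomial.coeff_eq_zero_of_natDegree_lt (by omega)]

theorem prod_X_sub_C_facts {K : Type*} [Field K] {n : ℕ} (k : Fin (n + 1) → K) :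
    (∏ i, (Polynomial.X - Polynomial.C (k i))).Monic ∧
    (∏ i, (Polynomial.X - Polynomial.C (k i))).natDegree = n + 1 ∧
    (∏ i, (Polynomial.X - Polynomial.C (k i))).coeff n = -∑ i, k i ∧
    ∀ t, (∏ i, (Polynomial.X - Polynomial.C (k i))).eval t = ∏ i, (t - k i) := by
  refine ⟨Polynomial.monic_prod_of_monic _ _ fun l _ => Polynomial.monic_X_sub_C _, ?_, ?_, ?_⟩
  · rw [Polynomial.natDegree_finsetProd_X_sub_C_eq_card]
    simp
  · have := Polynomial.prod_X_sub_C_coeff_card_pred Finset.univ k (by simp)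
    simpa using this
  · simp [Polynomial.eval_prod]

/-- The coordinates fix the subleading coefficient and the values at the `n` points `a j` of the
monic polynomial with roots `k`. This determines the polynomial, hence its root set, hence the
increasing sequence `k`. -/
theorem injOn_borderCoord {n : ℕ} (a : Fin n → ℝ) :
    Set.InjOn (borderCoord a) {k | Interlaces a k} := by
  intro k hk k' hk' he
  have ha : StrictMono a := Interlaces.strictMono_left hk
  have hP : ∏ i, (Polynomial.X - Polynomial.C (k i)) =
      ∏ i, (Polynomial.X - Polynomial.C (k' i)) := by
    obtain ⟨h1, h2, h3, h4⟩ := prod_X_sub_C_facts k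
    obtain ⟨h1', h2', h3', h4'⟩ := prod_X_sub_C_facts k'
    refine monic_eq_of_eval_eq h1 h1' h2 h2' ?_ ha.injective fun j => ?_
    · have := congrFun he 0
      simp only [borderCoord, Fin.cons_zero] at this
      rw [h3, h3']
      linarith
    · have := congrFun he j.succ
      simp only [borderCoord, Fin.cons_succ] at this
      rw [h4, h4']
      rw [div_left_inj' (nodeDeriv_ne_zero ha j)] at this
      exact mul_left_cancel₀ (neg_ne_zero.mpr Real.pi_ne_zero) this
  refine (StrictMono.range_inj (Interlaces.strictMono_right hk)
    (Interlaces.strictMono_right hk')).mp ?_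
  have hr : ∀ k : Fin (n + 1) → ℝ, Set.range k =
      {t | (∏ i, (Polynomial.X - Polynomial.C (k i))).eval t = 0} := fun k => by
    ext t
    simp only [Set.mem_range, Set.mem_ofPred_eq, (prod_X_sub_C_facts k).2.2.2,
      Finset.prod_eq_zero_iff, Finset.mem_univ, true_and, sub_eq_zero]
    exact exists_congr fun _ => eq_comm
  rw [hr, hr, hP]

/-- Among the factors `a j - k i` exactly `n - j` are negative, against `n - j - 1` among those of
`nodeDeriv a j`. The quotient is negative, and the minus sign in `borderCoord` makes it positive. -/
theorem borderCoord_succ_pos {n : ℕ} {a : Fin n → ℝ} {k : Fin (n + 1) → ℝ} (h : Interlaces a k)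
    (j : Fin n) : 0 < borderCoord a k j.succ := by
  have h1 := neg_one_pow_mul_prod_pos (m := n + 1) (c := j + 1) (by omega)
    (f := fun i => a j - k i) (fun i hi => h.sub_pos j hi) fun i hi => h.sub_neg j hi
  have h2 := nodeDeriv_sign h.strictMono_left j
  have e : n + 1 - (j + 1) = (n - (j + 1)) + 1 := by omega
  rw [e, pow_succ] at h1
  simp only [borderCoord, Fin.cons_succ]
  have h3 : -Real.pi * (∏ i, (a j - k i)) / nodeDeriv a j =
      Real.pi * ((-1) ^ (n - (j + 1)) * -1 * ∏ i, (a j - k i)) /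
        ((-1) ^ (n - (j + 1)) * nodeDeriv a j) := by
    have := nodeDeriv_ne_zero h.strictMono_left j
    have h4 : ((-1 : ℝ)) ^ (n - (j + 1 : ℕ)) ≠ 0 := pow_ne_zero _ (by norm_num)
    field_simp
  rw [h3]
  exact div_pos (mul_pos Real.pi_pos h1) h2

/-- A sequence extended by two outer points. -/
def bracket {n : ℕ} (a : Fin n → ℝ) (T : ℝ) : Fin (n + 2) → ℝ :=
  Fin.cons (-T) (Fin.snoc a T : Fin (n + 1) → ℝ)

/-- The signs of `P` alternate along the nodes `a`, and continue to alternate at two further points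
far out on either side. The intermediate value theorem then puts a root in each of the `n + 1` gaps.
-/
theorem exists_interlaces_roots {n : ℕ} {a : Fin n → ℝ} (ha : StrictMono a) {P : Polynomial ℝ}
    (hP : P.Monic) (hd : P.natDegree = n + 1)
    (hs : ∀ j : Fin n, 0 < (-1) ^ (n - (j : ℕ)) * P.eval (a j)) :
    ∃ k : Fin (n + 1) → ℝ, Interlaces a k ∧ ∀ i, P.eval (k i) = 0 := by
  have hdeg : (0 : WithBot ℕ) < P.degree := by
    rw [← Polynomial.natDegree_pos_iff_degree_pos, hd]
    omega
  have htop : Tendsto (fun x => P.eval x) atTop atTop :=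
    P.tendsto_atTop_of_leadingCoeff_nonneg hdeg (by rw [hP.leadingCoeff]; exact zero_le_one)
  -- `Q` also has leading coefficient one, so its growth at `+∞` gives the sign of `P` near `-∞`.
  let Q : Polynomial ℝ := Polynomial.C ((-1) ^ (n + 1)) * P.comp (-Polynomial.X)
  have hQe : ∀ x, Q.eval x = (-1) ^ (n + 1) * P.eval (-x) := fun x => by
    simp [Q, Polynomial.eval_comp]
  have hcomp : (P.comp (-Polynomial.X)).natDegree = n + 1 := by
    rw [Polynomial.natDegree_comp, Polynomial.natDegree_neg, Polynomial.natDegree_X, hd, mul_one]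
  have hQl : Q.leadingCoeff = 1 := by
    rw [Polynomial.leadingCoeff_mul, Polynomial.leadingCoeff_C,
      Polynomial.leadingCoeff_comp (by simp), hP.leadingCoeff, one_mul,
      Polynomial.leadingCoeff_neg, Polynomial.leadingCoeff_X, hd, ← mul_pow]
    simp
  have hQd : (0 : WithBot ℕ) < Q.degree := by
    rw [← Polynomial.natDegree_pos_iff_degree_pos, Polynomial.natDegree_C_mul (by simp), hcomp]
    omega
  have hbot : Tendsto (fun x => Q.eval x) atTop atTop :=
    Q.tendsto_atTop_of_leadingCoeff_nonneg hQd (by rw [hQl]; exact zero_le_one)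
  obtain ⟨T, hT1, hT2, hT3, hT4⟩ : ∃ T : ℝ, 0 < P.eval T ∧ 0 < Q.eval T ∧
      0 < T ∧ ∀ j, |a j| < T := by
    refine ((htop.eventually_gt_atTop 0).and ((hbot.eventually_gt_atTop 0).and
      ((eventually_gt_atTop 0).and ?_))).exists
    exact eventually_all.mpr fun j => eventually_gt_atTop _
  have hsign : ∀ m : Fin (n + 2), 0 < (-1) ^ (n + 1 - (m : ℕ)) * P.eval (bracket a T m) := by
    intro m
    refine Fin.cases ?_ (fun m => Fin.lastCases ?_ (fun j => ?_) m) m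
    · simpa [bracket, hQe] using hT2
    · simpa [bracket] using hT1
    · simpa [bracket] using hs j
  have hmono : StrictMono (bracket a T) := by
    refine Fin.strictMono_iff_lt_succ.mpr fun i => ?_
    refine Fin.cases ?_ (fun i => ?_) i
    · rw [Fin.castSucc_zero]
      simp only [bracket, Fin.cons_zero, Fin.cons_succ]
      rcases n with _ | n
      · have : (Fin.snoc a T : Fin (0 + 1) → ℝ) 0 = T :=
          Fin.snoc_last (α := fun _ => ℝ) (n := 0) T a
        rw [this]
        linarith
      · have : (Fin.snoc a T : Fin (n + 1 + 1) → ℝ) 0 = a 0 := by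
          rw [← Fin.castSucc_zero, Fin.snoc_castSucc]
        rw [this]
        have := hT4 0
        linarith [neg_abs_le (a 0)]
    · rw [← Fin.succ_castSucc]
      simp only [bracket, Fin.cons_succ]
      rcases Fin.eq_castSucc_or_eq_last i.succ with ⟨j, hj⟩ | h
      · rw [hj, Fin.snoc_castSucc, Fin.snoc_castSucc]
        refine ha ?_
        rw [Fin.lt_def]
        have := congrArg Fin.val hj
        simp at this
        omega
      · rw [h, Fin.snoc_last, Fin.snoc_castSucc]
        exact (le_abs_self _).trans_lt (hT4 i)
  have hroot : ∀ i : Fin (n + 1), ∃ t ∈ Set.Ioo (bracket a T i.castSucc) (bracket a T i.succ),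
      P.eval t = 0 := fun i => by
    have h1 := hsign i.castSucc
    have h2 := hsign i.succ
    have e1 : n + 1 - ((i.castSucc : Fin (n + 2)) : ℕ) = (n - (i : ℕ)) + 1 := by
      rw [Fin.val_castSucc]
      omega
    have e2 : n + 1 - ((i.succ : Fin (n + 2)) : ℕ) = n - (i : ℕ) := by
      rw [Fin.val_succ]
      omega
    rw [e1, pow_succ] at h1
    rw [e2] at h2
    obtain ⟨t, ht, h0⟩ := intermediate_value_Ioo (hmono (Fin.castSucc_lt_succ (i := i))).le
      (f := fun t => (-1) ^ (n - (i : ℕ)) * P.eval t)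
      (by fun_prop) (show (0 : ℝ) ∈ Set.Ioo _ _ from ⟨by linarith, h2⟩)
    refine ⟨t, ht, ?_⟩
    exact (mul_eq_zero.mp h0).resolve_left (pow_ne_zero _ (by norm_num))
  choose k hk hk0 using hroot
  refine ⟨k, fun j => ⟨?_, ?_⟩, hk0⟩
  · have := (hk j.castSucc).2
    simpa [bracket] using this
  · have := (hk j.succ).1
    rw [← Fin.succ_castSucc] at this
    simpa [bracket] using this

/-- The characteristic polynomial of a bordered diagonal matrix. -/
def arrowPoly {K : Type*} [Field K] {n : ℕ} (a r : Fin n → K) (d : K) : Polynomial K :=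
  (Polynomial.X - Polynomial.C d) * ∏ l, (Polynomial.X - Polynomial.C (a l)) -
    ∑ j, Polynomial.C (r j) * ∏ l ∈ Finset.univ.erase j, (Polynomial.X - Polynomial.C (a l))

theorem natDegree_arrowPoly_sum_le {K : Type*} [Field K] {n : ℕ} (a r : Fin n → K) :
    (∑ j, Polynomial.C (r j) *
      ∏ l ∈ Finset.univ.erase j, (Polynomial.X - Polynomial.C (a l))).natDegree ≤ n - 1 := by
  refine Polynomial.natDegree_sum_le_of_forall_le _ _ fun j _ => ?_
  refine (Polynomial.natDegree_C_mul_le _ _).trans ?_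
  rw [Polynomial.natDegree_finsetProd_X_sub_C_eq_card]
  simp

/-- The subtracted sum has degree at most `n - 1`, so the top two coefficients are those of the
product. At `a j` every term vanishes except the summand with index `j`. -/
theorem arrowPoly_facts {K : Type*} [Field K] {n : ℕ} (a r : Fin n → K) (d : K) :
    (arrowPoly a r d).Monic ∧ (arrowPoly a r d).natDegree = n + 1 ∧
    (arrowPoly a r d).coeff n = -(d + ∑ j, a j) ∧
    ∀ j, (arrowPoly a r d).eval (a j) = -(r j * ∏ l ∈ Finset.univ.erase j, (a j - a l)) := by
  have hprod : (Polynomial.X - Polynomial.C d) * ∏ l, (Polynomial.X - Polynomial.C (a l)) =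
      ∏ i, (Polynomial.X - Polynomial.C ((Fin.cons d a : Fin (n + 1) → K) i)) := by
    rw [Fin.prod_univ_succ]
    simp
  obtain ⟨h1, h2, h3, h4⟩ := prod_X_sub_C_facts (Fin.cons d a : Fin (n + 1) → K)
  rw [← hprod] at h1 h2 h3 h4
  have hle := natDegree_arrowPoly_sum_le a r
  have hlt : (∑ j, Polynomial.C (r j) *
      ∏ l ∈ Finset.univ.erase j, (Polynomial.X - Polynomial.C (a l))).natDegree <
      ((Polynomial.X - Polynomial.C d) *
        ∏ l, (Polynomial.X - Polynomial.C (a l))).natDegree := by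
    rw [h2]
    omega
  refine ⟨?_, ?_, ?_, fun j => ?_⟩
  · exact h1.sub_of_left (Polynomial.degree_lt_degree hlt)
  · rw [arrowPoly, Polynomial.natDegree_sub_eq_left_of_natDegree_lt hlt, h2]
  · rw [arrowPoly, Polynomial.coeff_sub, h3, Fin.sum_univ_succ]
    have : (∑ j, Polynomial.C (r j) *
        ∏ l ∈ Finset.univ.erase j, (Polynomial.X - Polynomial.C (a l))).coeff n = 0 := by
      rcases n with _ | n
      · simp
      · exact Polynomial.coeff_eq_zero_of_natDegree_lt (by omega)
    rw [this]
    simp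
  · rw [arrowPoly, Polynomial.eval_sub, h4, Fin.prod_univ_succ, Polynomial.eval_finsetSum,
      Finset.sum_eq_single j]
    · have : ∏ i, (a j - (Fin.cons d a : Fin (n + 1) → K) (Fin.succ i)) = 0 :=
        Finset.prod_eq_zero (Finset.mem_univ j) (by simp)
      rw [this, mul_zero, zero_sub, Polynomial.eval_mul, Polynomial.eval_C, Polynomial.eval_prod]
      simp
    · intro i _ hij
      rw [Polynomial.eval_mul, Polynomial.eval_prod,
        Finset.prod_eq_zero (Finset.mem_erase.mpr ⟨hij.symm, Finset.mem_univ j⟩) (by simp),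
        mul_zero]
    · simp

theorem eq_prod_of_roots {n : ℕ} {P : Polynomial ℝ} (hP : P.Monic) (hd : P.natDegree = n)
    {k : Fin n → ℝ} (hk : Function.Injective k) (h0 : ∀ i, P.eval (k i) = 0) :
    P = ∏ i, (Polynomial.X - Polynomial.C (k i)) := by
  refine Polynomial.eq_of_degree_sub_lt_of_eval_index_eq (s := Finset.univ) (v := k)
    hk.injOn ?_ fun j _ => ?_
  · have hm : (∏ i, (Polynomial.X - Polynomial.C (k i))).Monic :=
      Polynomial.monic_prod_of_monic _ _ fun l _ => Polynomial.monic_X_sub_C _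
    have hn : (∏ i, (Polynomial.X - Polynomial.C (k i))).natDegree = n := by
      rw [Polynomial.natDegree_finsetProd_X_sub_C_eq_card]
      simp
    have hPd : P.degree = n := by rw [Polynomial.degree_eq_natDegree hP.ne_zero, hd]
    rw [Finset.card_univ, Fintype.card_fin, ← hPd]
    refine Polynomial.degree_sub_lt_left ?_ hP.ne_zero (by rw [hP.leadingCoeff, hm.leadingCoeff])
    rw [hPd, Polynomial.degree_eq_natDegree hm.ne_zero, hn]
  · rw [h0, Polynomial.eval_prod, Finset.prod_eq_zero (Finset.mem_univ j)]
    simp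

/-- For surjectivity, read `u` as a border: `d = u 0` and `|b_j|² = u_j / π`. Positivity of the
`u_j` makes the arrow polynomial alternate in sign at the nodes, so its roots interlace `a`. -/
theorem image_borderCoord {n : ℕ} {a : Fin n → ℝ} (ha : StrictMono a) :
    borderCoord a '' {k | Interlaces a k} = {u | ∀ j : Fin n, 0 < u j.succ} := by
  ext u
  constructor
  · rintro ⟨k, hk, rfl⟩ j
    exact borderCoord_succ_pos hk j
  · intro hu
    obtain ⟨h1, h2, h3, h4⟩ := arrowPoly_facts a (fun j => u j.succ / Real.pi) (u 0)
    obtain ⟨k, hk, hk0⟩ := exists_interlaces_roots ha h1 h2 fun j => by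
      rw [h4]
      have e : n - (j : ℕ) = (n - ((j : ℕ) + 1)) + 1 := by
        have := j.2
        omega
      have := mul_pos (div_pos (hu j) Real.pi_pos) (nodeDeriv_sign ha j)
      rw [e, pow_succ]
      rw [nodeDeriv] at this
      linarith
    have hP := eq_prod_of_roots h1 h2 hk.strictMono_right.injective hk0
    obtain ⟨-, -, h3', h4'⟩ := prod_X_sub_C_facts k
    rw [← hP] at h3' h4'
    refine ⟨k, hk, ?_⟩
    ext m
    refine Fin.cases ?_ (fun j => ?_) m
    · simp only [borderCoord, Fin.cons_zero]
      linarith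
    · simp only [borderCoord, Fin.cons_succ]
      rw [← h4', h4, div_eq_iff (nodeDeriv_ne_zero ha j), nodeDeriv]
      have := Real.pi_ne_zero
      field_simp

theorem measurableSet_interlaces {n : ℕ} (a : Fin n → ℝ) :
    MeasurableSet {k : Fin (n + 1) → ℝ | Interlaces a k} := by
  have : {k : Fin (n + 1) → ℝ | Interlaces a k} =
      ⋂ i : Fin n, ({k | k i.castSucc < a i} ∩ {k | a i < k i.succ}) := by
    ext k
    simp [Interlaces]
  rw [this]
  exact MeasurableSet.iInter fun i => (measurableSet_lt (measurable_pi_apply _)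
    measurable_const).inter (measurableSet_lt measurable_const (measurable_pi_apply _))

theorem setIntegral_border {n : ℕ} {a : Fin n → ℝ} (ha : StrictMono a)
    (g : (Fin (n + 1) → ℝ) → ℂ) :
    ∫ u in {u : Fin (n + 1) → ℝ | ∀ j : Fin n, 0 < u j.succ}, g u =
      ∫ k in {k | Interlaces a k}, ((Real.pi ^ n * (Matrix.vandermonde k).det /
        (Matrix.vandermonde a).det : ℝ) : ℂ) * g (borderCoord a k) := by
  rw [← image_borderCoord ha, integral_image_eq_integral_abs_det_fderiv_smul volume
    (measurableSet_interlaces a) (fun k _ => (hasFDerivAt_borderCoord a k).hasFDerivWithinAt)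
    (injOn_borderCoord a)]
  refine setIntegral_congr_fun (measurableSet_interlaces a) fun k hk => ?_
  have : (Matrix.toLin' (borderJac a k)).toContinuousLinearMap.det = (borderJac a k).det := by
    rw [← LinearMap.det_toLin' (borderJac a k)]
    rfl
  rw [this, abs_det_borderJac hk, Complex.real_smul]

/-! ### Coordinates on Hermitian matrices and unitary invariance of Lebesgue measure -/

theorem HermCoord.toMatrix_isHermitian {n : ℕ} (c : HermCoord n) : c.toMatrix.IsHermitian :=
  c.toMatrix_mem

theorem HermCoord.toMatrix_diag {n : ℕ} (c : HermCoord n) (i : Fin n) :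
    c.toMatrix i i = c.1 i := by
  simp [HermCoord.toMatrix]

theorem HermCoord.toMatrix_lt {n : ℕ} (c : HermCoord n) {i j : Fin n} (h : i < j) :
    c.toMatrix i j = c.2 ⟨(i, j), h⟩ := by
  simp [HermCoord.toMatrix, h]

/-- Coordinates read off from a matrix. -/
def HermCoord.ofMatrix {n : ℕ} (A : Matrix (Fin n) (Fin n) ℂ) : HermCoord n :=
  (fun i => (A i i).re, fun p => A p.1.1 p.1.2)

theorem HermCoord.ofMatrix_toMatrix {n : ℕ} (c : HermCoord n) :
    HermCoord.ofMatrix c.toMatrix = c := by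
  refine Prod.ext (funext fun i => ?_) (funext fun p => ?_)
  · simp [HermCoord.ofMatrix, HermCoord.toMatrix_diag]
  · simp [HermCoord.ofMatrix, HermCoord.toMatrix_lt c p.2]

theorem HermCoord.toMatrix_ext {n : ℕ} {c c' : HermCoord n} (h : c.toMatrix = c'.toMatrix) :
    c = c' := by
  rw [← c.ofMatrix_toMatrix, h, c'.ofMatrix_toMatrix]

theorem isHermitian_ext_of_le {n : ℕ} {A B : Matrix (Fin n) (Fin n) ℂ} (hA : A.IsHermitian)
    (hB : B.IsHermitian) (h : ∀ i j, i ≤ j → A i j = B i j) : A = B := by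
  ext i j
  rcases le_total i j with hij | hij
  · exact h i j hij
  · rw [← hA.apply, ← hB.apply, h j i hij]

theorem HermCoord.toMatrix_ofMatrix {n : ℕ} {A : Matrix (Fin n) (Fin n) ℂ} (hA : A.IsHermitian) :
    (HermCoord.ofMatrix A).toMatrix = A := by
  refine isHermitian_ext_of_le (toMatrix_isHermitian _) hA fun i j hij => ?_
  rcases hij.eq_or_lt with rfl | h
  · rw [toMatrix_diag]
    exact Complex.conj_eq_iff_re.mp (hA.apply i i)
  · rw [toMatrix_lt _ h]
    rfl

theorem HermCoord.toMatrix_add {n : ℕ} (c c' : HermCoord n) :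
    (c + c').toMatrix = c.toMatrix + c'.toMatrix := by
  refine isHermitian_ext_of_le (toMatrix_isHermitian _)
    ((toMatrix_isHermitian _).add (toMatrix_isHermitian _)) fun i j hij => ?_
  rcases hij.eq_or_lt with rfl | h
  · simp [toMatrix_diag]
  · simp [toMatrix_lt _ h]

theorem HermCoord.toMatrix_smul {n : ℕ} (t : ℝ) (c : HermCoord n) :
    (t • c).toMatrix = t • c.toMatrix := by
  ext i j
  rcases lt_trichotomy i j with h | rfl | h
  · simp [toMatrix_lt _ h]
  · simp [toMatrix_diag]
  · rw [← (toMatrix_isHermitian _).apply, Matrix.smul_apply,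
      ← (toMatrix_isHermitian c).apply, toMatrix_lt _ h, toMatrix_lt _ h]
    simp

theorem HermCoord.continuous_toMatrix (n : ℕ) :
    Continuous (HermCoord.toMatrix : HermCoord n → Matrix (Fin n) (Fin n) ℂ) :=
  continuous_subtype_val.comp HermCoord.continuous_toHerm

/-- The squared Frobenius norm. -/
def HermCoord.frob {n : ℕ} (c : HermCoord n) : ℝ := (Matrix.trace (c.toMatrix * c.toMatrix)).re

theorem HermCoord.frob_eq {n : ℕ} (c : HermCoord n) :
    c.frob = ∑ i, ∑ j, ‖c.toMatrix i j‖ ^ 2 := by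
  simp only [frob, Matrix.trace, Matrix.diag_apply, Matrix.mul_apply, Complex.re_sum]
  refine Finset.sum_congr rfl fun i _ => Finset.sum_congr rfl fun j _ => ?_
  rw [← (toMatrix_isHermitian c).apply j i]
  change (_ * (starRingEnd ℂ) _).re = _
  rw [Complex.mul_conj, Complex.ofReal_re, Complex.normSq_eq_norm_sq]

theorem HermCoord.norm_le_of_frob_le {n : ℕ} {c : HermCoord n} {R : ℝ} (hR : 0 ≤ R)
    (h : c.frob ≤ R ^ 2) : ‖c‖ ≤ R := by
  have hent : ∀ i j, ‖c.toMatrix i j‖ ≤ R := fun i j => by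
    rw [frob_eq] at h
    have h1 : ‖c.toMatrix i j‖ ^ 2 ≤ R ^ 2 := by
      refine le_trans ?_ h
      refine le_trans ?_ (Finset.single_le_sum (f := fun i => ∑ j, ‖c.toMatrix i j‖ ^ 2)
        (fun i _ => Finset.sum_nonneg fun j _ => sq_nonneg _) (Finset.mem_univ i))
      exact Finset.single_le_sum (f := fun j => ‖c.toMatrix i j‖ ^ 2)
        (fun j _ => sq_nonneg _) (Finset.mem_univ j)
    exact (sq_le_sq₀ (norm_nonneg _) hR).mp h1
  refine max_le ((pi_norm_le_iff_of_nonneg hR).mpr fun i => ?_)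
    ((pi_norm_le_iff_of_nonneg hR).mpr fun p => ?_)
  · have := hent i i
    rwa [toMatrix_diag, Complex.norm_real] at this
  · have := hent p.1.1 p.1.2
    rwa [toMatrix_lt _ p.2] at this

theorem HermCoord.continuous_frob (n : ℕ) : Continuous (HermCoord.frob : HermCoord n → ℝ) := by
  have := HermCoord.continuous_toMatrix n
  exact Complex.continuous_re.comp (this.matrix_mul this).matrix_trace

theorem HermCoord.frob_zero (n : ℕ) : (0 : HermCoord n).frob = 0 := by
  have : (0 : HermCoord n).toMatrix = 0 := by
    simpa using HermCoord.toMatrix_smul 0 (0 : HermCoord n)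
  simp [frob, this]

/-- An injective linear map preserving a continuous function with bounded sublevel set preserves
Lebesgue measure. -/
theorem measurePreserving_of_invariant {E : Type*} [NormedAddCommGroup E] [NormedSpace ℝ E]
    [FiniteDimensional ℝ E] [MeasurableSpace E] [BorelSpace E] (μ : Measure E)
    [μ.IsAddHaarMeasure] (L : E →ₗ[ℝ] E) (hL : Function.Injective L) (N : E → ℝ)
    (hN : Continuous N) (h0 : N 0 < 1) (hb : Bornology.IsBounded {x | N x ≤ 1})
    (hLN : ∀ x, N (L x) = N x) : MeasurePreserving L μ μ := by
  have hdet : LinearMap.det L ≠ 0 := by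
    have := (LinearEquiv.ofInjectiveEndo L hL).isUnit_det'
    have h2 : ((LinearEquiv.ofInjectiveEndo L hL : E ≃ₗ[ℝ] E) : E →ₗ[ℝ] E) = L := by
      ext x
      simp
    rw [h2] at this
    exact this.ne_zero
  -- The sublevel set is invariant and has positive finite measure, which forces `|det L| = 1`.
  have hpre : L ⁻¹' {x | N x ≤ 1} = {x | N x ≤ 1} := by
    ext x
    simp [hLN]
  have hfin : μ {x | N x ≤ 1} ≠ ⊤ := hb.measure_lt_top.ne
  have hpos : μ {x | N x ≤ 1} ≠ 0 := by
    refine ne_of_gt (lt_of_lt_of_le ?_ (measure_mono (fun x (hx : N x < 1) => hx.le)))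
    exact (isOpen_lt hN continuous_const).measure_pos μ ⟨0, h0⟩
  have h1 := Measure.addHaar_preimage_linearMap μ hdet {x | N x ≤ 1}
  rw [hpre] at h1
  have h2 : ENNReal.ofReal |(LinearMap.det L)⁻¹| = 1 := by
    have h3 : ENNReal.ofReal |(LinearMap.det L)⁻¹| * μ {x | N x ≤ 1} = 1 * μ {x | N x ≤ 1} := by
      rw [← h1, one_mul]
    exact (ENNReal.mul_left_inj hpos hfin).mp h3
  refine ⟨(LinearMap.continuous_of_finiteDimensional L).measurable, ?_⟩
  rw [Measure.map_linearMap_addHaar_eq_smul_addHaar μ hdet, h2, one_smul]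

/-- Unitary conjugation in coordinates. -/
def HermCoord.conj {n : ℕ} (V : Matrix (Fin n) (Fin n) ℂ) : HermCoord n →ₗ[ℝ] HermCoord n where
  toFun c := HermCoord.ofMatrix (V * c.toMatrix * star V)
  map_add' c c' := by
    rw [HermCoord.toMatrix_add, mul_add, add_mul]
    exact Prod.ext (funext fun i => Complex.add_re _ _) rfl
  map_smul' t c := by
    rw [HermCoord.toMatrix_smul, mul_smul_comm, smul_mul_assoc]
    refine Prod.ext (funext fun i => ?_) (funext fun p => ?_) <;> simp [HermCoord.ofMatrix]

theorem isHermitian_conj {n : ℕ} (V : Matrix (Fin n) (Fin n) ℂ) {A : Matrix (Fin n) (Fin n) ℂ}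
    (hA : A.IsHermitian) : (V * A * star V).IsHermitian := by
  rw [Matrix.IsHermitian, ← Matrix.star_eq_conjTranspose, star_mul, star_mul, star_star,
    Matrix.star_eq_conjTranspose A, hA.eq, mul_assoc]

theorem HermCoord.toMatrix_conj {n : ℕ} (V : Matrix (Fin n) (Fin n) ℂ) (c : HermCoord n) :
    (HermCoord.conj V c).toMatrix = V * c.toMatrix * star V :=
  HermCoord.toMatrix_ofMatrix (isHermitian_conj V c.toMatrix_isHermitian)

theorem HermCoord.isAddHaarMeasure_volume (n : ℕ) :
    (volume : Measure (HermCoord n)).IsAddHaarMeasure :=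
  Measure.prod.instIsAddHaarMeasure (volume : Measure (Fin n → ℝ))
    (volume : Measure ({p : Fin n × Fin n // p.1 < p.2} → ℂ))

theorem HermCoord.measurePreserving_conj {n : ℕ} {V : Matrix (Fin n) (Fin n) ℂ}
    (hV : V ∈ Matrix.unitaryGroup (Fin n) ℂ) :
    MeasurePreserving (HermCoord.conj V) volume volume := by
  have h1 : star V * V = 1 := hV.1
  have hcomp : ∀ c : HermCoord n, HermCoord.conj (star V) (HermCoord.conj V c) = c := fun c => by
    apply HermCoord.toMatrix_ext
    rw [toMatrix_conj, toMatrix_conj, star_star]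
    calc star V * (V * c.toMatrix * star V) * V
        = (star V * V) * c.toMatrix * (star V * V) := by simp only [mul_assoc]
      _ = c.toMatrix := by rw [h1, one_mul, mul_one]
  have := HermCoord.isAddHaarMeasure_volume n
  refine measurePreserving_of_invariant volume (HermCoord.conj V)
    (Function.LeftInverse.injective hcomp) HermCoord.frob (HermCoord.continuous_frob n)
    (by rw [HermCoord.frob_zero]; exact one_pos) ?_ fun c => ?_
  · refine (Metric.isBounded_closedBall (x := (0 : HermCoord n)) (r := 1)).subset fun c hc => ?_
    rw [mem_closedBall_zero_iff]
    exact HermCoord.norm_le_of_frob_le zero_le_one (by simpa using hc)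
  · rw [frob, frob, toMatrix_conj]
    have : V * c.toMatrix * star V * (V * c.toMatrix * star V) =
        V * (c.toMatrix * c.toMatrix * star V) := by
      calc _ = V * c.toMatrix * (star V * V) * c.toMatrix * star V := by simp only [mul_assoc]
        _ = _ := by rw [h1, mul_one]; simp only [mul_assoc]
    rw [this, Matrix.trace_mul_comm, mul_assoc, h1, mul_one]

theorem measurePreserving_vecMul {n : ℕ} {V : Matrix (Fin n) (Fin n) ℂ}
    (hV : V ∈ Matrix.unitaryGroup (Fin n) ℂ) :
    MeasurePreserving (fun b : Fin n → ℂ => Matrix.vecMul b V) volume volume := by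
  have h1 : V * star V = 1 := Unitary.mul_star_self_of_mem hV
  let N : (Fin n → ℂ) → ℝ := fun b => (b ⬝ᵥ star b).re
  have hNs : ∀ b, N b = ∑ i, ‖b i‖ ^ 2 := fun b => by
    simp only [N, dotProduct, Complex.re_sum, Pi.star_apply]
    refine Finset.sum_congr rfl fun i _ => ?_
    change (_ * (starRingEnd ℂ) _).re = _
    rw [Complex.mul_conj, Complex.ofReal_re, Complex.normSq_eq_norm_sq]
  let L : (Fin n → ℂ) →ₗ[ℝ] (Fin n → ℂ) := (Matrix.vecMulLinear V).restrictScalars ℝ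
  refine measurePreserving_of_invariant (E := Fin n → ℂ) volume L (fun b b' h => ?_) N
    ?_ ?_ ?_ fun b => ?_
  · have h2 : Matrix.vecMul b V = Matrix.vecMul b' V := h
    have := congrArg (fun x => Matrix.vecMul x (star V)) h2
    simpa [Matrix.vecMul_vecMul, h1] using this
  · simp only [N, dotProduct]
    fun_prop
  · simp [N]
  · refine (Metric.isBounded_closedBall (x := (0 : Fin n → ℂ)) (r := 1)).subset fun b hb => ?_
    rw [mem_closedBall_zero_iff, pi_norm_le_iff_of_nonneg zero_le_one]
    intro i
    have h2 : N b ≤ 1 := hb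
    rw [hNs] at h2
    have h3 := (Finset.single_le_sum (f := fun i => ‖b i‖ ^ 2) (fun i _ => sq_nonneg _)
      (Finset.mem_univ i)).trans h2
    nlinarith [norm_nonneg (b i)]
  · change (Matrix.vecMul b V ⬝ᵥ star (Matrix.vecMul b V)).re = (b ⬝ᵥ star b).re
    rw [Matrix.star_vecMul, ← Matrix.star_eq_conjTranspose, ← Matrix.dotProduct_mulVec,
      Matrix.mulVec_mulVec, h1, Matrix.one_mulVec]

/-- Equal characteristic polynomials give equal ordered eigenvalue lists, so the two
diagonalizations share their diagonal part and `V = W U*` works. Unitary invariance can then be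
expressed through characteristic polynomials alone. -/
theorem exists_unitary_of_charpoly_eq {n : ℕ} {A B : Matrix (Fin n) (Fin n) ℂ}
    (hA : A.IsHermitian) (hB : B.IsHermitian) (h : A.charpoly = B.charpoly) :
    ∃ V ∈ Matrix.unitaryGroup (Fin n) ℂ, B = V * A * star V := by
  have he := (Matrix.IsHermitian.eigenvalues_eq_eigenvalues_iff hA hB).mpr h
  have h1 := hA.spectral_theorem
  have h2 := hB.spectral_theorem
  rw [Unitary.conjStarAlgAut_apply] at h1 h2
  rw [he] at h1
  set U := hA.eigenvectorUnitary
  set W := hB.eigenvectorUnitary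
  refine ⟨(W * star U : Matrix.unitaryGroup (Fin n) ℂ), (W * star U).2, ?_⟩
  set D := Matrix.diagonal (RCLike.ofReal ∘ hB.eigenvalues : Fin n → ℂ)
  have hU : star (U : Matrix (Fin n) (Fin n) ℂ) * U = 1 := U.2.1
  rw [h1]
  conv_lhs => rw [h2]
  simp only [Submonoid.coe_mul, Unitary.coe_star, star_mul, star_star]
  calc _ = (W : Matrix (Fin n) (Fin n) ℂ) * 1 * D * 1 * star (W : Matrix (Fin n) (Fin n) ℂ) := by
        simp
    _ = _ := by
      rw [← hU]
      simp only [mul_assoc]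

/-! ### Bordered matrices and their characteristic polynomials -/

/-- Index pairs of the bordered matrix: pairs with the new index, and old pairs. -/
def borderIndex (n : ℕ) : Fin n ⊕ {p : Fin n × Fin n // p.1 < p.2} ≃
    {p : Fin (n + 1) × Fin (n + 1) // p.1 < p.2} :=
  Equiv.ofBijective
    (Sum.elim (fun j => ⟨(0, j.succ), Fin.succ_pos j⟩)
      fun p => ⟨(p.1.1.succ, p.1.2.succ), Fin.succ_lt_succ_iff.mpr p.2⟩) <| by
    constructor
    · rintro (j | p) (j' | p') h
      · simpa using h
      · simp at h
        exact absurd h.1.symm (Fin.succ_ne_zero _)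
      · simp at h
      · simp only [Sum.elim_inr, Subtype.mk.injEq, Prod.mk.injEq, Fin.succ_inj] at h
        exact congrArg Sum.inr (Subtype.ext (Prod.ext h.1 h.2))
    · rintro ⟨⟨i, j⟩, h⟩
      obtain ⟨j', rfl⟩ := Fin.exists_succ_eq.mpr (Fin.pos_iff_ne_zero.mp ((Fin.zero_le i).trans_lt h))
      rcases Fin.eq_zero_or_eq_succ i with rfl | ⟨i', rfl⟩
      · exact ⟨Sum.inl j', rfl⟩
      · exact ⟨Sum.inr ⟨(i', j'), Fin.succ_lt_succ_iff.mp h⟩, rfl⟩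

section ProdComm
variable {α β γ δ : Type*} [MeasureSpace α] [MeasureSpace β] [MeasureSpace γ] [MeasureSpace δ]

/-- Interchange of the middle factors of a fourfold product. -/
def prodInterchange : (α × β) × (γ × δ) ≃ᵐ (α × γ) × (β × δ) where
  toFun p := ((p.1.1, p.2.1), (p.1.2, p.2.2))
  invFun p := ((p.1.1, p.2.1), (p.1.2, p.2.2))
  left_inv _ := rfl
  right_inv _ := rfl
  measurable_toFun := by
    simp only [Equiv.coe_fn_mk]
    fun_prop
  measurable_invFun := by
    simp only [Equiv.coe_fn_symm_mk]
    fun_prop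

theorem measurePreserving_prodInterchange [SFinite (volume : Measure α)]
    [SFinite (volume : Measure β)] [SFinite (volume : Measure γ)] [SFinite (volume : Measure δ)] :
    MeasurePreserving (prodInterchange : (α × β) × (γ × δ) ≃ᵐ (α × γ) × (β × δ)) volume volume := by
  have s1 : MeasurePreserving (MeasurableEquiv.prodAssoc : (α × β) × (γ × δ) ≃ᵐ _)
    volume volume := volume_preserving_prodAssoc
  have s2 : MeasurePreserving (MeasurableEquiv.prodAssoc : (β × γ) × δ ≃ᵐ _)
    volume volume := volume_preserving_prodAssoc
  have s3 : MeasurePreserving (Prod.swap : β × γ → γ × β) volume volume :=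
    Measure.measurePreserving_swap
  have s4 : MeasurePreserving (MeasurableEquiv.prodAssoc : (γ × β) × δ ≃ᵐ _)
    volume volume := volume_preserving_prodAssoc
  have s5 : MeasurePreserving (MeasurableEquiv.prodAssoc : (α × γ) × (β × δ) ≃ᵐ _)
    volume volume := volume_preserving_prodAssoc
  have m := s4.comp ((s3.prod (MeasurePreserving.id (volume : Measure δ))).comp s2.symm)
  exact s5.symm.comp (((MeasurePreserving.id (volume : Measure α)).prod m).comp s1)

end ProdComm

/-- The Hermitian matrix obtained from one of size `n` by adding a first row and column. -/
def HermCoord.border (n : ℕ) : (ℝ × (Fin n → ℂ)) × HermCoord n ≃ᵐ HermCoord (n + 1) :=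
  prodInterchange.trans
    (MeasurableEquiv.prodCongr (MeasurableEquiv.piFinSuccAbove (fun _ => ℝ) 0).symm
      ((MeasurableEquiv.sumPiEquivProdPi (fun _ => ℂ)).symm.trans
        (MeasurableEquiv.piCongrLeft (fun _ => ℂ) (borderIndex n))))

theorem HermCoord.measurePreserving_border (n : ℕ) :
    MeasurePreserving (HermCoord.border n) volume volume := by
  have h1 := (volume_preserving_piFinSuccAbove (fun _ : Fin (n + 1) => ℝ) 0).symm
  have h2 := (volume_measurePreserving_sumPiEquivProdPi_symm
    (fun _ : Fin n ⊕ {p : Fin n × Fin n // p.1 < p.2} => ℂ))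
  have h3 := volume_measurePreserving_piCongrLeft (fun _ => ℂ) (borderIndex n)
  exact (h1.prod (h3.comp h2)).comp measurePreserving_prodInterchange

theorem HermCoord.border_fst_zero {n : ℕ} (d : ℝ) (b : Fin n → ℂ) (c : HermCoord n) :
    (HermCoord.border n ((d, b), c)).1 0 = d := rfl

theorem HermCoord.border_fst_succ {n : ℕ} (d : ℝ) (b : Fin n → ℂ) (c : HermCoord n) (i : Fin n) :
    (HermCoord.border n ((d, b), c)).1 i.succ = c.1 i := rfl

theorem HermCoord.border_snd {n : ℕ} (d : ℝ) (b : Fin n → ℂ) (c : HermCoord n)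
    (s : Fin n ⊕ {p : Fin n × Fin n // p.1 < p.2}) :
    (HermCoord.border n ((d, b), c)).2 (borderIndex n s) = Sum.elim b c.2 s := by
  have := Equiv.piCongrLeft_apply_apply (fun _ => ℂ) (borderIndex n)
    ((MeasurableEquiv.sumPiEquivProdPi
      (fun _ : Fin n ⊕ {p : Fin n × Fin n // p.1 < p.2} => ℂ)).symm (b, c.2)) s
  refine Eq.trans this ?_
  rcases s with j | p <;> rfl

/-- The block decomposition of the index set of a bordered matrix. -/
def borderSum (n : ℕ) : Unit ⊕ Fin n ≃ Fin (n + 1) :=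
  Equiv.ofBijective (Sum.elim (fun _ => 0) Fin.succ) <| by
    constructor
    · rintro (j | p) (j' | p') h
      · rfl
      · exact absurd h.symm (Fin.succ_ne_zero _)
      · exact absurd h (Fin.succ_ne_zero _)
      · exact congrArg Sum.inr (Fin.succ_injective _ h)
    · intro i
      rcases Fin.eq_zero_or_eq_succ i with rfl | ⟨i', rfl⟩
      · exact ⟨Sum.inl (), rfl⟩
      · exact ⟨Sum.inr i', rfl⟩

theorem HermCoord.toMatrix_border {n : ℕ} (d : ℝ) (b : Fin n → ℂ) (c : HermCoord n) :
    (HermCoord.border n ((d, b), c)).toMatrix = Matrix.reindex (borderSum n) (borderSum n)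
      (Matrix.fromBlocks (Matrix.of fun _ _ => (d : ℂ)) (Matrix.of fun _ j => b j)
        (Matrix.of fun j _ => star (b j)) c.toMatrix) := by
  rw [← Equiv.symm_apply_eq]
  have e0 : borderSum n (Sum.inl ()) = 0 := rfl
  have e1 : ∀ j, borderSum n (Sum.inr j) = j.succ := fun j => rfl
  have h0 : ∀ j : Fin n, (HermCoord.border n ((d, b), c)).toMatrix 0 j.succ = b j := fun j => by
    rw [toMatrix_lt _ (Fin.succ_pos j)]
    exact border_snd d b c (Sum.inl j)
  ext s t
  simp only [Matrix.reindex_symm, Matrix.reindex_apply, Equiv.symm_symm, Matrix.submatrix_apply]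
  rcases s with ⟨⟩ | i <;> rcases t with ⟨⟩ | j
  · simp [e0, toMatrix_diag, border_fst_zero]
  · simp [e0, e1, h0]
  · rw [e0, e1, ← (toMatrix_isHermitian _).apply, h0]
    rfl
  · rw [e1, e1, Matrix.fromBlocks_apply₂₂]
    rcases lt_trichotomy i j with h | rfl | h
    · rw [toMatrix_lt _ (Fin.succ_lt_succ_iff.mpr h), toMatrix_lt _ h]
      exact border_snd d b c (Sum.inr ⟨(i, j), h⟩)
    · simp [toMatrix_diag, border_fst_succ]
    · rw [← (toMatrix_isHermitian _).apply, ← (toMatrix_isHermitian c).apply,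
        toMatrix_lt _ (Fin.succ_lt_succ_iff.mpr h), toMatrix_lt _ h]
      exact congrArg star (border_snd d b c (Sum.inr ⟨(j, i), h⟩))

theorem HermCoord.charpoly_border {n : ℕ} (d : ℝ) (b : Fin n → ℂ) (c : HermCoord n) :
    (HermCoord.border n ((d, b), c)).toMatrix.charpoly =
      (Matrix.fromBlocks (Matrix.of fun (_ _ : Unit) => (d : ℂ)) (Matrix.of fun _ j => b j)
        (Matrix.of fun j _ => star (b j)) c.toMatrix).charpoly := by
  rw [toMatrix_border, Matrix.charpoly_reindex]

/-- The diagonal matrix with given real entries. -/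
def HermCoord.diag {n : ℕ} (a : Fin n → ℝ) : HermCoord n := (a, 0)

theorem HermCoord.toMatrix_diagonal {n : ℕ} (a : Fin n → ℝ) :
    (HermCoord.diag a).toMatrix = Matrix.diagonal fun i => (a i : ℂ) := by
  refine isHermitian_ext_of_le (toMatrix_isHermitian _) ?_ fun i j hij => ?_
  · rw [Matrix.isHermitian_diagonal_iff]
    intro i
    simp [IsSelfAdjoint]
  rcases hij.eq_or_lt with rfl | h
  · simp [toMatrix_diag, diag]
  · rw [toMatrix_lt _ h, Matrix.diagonal_apply_ne _ h.ne]
    rfl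

/-- For `t` different from every `a j` the diagonal block is invertible and the Schur complement `t
- d - ∑ |b_j|² / (t - a_j)` gives the determinant. Infinitely many such `t` suffice for the
polynomial identity. -/
theorem charpoly_arrow {n : ℕ} (d : ℂ) (a b : Fin n → ℂ) :
    (Matrix.fromBlocks (Matrix.of fun (_ _ : Unit) => d) (Matrix.of fun _ j => b j)
        (Matrix.of fun j _ => star (b j)) (Matrix.diagonal a)).charpoly =
      arrowPoly a (fun j => b j * star (b j)) d := by
  refine Polynomial.eq_of_infinite_eval_eq _ _ ?_
  refine Set.Infinite.mono (s := (Set.range a)ᶜ) (fun t ht => ?_)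
    (Set.finite_range a).infinite_compl
  have hne : ∀ j, t - a j ≠ 0 := fun j h => ht ⟨j, (sub_eq_zero.mp h).symm⟩
  rw [Set.mem_ofPred_eq, Matrix.eval_charpoly]
  have hb : Matrix.scalar (Unit ⊕ Fin n) t - Matrix.fromBlocks (Matrix.of fun (_ _ : Unit) => d)
      (Matrix.of fun _ j => b j) (Matrix.of fun j _ => star (b j)) (Matrix.diagonal a) =
      Matrix.fromBlocks (Matrix.of fun (_ _ : Unit) => t - d) (Matrix.of fun _ j => -b j)
        (Matrix.of fun j _ => -star (b j)) (Matrix.diagonal fun j => t - a j) := by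
    ext i j
    rcases i with ⟨⟩ | i <;> rcases j with ⟨⟩ | j
    · simp
    · simp
    · simp
    · by_cases hij : i = j
      · simp [hij]
      · simp [hij, Matrix.diagonal_apply_ne]
  have hinv : (Matrix.diagonal fun j => t - a j) * (Matrix.diagonal fun j => (t - a j)⁻¹) = 1 := by
    rw [Matrix.diagonal_mul_diagonal, ← Matrix.diagonal_one]
    congr 1
    ext j
    exact mul_inv_cancel₀ (hne j)
  let _ : Invertible (Matrix.diagonal fun j => t - a j) :=
    ⟨Matrix.diagonal fun j => (t - a j)⁻¹, by
      rw [← hinv]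
      exact Matrix.commute_diagonal _ _, hinv⟩
  have hi : ⅟(Matrix.diagonal fun j => t - a j) = Matrix.diagonal fun j => (t - a j)⁻¹ := rfl
  rw [hb, Matrix.det_fromBlocks₂₂, hi, Matrix.det_diagonal, Matrix.det_unique]
  have hsum : (Matrix.of (fun (_ _ : Unit) => t - d) - (Matrix.of fun (_ : Unit) j => -b j) *
      (Matrix.diagonal fun j => (t - a j)⁻¹) * Matrix.of fun j (_ : Unit) => -star (b j))
      default default = t - d - ∑ j, b j * star (b j) / (t - a j) := by
    simp only [Matrix.sub_apply, Matrix.of_apply, Matrix.mul_apply]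
    congr 1
    refine Finset.sum_congr rfl fun j _ => ?_
    rw [Finset.sum_eq_single j (fun x _ hx => by rw [Matrix.diagonal_apply_ne _ hx, mul_zero])
      (by simp), Matrix.diagonal_apply_eq]
    ring
  rw [hsum, arrowPoly]
  simp only [Polynomial.eval_sub, Polynomial.eval_mul, Polynomial.eval_X, Polynomial.eval_C,
    Polynomial.eval_prod, Polynomial.eval_finsetSum]
  rw [mul_sub, mul_comm, Finset.mul_sum]
  congr 1
  refine Finset.sum_congr rfl fun j _ => ?_
  rw [← Finset.mul_prod_erase Finset.univ _ (Finset.mem_univ j)]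
  have := hne j
  field_simp

theorem HermCoord.charpoly_border_diag {n : ℕ} (d : ℝ) (b : Fin n → ℂ) (a : Fin n → ℝ) :
    (HermCoord.border n ((d, b), HermCoord.diag a)).toMatrix.charpoly =
      arrowPoly (fun j => (a j : ℂ)) (fun j => ((‖b j‖ ^ 2 : ℝ) : ℂ)) d := by
  rw [charpoly_border, toMatrix_diagonal, charpoly_arrow]
  congr 1
  ext j
  change _ * (starRingEnd ℂ) _ = _
  rw [Complex.mul_conj, Complex.normSq_eq_norm_sq]

theorem HermCoord.charpoly_diag {n : ℕ} (k : Fin n → ℝ) :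
    (HermCoord.diag k).toMatrix.charpoly =
      ∏ i, (Polynomial.X - Polynomial.C (k i : ℂ)) := by
  rw [toMatrix_diagonal, Matrix.charpoly_diagonal]

/-- A bordered diagonal matrix whose border is given by `borderCoord` has the prescribed
eigenvalues. -/
theorem HermCoord.charpoly_border_borderCoord {n : ℕ} {a : Fin n → ℝ} {k : Fin (n + 1) → ℝ}
    (h : Interlaces a k) {b : Fin n → ℂ} {d : ℝ} (hd : d = borderCoord a k 0)
    (hb : ∀ j, Real.pi * ‖b j‖ ^ 2 = borderCoord a k j.succ) :
    (HermCoord.border n ((d, b), HermCoord.diag a)).toMatrix.charpoly =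
      (HermCoord.diag k).toMatrix.charpoly := by
  rw [charpoly_border_diag, charpoly_diag]
  obtain ⟨h1, h2, h3, h4⟩ := arrowPoly_facts (fun j => (a j : ℂ))
    (fun j => ((‖b j‖ ^ 2 : ℝ) : ℂ)) (d : ℂ)
  obtain ⟨h1', h2', h3', h4'⟩ := prod_X_sub_C_facts fun i => (k i : ℂ)
  refine monic_eq_of_eval_eq h1 h1' h2 h2' ?_
    (a := fun j => (a j : ℂ)) (fun i j hij => h.strictMono_left.injective
      (Complex.ofReal_injective hij)) fun j => ?_
  · rw [h3, h3', hd, borderCoord, Fin.cons_zero]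
    push_cast
    ring
  · rw [h4, h4']
    have h5 := hb j
    simp only [borderCoord, Fin.cons_succ] at h5
    rw [eq_div_iff (nodeDeriv_ne_zero h.strictMono_left j)] at h5
    have h6 : ‖b j‖ ^ 2 * nodeDeriv a j = -∏ i, (a j - k i) := by
      have := Real.pi_ne_zero
      refine mul_left_cancel₀ this ?_
      linarith
    have h7 := congrArg (fun x : ℝ => (x : ℂ)) h6
    simp only [nodeDeriv] at h7
    push_cast at h7 ⊢
    rw [h7, neg_neg]

/-- The whole bordered matrix is conjugated by the block matrix `diag(1, V)`. -/
theorem HermCoord.charpoly_border_conj {n : ℕ} {V : Matrix (Fin n) (Fin n) ℂ}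
    (hV : V ∈ Matrix.unitaryGroup (Fin n) ℂ) (d : ℝ) (b : Fin n → ℂ) {c c' : HermCoord n}
    (hc : c'.toMatrix = V * c.toMatrix * star V) :
    (HermCoord.border n ((d, Matrix.vecMul b (star V)), c')).toMatrix.charpoly =
      (HermCoord.border n ((d, b), c)).toMatrix.charpoly := by
  have h1 : star V * V = 1 := hV.1
  rw [charpoly_border, charpoly_border]
  have hB : Matrix.of (fun (_ : Unit) j => Matrix.vecMul b (star V) j) =
      Matrix.of (fun (_ : Unit) j => b j) * star V := by
    ext i j
    simp [Matrix.vecMul, dotProduct, Matrix.mul_apply]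
  have hC : Matrix.of (fun j (_ : Unit) => star (Matrix.vecMul b (star V) j)) =
      V * Matrix.of fun j (_ : Unit) => star (b j) := by
    ext i j
    simp [Matrix.vecMul, dotProduct, Matrix.mul_apply, Matrix.star_apply, mul_comm]
  have hmul : Matrix.fromBlocks (Matrix.of fun (_ _ : Unit) => (d : ℂ))
      (Matrix.of fun (_ : Unit) j => Matrix.vecMul b (star V) j)
      (Matrix.of fun j (_ : Unit) => star (Matrix.vecMul b (star V) j)) c'.toMatrix =
      Matrix.fromBlocks 1 0 0 V * (Matrix.fromBlocks (Matrix.of fun (_ _ : Unit) => (d : ℂ))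
        (Matrix.of fun _ j => b j) (Matrix.of fun j _ => star (b j)) c.toMatrix *
        Matrix.fromBlocks 1 0 0 (star V)) := by
    rw [hB, hC, hc, Matrix.fromBlocks_multiply, Matrix.fromBlocks_multiply]
    simp [mul_assoc]
  rw [hmul, Matrix.charpoly_mul_comm, mul_assoc, Matrix.fromBlocks_multiply, h1]
  simp [Matrix.fromBlocks_one]

/-- `π|z|²` is the area of the disc of radius `|z|`, so discs of area `r` correspond to intervals of
length `r`. This is the reason for keeping `π` in the border coordinates. -/
theorem measurePreserving_pi_mul_norm_sq :
    MeasurePreserving (fun z : ℂ => Real.pi * ‖z‖ ^ 2) volume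
      ((volume : Measure ℝ).restrict (Set.Ioi 0)) := by
  refine ⟨by fun_prop, ?_⟩
  have hball : ∀ r : ℝ, 0 ≤ r → volume {z : ℂ | Real.pi * ‖z‖ ^ 2 ≤ r} = ENNReal.ofReal r ∧
      volume {z : ℂ | Real.pi * ‖z‖ ^ 2 < r} = ENNReal.ofReal r := fun r hr => by
    have hs : 0 ≤ r / Real.pi := div_nonneg hr Real.pi_pos.le
    have e1 : {z : ℂ | Real.pi * ‖z‖ ^ 2 ≤ r} = Metric.closedBall 0 (Real.sqrt (r / Real.pi)) := by
      ext z
      rw [mem_closedBall_zero_iff, Set.mem_ofPred_eq, Real.le_sqrt (norm_nonneg _) hs,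
        le_div_iff₀ Real.pi_pos, mul_comm]
    have e2 : {z : ℂ | Real.pi * ‖z‖ ^ 2 < r} = Metric.ball 0 (Real.sqrt (r / Real.pi)) := by
      ext z
      rw [mem_ball_zero_iff, Set.mem_ofPred_eq, Real.lt_sqrt (norm_nonneg _),
        lt_div_iff₀ Real.pi_pos, mul_comm]
    have e3 : ENNReal.ofReal (Real.sqrt (r / Real.pi)) ^ 2 * NNReal.pi = ENNReal.ofReal r := by
      have : (NNReal.pi : ENNReal) = ENNReal.ofReal Real.pi := by
        rw [ENNReal.ofReal, ← NNReal.coe_real_pi, Real.toNNReal_coe]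
      rw [this, ← ENNReal.ofReal_pow (Real.sqrt_nonneg _), Real.sq_sqrt hs,
        ← ENNReal.ofReal_mul hs, div_mul_cancel₀ _ Real.pi_ne_zero]
    rw [e1, e2, Complex.volume_closedBall, Complex.volume_ball, e3]
    exact ⟨rfl, rfl⟩
  have hIoo : ∀ a b : ℝ, Measure.map (fun z : ℂ => Real.pi * ‖z‖ ^ 2) volume (Set.Ioo a b) =
      (volume : Measure ℝ).restrict (Set.Ioi 0) (Set.Ioo a b) := fun a b => by
    rw [Measure.map_apply (by fun_prop) measurableSet_Ioo, Measure.restrict_apply measurableSet_Ioo]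
    rcases lt_or_ge a 0 with ha | ha
    · have h1 : Set.Ioo a b ∩ Set.Ioi 0 = Set.Ioo 0 b := by
        ext t
        simp only [Set.mem_inter_iff, Set.mem_Ioo, Set.mem_Ioi]
        constructor
        · rintro ⟨⟨_, h2⟩, h3⟩
          exact ⟨h3, h2⟩
        · rintro ⟨h1, h2⟩
          exact ⟨⟨ha.trans h1, h2⟩, h1⟩
      have h2 : (fun z : ℂ => Real.pi * ‖z‖ ^ 2) ⁻¹' Set.Ioo a b =
          {z : ℂ | Real.pi * ‖z‖ ^ 2 < b} := by
        ext z
        simp only [Set.mem_preimage, Set.mem_Ioo, Set.mem_ofPred_eq, and_iff_right_iff_imp]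
        intro _
        exact ha.trans_le (by positivity)
      rw [h1, h2, Real.volume_Ioo, sub_zero]
      rcases le_total 0 b with hb | hb
      · exact (hball b hb).2
      · have : {z : ℂ | Real.pi * ‖z‖ ^ 2 < b} = ∅ := by
          ext z
          simp only [Set.mem_ofPred_eq, Set.mem_empty_iff_false, iff_false, not_lt]
          exact hb.trans (by positivity)
        rw [this, measure_empty, ENNReal.ofReal_of_nonpos hb]
    · have h1 : Set.Ioo a b ∩ Set.Ioi 0 = Set.Ioo a b :=
        Set.inter_eq_left.mpr fun t ht => ha.trans_lt ht.1
      rw [h1, Real.volume_Ioo]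
      rcases le_total b a with hab | hab
      · rw [Set.Ioo_eq_empty (not_lt.mpr hab), Set.preimage_empty, measure_empty,
          ENNReal.ofReal_of_nonpos (by linarith)]
      · have h2 : (fun z : ℂ => Real.pi * ‖z‖ ^ 2) ⁻¹' Set.Ioo a b =
            {z : ℂ | Real.pi * ‖z‖ ^ 2 < b} \ {z : ℂ | Real.pi * ‖z‖ ^ 2 ≤ a} := by
          ext z
          simp only [Set.mem_preimage, Set.mem_Ioo, Set.mem_sdiff, Set.mem_ofPred_eq, not_le]
          exact and_comm
        rcases hab.eq_or_lt with rfl | hlt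
        · simp
        have hsub : {z : ℂ | Real.pi * ‖z‖ ^ 2 ≤ a} ⊆ {z : ℂ | Real.pi * ‖z‖ ^ 2 < b} :=
          fun z (hz : Real.pi * ‖z‖ ^ 2 ≤ a) => lt_of_le_of_lt hz hlt
        rw [h2, measure_sdiff hsub (measurableSet_le (by fun_prop) measurable_const).nullMeasurableSet
          (by rw [(hball a ha).1]; exact ENNReal.ofReal_ne_top), (hball a ha).1,
          (hball b (ha.trans hab)).2, ENNReal.ofReal_sub _ ha]
  have hloc : IsLocallyFiniteMeasure
      (Measure.map (fun z : ℂ => Real.pi * ‖z‖ ^ 2) volume) := ⟨fun x =>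
    ⟨Set.Ioo (x - 1) (x + 1), Ioo_mem_nhds (by linarith) (by linarith), by
      rw [hIoo]
      exact (Measure.restrict_apply_le _ _).trans_lt measure_Ioo_lt_top⟩⟩
  exact Real.measure_ext_Ioo_rat fun a b => hIoo a b

theorem measurePreserving_borderParam (n : ℕ) :
    MeasurePreserving (fun p : ℝ × (Fin n → ℂ) =>
      (Fin.cons p.1 fun j => Real.pi * ‖p.2 j‖ ^ 2 : Fin (n + 1) → ℝ)) volume
      (volume.restrict {u : Fin (n + 1) → ℝ | ∀ j : Fin n, 0 < u j.succ}) := by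
  have h1 : MeasurePreserving (fun (b : Fin n → ℂ) j => Real.pi * ‖b j‖ ^ 2) volume
      ((volume : Measure (Fin n → ℝ)).restrict (Set.univ.pi fun _ => Set.Ioi 0)) := by
    have := measurePreserving_pi (fun _ : Fin n => (volume : Measure ℂ))
      (fun _ : Fin n => (volume : Measure ℝ).restrict (Set.Ioi 0))
      fun _ => measurePreserving_pi_mul_norm_sq
    rwa [← Measure.restrict_pi_pi] at this
  have h2 := (MeasurePreserving.id (volume : Measure ℝ)).prod h1
  have h3 := (volume_preserving_piFinSuccAbove (fun _ : Fin (n + 1) => ℝ) 0).symm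
  have hset : (MeasurableEquiv.piFinSuccAbove (fun _ : Fin (n + 1) => ℝ) 0).symm ⁻¹'
      {u : Fin (n + 1) → ℝ | ∀ j : Fin n, 0 < u j.succ} =
      Set.univ ×ˢ (Set.univ.pi fun _ => Set.Ioi 0) := by
    ext p
    simp only [Set.mem_preimage, Set.mem_ofPred_eq, Set.mem_prod, Set.mem_univ, true_and,
      Set.mem_pi, forall_true_left, Set.mem_Ioi]
    rfl
  have h4 := h3.restrict_preimage_emb (MeasurableEquiv.measurableEmbedding _)
    {u : Fin (n + 1) → ℝ | ∀ j : Fin n, 0 < u j.succ}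
  rw [hset, Measure.volume_eq_prod, ← Measure.prod_restrict, Measure.restrict_univ] at h4
  have hfun : (fun p : ℝ × (Fin n → ℂ) =>
      (Fin.cons p.1 fun j => Real.pi * ‖p.2 j‖ ^ 2 : Fin (n + 1) → ℝ)) =
      (MeasurableEquiv.piFinSuccAbove (fun _ : Fin (n + 1) => ℝ) 0).symm ∘
        Prod.map id fun b j => Real.pi * ‖b j‖ ^ 2 := by
    ext p j
    refine Fin.cases rfl (fun j => rfl) j
  rw [hfun]
  exact h4.comp h2

/-! ### Integrating out the first row and column -/

/-- Functions of Hermitian matrices that depend only on the eigenvalues. -/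
def SpectralInvariant {n : ℕ} (f : HermCoord n → ℂ) : Prop :=
  ∀ c c' : HermCoord n, c.toMatrix.charpoly = c'.toMatrix.charpoly → f c = f c'

/-- Partial Fourier integral over the first row and column. -/
def borderIntegral {n : ℕ} (f : HermCoord (n + 1) → ℂ) (x : ℝ) (c : HermCoord n) : ℂ :=
  ∫ p : ℝ × (Fin n → ℂ), f (HermCoord.border n (p, c)) * Complex.exp (-Complex.I * p.1 * x)

/-- Over a diagonal block the spectrum depends on `b` only through the `|b_j|²`. The integral
therefore descends to `u = (d, π|b_j|²)` with `u_j > 0`, and `setIntegral_border` substitutes the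
interlacing eigenvalues for `u`. -/
theorem borderIntegral_diag {n : ℕ} {f : HermCoord (n + 1) → ℂ} (hf : Measurable f)
    (hfi : SpectralInvariant f) (x : ℝ) {a : Fin n → ℝ} (ha : StrictMono a) :
    borderIntegral f x (HermCoord.diag a) = ∫ k in {k | Interlaces a k},
      ((Real.pi ^ n * (Matrix.vandermonde k).det / (Matrix.vandermonde a).det : ℝ) : ℂ) *
      (f (HermCoord.diag k) * Complex.exp (-Complex.I * ((∑ i, k i - ∑ j, a j : ℝ) : ℂ) * x)) := by
  -- A representative border for given `u`, with real nonnegative entries `√(u_j / π)`.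
  let q : (Fin (n + 1) → ℝ) → ℝ × (Fin n → ℂ) := fun u =>
    (u 0, fun j => ((Real.sqrt (u j.succ / Real.pi) : ℝ) : ℂ))
  have hq : Measurable q := by
    simp only [q]
    fun_prop
  let G : (Fin (n + 1) → ℝ) → ℂ := fun u =>
    f (HermCoord.border n (q u, HermCoord.diag a)) * Complex.exp (-Complex.I * u 0 * x)
  have hG : Measurable G := by
    refine Measurable.mul (hf.comp ((HermCoord.border n).measurable.comp
      (hq.prodMk measurable_const))) (by fun_prop)
  have hbG : borderIntegral f x (HermCoord.diag a) = ∫ p : ℝ × (Fin n → ℂ),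
      G (Fin.cons p.1 fun j => Real.pi * ‖p.2 j‖ ^ 2 : Fin (n + 1) → ℝ) := by
    refine integral_congr_ae (Eventually.of_forall fun p => ?_)
    simp only [G, q, Fin.cons_zero, Fin.cons_succ]
    congr 1
    refine hfi _ _ ?_
    rw [← Prod.mk.eta (p := p), HermCoord.charpoly_border_diag, HermCoord.charpoly_border_diag]
    congr 1
    ext j
    rw [mul_div_cancel_left₀ _ Real.pi_ne_zero, Real.sqrt_sq (norm_nonneg _)]
    simp
  rw [hbG]
  have hmap := measurePreserving_borderParam n
  rw [← integral_map hmap.measurable.aemeasurable hG.aestronglyMeasurable, hmap.map_eq,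
    setIntegral_border ha]
  refine setIntegral_congr_fun (measurableSet_interlaces a) fun k hk => ?_
  have hk' : Interlaces a k := hk
  simp only [G]
  congr 2
  refine hfi _ _ (HermCoord.charpoly_border_borderCoord hk' rfl fun j => ?_)
  have hpos := borderCoord_succ_pos hk' j
  rw [Complex.norm_real, Real.norm_of_nonneg (Real.sqrt_nonneg _),
    Real.sq_sqrt (div_nonneg hpos.le Real.pi_pos.le), mul_div_cancel₀ _ Real.pi_ne_zero]

/-- Conjugating the block by `V` is compensated by the measure-preserving substitution `b ↦ b V*` in
the border. This lets the induction continue with the smaller matrix. -/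
theorem spectralInvariant_borderIntegral {n : ℕ} {f : HermCoord (n + 1) → ℂ}
    (hfi : SpectralInvariant f) (x : ℝ) : SpectralInvariant (borderIntegral f x) := by
  intro c c' hcc
  obtain ⟨V, hV, hVc⟩ := exists_unitary_of_charpoly_eq c.toMatrix_isHermitian
    c'.toMatrix_isHermitian hcc
  have hV' : star V ∈ Matrix.unitaryGroup (Fin n) ℂ := Unitary.star_mem hV
  have hpres : MeasurePreserving (fun p : ℝ × (Fin n → ℂ) => (p.1, Matrix.vecMul p.2 (star V)))
      volume volume :=
    (MeasurePreserving.id (volume : Measure ℝ)).prod (measurePreserving_vecMul hV')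
  have hVV : V * star V = 1 := Unitary.mul_star_self_of_mem hV
  have hVV' : star V * V = 1 := Unitary.star_mul_self_of_mem hV
  let e : ℝ × (Fin n → ℂ) ≃ᵐ ℝ × (Fin n → ℂ) :=
    { toFun := fun p => (p.1, Matrix.vecMul p.2 (star V))
      invFun := fun p => (p.1, Matrix.vecMul p.2 V)
      left_inv := fun p => by simp [Matrix.vecMul_vecMul, hVV']
      right_inv := fun p => by simp [Matrix.vecMul_vecMul, hVV]
      measurable_toFun := hpres.measurable
      measurable_invFun :=
        ((MeasurePreserving.id (volume : Measure ℝ)).prod (measurePreserving_vecMul hV)).measurable }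
  have he : MeasurePreserving e volume volume := hpres
  rw [borderIntegral, borderIntegral, ← he.integral_comp' (g := fun p =>
    f (HermCoord.border n (p, c')) * Complex.exp (-Complex.I * p.1 * x))]
  refine integral_congr_ae (Eventually.of_forall fun p => ?_)
  change _ = f (HermCoord.border n ((p.1, Matrix.vecMul p.2 (star V)), c')) *
    Complex.exp (-Complex.I * p.1 * x)
  simp only
  congr 1
  exact hfi _ _ (HermCoord.charpoly_border_conj hV p.1 p.2 hVc).symm

theorem measurable_borderIntegral {n : ℕ} {f : HermCoord (n + 1) → ℂ} (hf : Measurable f) (x : ℝ) :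
    Measurable (borderIntegral f x) := by
  have h : Measurable fun q : (ℝ × (Fin n → ℂ)) × HermCoord n =>
      f (HermCoord.border n q) * Complex.exp (-Complex.I * q.1.1 * x) :=
    (hf.comp (HermCoord.border n).measurable).mul (by fun_prop)
  exact (h.stronglyMeasurable.integral_prod_left).measurable

/-! ### Exponential determinants over interlacing sequences -/

theorem vandermondeProd_succ {n : ℕ} (x : Fin (n + 1) → ℝ) :
    vandermondeProd x = (∏ j : Fin n, (x 0 - x j.succ)) * vandermondeProd fun j => x j.succ := by
  rw [vandermondeProd, Fin.prod_univ_succ, Fin.prod_Ioi_zero, vandermondeProd]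
  simp only [Fin.prod_Ioi_succ]

/-- Subtracting from each row its predecessor turns the column of ones into `(1, 0, ..., 0)`.
Expanding along it leaves the differences. -/
theorem det_sub_succ {n : ℕ} {R : Type*} [CommRing R] (E : Fin (n + 1) → Fin n → R) :
    (Matrix.of fun i j : Fin n => E i.succ j - E i.castSucc j).det =
      (Matrix.of fun i j : Fin (n + 1) => (Fin.cons 1 (E i) : Fin (n + 1) → R) j).det := by
  let B : Matrix (Fin (n + 1)) (Fin (n + 1)) R := Matrix.of fun i j =>
    (Fin.cons ((Fin.cons 1 (E 0) : Fin (n + 1) → R) j) (fun i' =>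
      (Fin.cons 0 fun j' => E i'.succ j' - E i'.castSucc j' : Fin (n + 1) → R) j) :
        Fin (n + 1) → R) i
  rw [Matrix.det_eq_of_forall_row_eq_smul_add_pred (B := B) (fun _ => 1) (fun j => ?_)
    fun i j => ?_]
  · rw [Matrix.det_succ_column_zero, Fin.sum_univ_succ, Finset.sum_eq_zero]
    · simp only [B, Matrix.of_apply, Fin.cons_zero, Fin.val_zero, pow_zero, one_mul, add_zero]
      congr 1
    · intro i _
      simp [B]
  · simp [B]
  · refine Fin.cases ?_ (fun j => ?_) j <;> simp [B]

theorem interlaces_pi {n : ℕ} (k : Fin (n + 1) → ℝ) :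
    {a : Fin n → ℝ | Interlaces a k} =
      Set.univ.pi fun i : Fin n => Set.Ioo (k i.castSucc) (k i.succ) := by
  ext a
  simp [Interlaces, Set.mem_pi]

theorem setIntegral_Ioo_cexp {u v η : ℝ} (huv : u ≤ v) (hη : η ≠ 0) :
    ∫ t in Set.Ioo u v, Complex.exp (-Complex.I * t * η) =
      (-Complex.I * η)⁻¹ *
        (Complex.exp (-Complex.I * v * η) - Complex.exp (-Complex.I * u * η)) := by
  have hc : -Complex.I * (η : ℂ) ≠ 0 := by
    simp [hη]
  have h := integral_exp_mul_complex (a := u) (b := v) hc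
  rw [← integral_Ioc_eq_integral_Ioo, ← intervalIntegral.integral_of_le huv, inv_mul_eq_div]
  have e : ∀ t : ℝ, -Complex.I * (t : ℂ) * η = -Complex.I * η * t := fun t => by ring
  simp_rw [e]
  exact h

/-- For fixed `k` the interlacing sequences form the box `∏ (k_i, k_{i+1})`, so each row is
integrated separately into a difference of exponentials, and `det_sub_succ` applies. -/
theorem setIntegral_interlaces_det {n : ℕ} {k : Fin (n + 1) → ℝ} (hk : StrictMono k)
    {η : Fin n → ℝ} (hη : ∀ j, η j ≠ 0) :
    ∫ a in {a : Fin n → ℝ | Interlaces a k},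
      (Matrix.of fun i j : Fin n => Complex.exp (-Complex.I * a i * η j)).det =
    (∏ j, (-Complex.I * η j)⁻¹) * (Matrix.of fun i j : Fin (n + 1) =>
      (Fin.cons 1 (fun j => Complex.exp (-Complex.I * k i * η j)) : Fin (n + 1) → ℂ) j).det := by
  have hle : ∀ i : Fin n, k i.castSucc ≤ k i.succ := fun i =>
    (hk (Fin.castSucc_lt_succ (i := i))).le
  have hT : ∀ a : Fin n → ℝ, (Matrix.of fun i j : Fin n => Complex.exp (-Complex.I * a i * η j)).det
      = (Matrix.of fun j i : Fin n => Complex.exp (-Complex.I * a i * η j)).det := fun a => by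
    rw [← Matrix.det_transpose]
    rfl
  rw [interlaces_pi, volume_pi, Measure.restrict_pi_pi]
  simp_rw [hT]
  rw [integral_det (μ := fun i : Fin n => volume.restrict (Set.Ioo (k i.castSucc) (k i.succ)))
    (F := fun j _ t => Complex.exp (-Complex.I * t * η j)) fun j i => ?_]
  · simp_rw [setIntegral_Ioo_cexp (hle _) (hη _)]
    rw [← det_sub_succ, ← Matrix.det_transpose, ← Matrix.det_mul_row]
    rfl
  · exact (Continuous.integrableOn_Icc (by fun_prop)).mono_set Set.Ioo_subset_Icc_self

/-- Multiplying row `i` by `exp(-i k_i x_0)` undoes the shift of frequencies and turns the column of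
ones into the missing column for `x_0`. -/
theorem setIntegral_interlaces_det_shift {n : ℕ} {k : Fin (n + 1) → ℝ} (hk : StrictMono k)
    {x : Fin (n + 1) → ℝ} (hx : Function.Injective x) :
    Complex.exp (-Complex.I * ((∑ i, k i : ℝ) : ℂ) * x 0) *
    ∫ a in {a : Fin n → ℝ | Interlaces a k}, (Matrix.of fun i j : Fin n =>
      Complex.exp (-Complex.I * a i * ((x j.succ - x 0 : ℝ) : ℂ))).det =
    (∏ j : Fin n, (-Complex.I * ((x j.succ - x 0 : ℝ) : ℂ))⁻¹) *
      (Matrix.of fun i j : Fin (n + 1) => Complex.exp (-Complex.I * k i * x j)).det := by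
  rw [setIntegral_interlaces_det hk fun j => sub_ne_zero.mpr fun h => Fin.succ_ne_zero j (hx h),
    mul_left_comm]
  congr 1
  have h := Matrix.det_mul_column (fun i : Fin (n + 1) => Complex.exp (-Complex.I * k i * x 0))
    (Matrix.of fun i j : Fin (n + 1) => (Fin.cons 1 (fun j =>
      Complex.exp (-Complex.I * k i * ((x j.succ - x 0 : ℝ) : ℂ))) : Fin (n + 1) → ℂ) j)
  have hs : ∏ i, Complex.exp (-Complex.I * k i * x 0) =
      Complex.exp (-Complex.I * ((∑ i, k i : ℝ) : ℂ) * x 0) := by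
    rw [← Complex.exp_sum]
    push_cast
    rw [Finset.mul_sum, Finset.sum_mul]
  rw [← hs, ← h]
  congr 1
  ext i j
  refine Fin.cases ?_ (fun j => ?_) j
  · simp
  · simp only [Matrix.of_apply, Fin.cons_succ]
    rw [← Complex.exp_add]
    congr 1
    push_cast
    ring

/-! ### The Fourier transform of a spectral function -/

/-- On ordered diagonal matrices, `f` times the Vandermonde determinant is bounded by `C` and
`f` vanishes outside a box of size `R`. -/
def TameOnDiag {n : ℕ} (f : HermCoord n → ℂ) (C R : ℝ) : Prop :=
  ∀ a : Fin n → ℝ, StrictMono a →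
    ‖f (HermCoord.diag a) * ((Matrix.vandermonde a).det : ℂ)‖ ≤ C ∧
    (f (HermCoord.diag a) ≠ 0 → ∀ i, |a i| ≤ R)

theorem mem_Icc_const_iff {n : ℕ} {R : ℝ} {k : Fin n → ℝ} :
    k ∈ Set.Icc (fun _ => -R) (fun _ => R) ↔ ∀ i, |k i| ≤ R := by
  simp only [Set.mem_Icc, Pi.le_def, abs_le]
  exact ⟨fun h i => ⟨h.1 i, h.2 i⟩, fun h => ⟨fun i => (h i).1, fun i => (h i).2⟩⟩

theorem Interlaces.abs_le {n : ℕ} {a : Fin n → ℝ} {k : Fin (n + 1) → ℝ} (h : Interlaces a k)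
    {R : ℝ} (hk : ∀ i, |k i| ≤ R) (i : Fin n) : |a i| ≤ R :=
  _root_.abs_le.mpr ⟨(_root_.abs_le.mp (hk i.castSucc)).1.trans (h i).1.le,
    (h i).2.le.trans (_root_.abs_le.mp (hk i.succ)).2⟩

theorem norm_cexp_neg_I_mul (s t : ℝ) : ‖Complex.exp (-Complex.I * s * t)‖ = 1 := by
  simp [Complex.norm_exp]

theorem borderIntegral_diag_mul {n : ℕ} {f : HermCoord (n + 1) → ℂ} (hf : Measurable f)
    (hfi : SpectralInvariant f) (x : ℝ) {a : Fin n → ℝ} (ha : StrictMono a) :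
    borderIntegral f x (HermCoord.diag a) * ((Matrix.vandermonde a).det : ℂ) =
      ∫ k in {k | Interlaces a k}, (Real.pi : ℂ) ^ n *
        (f (HermCoord.diag k) * ((Matrix.vandermonde k).det : ℂ) *
          Complex.exp (-Complex.I * ((∑ i, k i - ∑ j, a j : ℝ) : ℂ) * x)) := by
  rw [borderIntegral_diag hf hfi x ha, ← integral_mul_const]
  refine setIntegral_congr_fun (measurableSet_interlaces a) fun k _ => ?_
  have : ((Matrix.vandermonde a).det : ℂ) ≠ 0 := by exact_mod_cast (det_vandermonde_pos ha).ne'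
  push_cast
  field_simp

/-- An interlacing `a` lies between the extreme entries of `k`, so the box of size `R` is inherited.
The Vandermonde factor of `a` cancels the denominator of the Jacobian, and the new bound is the old
one times `π^n` and the volume of the box. -/
theorem TameOnDiag.borderIntegral {n : ℕ} {f : HermCoord (n + 1) → ℂ} (hf : Measurable f)
    (hfi : SpectralInvariant f) {C R : ℝ} (ht : TameOnDiag f C R) (x : ℝ) :
    TameOnDiag (borderIntegral f x) (Real.pi ^ n * C *
      (volume : Measure (Fin (n + 1) → ℝ)).real (Set.Icc (fun _ => -R) (fun _ => R))) R := by
  have hC : 0 ≤ C := by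
    have : StrictMono fun i : Fin (n + 1) => (i : ℝ) := fun i j h => Nat.cast_lt.mpr h
    exact (norm_nonneg _).trans (ht _ this).1
  intro a ha
  constructor
  · rw [borderIntegral_diag_mul hf hfi x ha,
      setIntegral_eq_of_subset_of_forall_sdiff_eq_zero
        (s := {k | Interlaces a k} ∩ Set.Icc (fun _ => -R) (fun _ => R))
        (measurableSet_interlaces a) Set.inter_subset_left fun k hk => ?_]
    · have hfin : volume ({k | Interlaces a k} ∩ Set.Icc (fun _ => -R) (fun _ => R)) < ⊤ :=
        (measure_mono Set.inter_subset_right).trans_lt isCompact_Icc.measure_lt_top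
      refine (norm_setIntegral_le_of_norm_le_const hfin (C := Real.pi ^ n * C) fun k hk => ?_).trans ?_
      · have hk' : Interlaces a k := hk.1
        rw [norm_mul, norm_mul, norm_cexp_neg_I_mul, mul_one, norm_pow, Complex.norm_real,
          Real.norm_of_nonneg Real.pi_pos.le]
        have := (ht k hk'.strictMono_right).1
        gcongr
      · have hm := measureReal_mono (μ := volume) (s₁ := {k | Interlaces a k} ∩
            Set.Icc (fun _ => -R) (fun _ => R)) (s₂ := Set.Icc (fun _ => -R) (fun _ => R))
          Set.inter_subset_right isCompact_Icc.measure_lt_top.ne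
        have := Real.pi_pos
        gcongr
    · have hk' : Interlaces a k := hk.1
      have h0 : f (HermCoord.diag k) = 0 := by
        by_contra hne
        exact hk.2 ⟨hk.1, mem_Icc_const_iff.mpr ((ht k hk'.strictMono_right).2 hne)⟩
      rw [h0]
      ring
  · intro hne i
    by_contra hi
    refine hne ?_
    rw [borderIntegral_diag hf hfi x ha]
    refine setIntegral_eq_zero_of_forall_eq_zero fun k hk => ?_
    have hk' : Interlaces a k := hk
    have h0 : f (HermCoord.diag k) = 0 := by
      by_contra hne
      exact hi (hk'.abs_le ((ht k hk'.strictMono_right).2 hne) i)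
    rw [h0]
    ring

theorem measurableSet_interlaces_prod (n : ℕ) :
    MeasurableSet {p : (Fin n → ℝ) × (Fin (n + 1) → ℝ) | Interlaces p.1 p.2} := by
  have : {p : (Fin n → ℝ) × (Fin (n + 1) → ℝ) | Interlaces p.1 p.2} =
      ⋂ i : Fin n, ({p | p.2 i.castSucc < p.1 i} ∩ {p | p.1 i < p.2 i.succ}) := by
    ext k
    simp [Interlaces]
  rw [this]
  exact MeasurableSet.iInter fun i => (measurableSet_lt (by fun_prop) (by fun_prop)).inter
    (measurableSet_lt (by fun_prop) (by fun_prop))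

theorem HermCoord.measurable_diag (n : ℕ) : Measurable (HermCoord.diag : (Fin n → ℝ) → HermCoord n) := by
  unfold HermCoord.diag
  fun_prop

theorem norm_det_cexp_le {n : ℕ} (a y : Fin n → ℝ) :
    ‖(Matrix.of fun i j : Fin n => Complex.exp (-Complex.I * a i * y j)).det‖ ≤
      Fintype.card (Equiv.Perm (Fin n)) := by
  rw [Matrix.det_apply']
  have hle : ∀ σ ∈ (Finset.univ : Finset (Equiv.Perm (Fin n))), ‖(Equiv.Perm.sign σ : ℂ) *
      ∏ i, (Matrix.of fun i j : Fin n => Complex.exp (-Complex.I * a i * y j)) (σ i) i‖ ≤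
      (1 : ℝ) := fun σ _ => by
    rw [norm_mul, norm_prod]
    rcases Int.units_eq_one_or (Equiv.Perm.sign σ) with h | h <;> simp [h, Complex.norm_exp]
  have := norm_sum_le_of_le _ hle
  rwa [Finset.sum_const, nsmul_eq_mul, mul_one, Finset.card_univ] at this

theorem det_cexp_shift {n : ℕ} (a y : Fin n → ℝ) (t : ℝ) :
    (Matrix.of fun i j : Fin n => Complex.exp (-Complex.I * a i * ((y j - t : ℝ) : ℂ))).det =
      Complex.exp (-Complex.I * ((-∑ j, a j : ℝ) : ℂ) * t) *
      (Matrix.of fun i j : Fin n => Complex.exp (-Complex.I * a i * y j)).det := by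
  have h := Matrix.det_mul_column (fun i : Fin n => Complex.exp (Complex.I * a i * t))
    (Matrix.of fun i j : Fin n => Complex.exp (-Complex.I * a i * y j))
  have hs : ∏ i, Complex.exp (Complex.I * a i * t) =
      Complex.exp (-Complex.I * ((-∑ j, a j : ℝ) : ℂ) * t) := by
    rw [← Complex.exp_sum]
    push_cast
    rw [← Finset.sum_mul, ← Finset.mul_sum]
    ring_nf
  rw [← hs, ← h]
  congr 1
  ext i j
  simp only [Matrix.of_apply]
  rw [← Complex.exp_add]
  congr 1
  push_cast
  ring

/-- Exchange of the order of integration over interlacing sequences. -/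
theorem integral_interlaces_swap {n : ℕ} {f : HermCoord (n + 1) → ℂ} (hf : Measurable f)
    {C R : ℝ} (ht : TameOnDiag f C R) {G : (Fin (n + 1) → ℝ) → ℂ} {H : (Fin n → ℝ) → ℂ}
    (hG : ∀ k, G k = f (HermCoord.diag k) * ((Matrix.vandermonde k).det : ℂ))
    (hHm : Measurable H) {B : ℝ} (hB : ∀ a, ‖H a‖ ≤ B) (E : (Fin (n + 1) → ℝ) → ℂ)
    (hE : Measurable E) (hE1 : ∀ k, ‖E k‖ ≤ 1) :
    ∫ a in {a : Fin n → ℝ | StrictMono a}, ∫ k in {k | Interlaces a k}, G k * E k * H a =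
      ∫ k in {k : Fin (n + 1) → ℝ | StrictMono k},
        G k * E k * ∫ a in {a | Interlaces a k}, H a := by
  let S : Set ((Fin n → ℝ) × (Fin (n + 1) → ℝ)) := {p | Interlaces p.1 p.2}
  have hS : MeasurableSet S := measurableSet_interlaces_prod n
  let F : (Fin n → ℝ) → (Fin (n + 1) → ℝ) → ℂ := fun a k =>
    S.indicator (fun p => G p.2 * E p.2 * H p.1) (a, k)
  have hGm : Measurable G := by
    have : G = fun k => f (HermCoord.diag k) * ((Matrix.vandermonde k).det : ℂ) := funext hG
    rw [this]
    exact (hf.comp (HermCoord.measurable_diag _)).mul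
      (Complex.measurable_ofReal.comp (continuous_det_vandermonde _).measurable)
  have hC : 0 ≤ C := by
    have : StrictMono fun i : Fin (n + 1) => (i : ℝ) := fun i j h => Nat.cast_lt.mpr h
    exact (norm_nonneg _).trans (ht _ this).1
  have hB0 : 0 ≤ B := (norm_nonneg _).trans (hB 0)
  have hF : Integrable (Function.uncurry F) (volume.prod volume) := by
    -- On interlacing pairs the integrand is supported in a product of boxes and bounded by `C * B`,
    -- which justifies Fubini.
    have hbox : Integrable ((Set.Icc (fun _ => -R) (fun _ => R) ×ˢ
        Set.Icc (fun _ => -R) (fun _ => R)).indicator fun _ => C * B)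
        ((volume : Measure (Fin n → ℝ)).prod (volume : Measure (Fin (n + 1) → ℝ))) := by
      rw [integrable_indicator_iff (measurableSet_Icc.prod measurableSet_Icc)]
      refine integrableOn_const ?_
      rw [Measure.prod_prod]
      exact (ENNReal.mul_lt_top isCompact_Icc.measure_lt_top isCompact_Icc.measure_lt_top).ne
    refine hbox.mono' ?_ (Eventually.of_forall fun p => ?_)
    · have : Measurable fun p : (Fin n → ℝ) × (Fin (n + 1) → ℝ) => G p.2 * E p.2 * H p.1 :=
        ((hGm.comp measurable_snd).mul (hE.comp measurable_snd)).mul (hHm.comp measurable_fst)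
      exact (this.indicator hS).aestronglyMeasurable
    · change ‖S.indicator (fun p => G p.2 * E p.2 * H p.1) p‖ ≤ _
      by_cases hp : p ∈ S
      · have hp' : Interlaces p.1 p.2 := hp
        rw [Set.indicator_of_mem hp]
        by_cases h0 : f (HermCoord.diag p.2) = 0
        · rw [hG, h0]
          simp only [zero_mul, norm_zero]
          exact Set.indicator_nonneg (fun _ _ => mul_nonneg hC hB0) _
        · have hk := (ht p.2 hp'.strictMono_right).2 h0
          rw [Set.indicator_of_mem (Set.mk_mem_prod
            (mem_Icc_const_iff.mpr (hp'.abs_le hk)) (mem_Icc_const_iff.mpr hk)),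
            norm_mul, norm_mul]
          have h1 := (ht p.2 hp'.strictMono_right).1
          rw [← hG] at h1
          calc ‖G p.2‖ * ‖E p.2‖ * ‖H p.1‖ ≤ C * 1 * B := by
                gcongr
                · exact hE1 _
                · exact hB _
            _ = C * B := by ring
      · rw [Set.indicator_of_notMem hp, norm_zero]
        exact Set.indicator_nonneg (fun _ _ => mul_nonneg hC hB0) _
  have h1 : ∀ a, ∫ k in {k | Interlaces a k}, G k * E k * H a = ∫ k, F a k := fun a => by
    rw [← integral_indicator (measurableSet_interlaces a)]
    rfl
  have h2 : ∀ k, G k * E k * ∫ a in {a | Interlaces a k}, H a = ∫ a, F a k := fun k => by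
    have hm : MeasurableSet {a : Fin n → ℝ | Interlaces a k} := by
      rw [interlaces_pi]
      exact MeasurableSet.univ_pi fun i => measurableSet_Ioo
    rw [← integral_const_mul, ← integral_indicator hm]
    rfl
  simp_rw [h1, h2]
  rw [setIntegral_eq_integral_of_forall_compl_eq_zero fun a ha => ?_,
    setIntegral_eq_integral_of_forall_compl_eq_zero fun k hk => ?_]
  · exact integral_integral_swap hF
  · refine integral_eq_zero_of_ae (Eventually.of_forall fun a => ?_)
    exact Set.indicator_of_notMem (fun h : Interlaces a k => hk h.strictMono_right) _
  · refine integral_eq_zero_of_ae (Eventually.of_forall fun k => ?_)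
    exact Set.indicator_of_notMem (fun h : Interlaces a k => ha h.strictMono_left) _

theorem integrable_border_cexp {n : ℕ} {f : HermCoord (n + 1) → ℂ} (hint : Integrable f)
    (x : Fin (n + 1) → ℝ) :
    Integrable (fun q : (ℝ × (Fin n → ℂ)) × HermCoord n =>
      f (HermCoord.border n q) * Complex.exp (-Complex.I * q.1.1 * x 0))
      (volume.prod volume) := by
  have h := (HermCoord.measurePreserving_border n).integrable_comp_emb
    (HermCoord.border n).measurableEmbedding |>.mpr hint
  refine h.mul_bdd (c := 1) (by fun_prop) (Eventually.of_forall fun q => ?_)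
  exact (norm_cexp_neg_I_mul _ _).le

/-- The Fourier transform of a spectral function at a diagonal matrix, as an integral over ordered
eigenvalues. -/
theorem integral_spectral_cexp (n : ℕ) : ∀ (f : HermCoord n → ℂ), Measurable f →
    SpectralInvariant f → Integrable f → ∀ C R : ℝ, TameOnDiag f C R →
    ∀ x : Fin n → ℝ, Function.Injective x →
    (∫ c : HermCoord n, f c * ∏ i, Complex.exp (-Complex.I * c.1 i * x i)) *
      (vandermondeProd x : ℂ) =
    (-Complex.I * Real.pi) ^ (n * (n - 1) / 2) * ∫ a in {a : Fin n → ℝ | StrictMono a},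
      f (HermCoord.diag a) * ((Matrix.vandermonde a).det : ℂ) *
        (Matrix.of fun i j : Fin n => Complex.exp (-Complex.I * a i * x j)).det := by
  induction n with
  | zero =>
    intro f _ _ _ _ _ _ x _
    have hu : {a : Fin 0 → ℝ | StrictMono a} = Set.univ :=
      Set.eq_univ_of_forall fun a => Subsingleton.strictMono a
    have h1 : (volume : Measure (Fin 0 → ℝ)).real Set.univ = 1 := by
      simp [measureReal_def, volume_pi]
    have h2 : (volume : Measure (HermCoord 0)).real Set.univ = 1 := by
      rw [measureReal_def, Measure.volume_eq_prod, ← Set.univ_prod_univ, Measure.prod_prod]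
      simp [volume_pi]
    rw [hu, setIntegral_univ]
    have : ∀ c : HermCoord 0, c = HermCoord.diag 0 := fun c => Subsingleton.elim _ _
    have h3 : ∀ a : Fin 0 → ℝ, a = 0 := fun a => Subsingleton.elim _ _
    have e1 : ∀ c : HermCoord 0, f c * ∏ i, Complex.exp (-Complex.I * c.1 i * x i) =
        f (HermCoord.diag 0) := fun c => by
      rw [this c]
      simp
    have e2 : ∀ a : Fin 0 → ℝ, f (HermCoord.diag a) * ((Matrix.vandermonde a).det : ℂ) *
        (Matrix.of fun i j : Fin 0 => Complex.exp (-Complex.I * a i * x j)).det =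
        f (HermCoord.diag 0) := fun a => by
      rw [h3 a]
      simp
    simp_rw [e1, e2]
    rw [integral_const, integral_const, h1, h2]
    simp [vandermondeProd]
  | succ n ih =>
    intro f hf hfi hint C R ht x hx
    have hF := integrable_border_cexp hint x
    have hcexp : ∀ q : (ℝ × (Fin n → ℂ)) × HermCoord n,
        f (HermCoord.border n q) *
          ∏ i, Complex.exp (-Complex.I * (HermCoord.border n q).1 i * x i) =
        f (HermCoord.border n q) * Complex.exp (-Complex.I * q.1.1 * x 0) *
          ∏ i, Complex.exp (-Complex.I * q.2.1 i * x i.succ) := fun q => by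
      rw [Fin.prod_univ_succ, ← mul_assoc]
      rfl
    have hF2 : Integrable (fun q : (ℝ × (Fin n → ℂ)) × HermCoord n =>
        f (HermCoord.border n q) * Complex.exp (-Complex.I * q.1.1 * x 0) *
          ∏ i, Complex.exp (-Complex.I * q.2.1 i * x i.succ)) (volume.prod volume) := by
      refine hF.mul_bdd (c := 1) (Continuous.aestronglyMeasurable (by fun_prop))
        (Eventually.of_forall fun q => ?_)
      rw [norm_prod]
      simp [Complex.norm_exp]
    -- The phase splits into a factor in the corner entry `d` and factors in the diagonal of the
    -- remaining block, so the inner integral is `borderIntegral f (x 0)`.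
    have hL : ∫ c : HermCoord (n + 1), f c * ∏ i, Complex.exp (-Complex.I * c.1 i * x i) =
        ∫ c : HermCoord n, borderIntegral f (x 0) c *
          ∏ i, Complex.exp (-Complex.I * c.1 i * x i.succ) := by
      rw [← (HermCoord.measurePreserving_border n).integral_comp'
        (g := fun c => f c * ∏ i, Complex.exp (-Complex.I * c.1 i * x i))]
      simp_rw [hcexp]
      rw [Measure.volume_eq_prod, integral_prod_symm _ hF2]
      simp only [integral_mul_const]
      rfl
    have hinth : Integrable (borderIntegral f (x 0)) := hF.integral_prod_right
    rw [hL, vandermondeProd_succ, Complex.ofReal_mul, mul_left_comm,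
      ih (borderIntegral f (x 0)) (measurable_borderIntegral hf _)
        (spectralInvariant_borderIntegral hfi _) hinth _ _
        (TameOnDiag.borderIntegral hf hfi ht (x 0)) (fun j => x j.succ)
        (fun i j h => Fin.succ_injective _ (hx h))]
    -- The phase `exp(i (∑ a) x_0)` produced by `d = ∑ k - ∑ a` is absorbed into the determinant by
    -- replacing each `x_j` with `x_j - x_0`.
    have hR : ∫ a in {a : Fin n → ℝ | StrictMono a},
        borderIntegral f (x 0) (HermCoord.diag a) * ((Matrix.vandermonde a).det : ℂ) *
          (Matrix.of fun i j : Fin n => Complex.exp (-Complex.I * a i * x j.succ)).det =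
        (Real.pi : ℂ) ^ n * ∫ a in {a : Fin n → ℝ | StrictMono a}, ∫ k in {k | Interlaces a k},
          (f (HermCoord.diag k) * ((Matrix.vandermonde k).det : ℂ)) *
          Complex.exp (-Complex.I * ((∑ i, k i : ℝ) : ℂ) * x 0) *
          (Matrix.of fun i j : Fin n =>
            Complex.exp (-Complex.I * a i * ((x j.succ - x 0 : ℝ) : ℂ))).det := by
      rw [← integral_const_mul]
      refine setIntegral_congr_fun (measurableSet_strictMono n) fun a ha => ?_
      rw [borderIntegral_diag_mul hf hfi (x 0) ha, ← integral_mul_const, ← integral_const_mul]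
      refine setIntegral_congr_fun (measurableSet_interlaces a) fun k _ => ?_
      rw [det_cexp_shift a (fun j => x j.succ) (x 0)]
      have : Complex.exp (-Complex.I * ((∑ i, k i - ∑ j, a j : ℝ) : ℂ) * x 0) =
          Complex.exp (-Complex.I * ((∑ i, k i : ℝ) : ℂ) * x 0) *
          Complex.exp (-Complex.I * ((-∑ j, a j : ℝ) : ℂ) * x 0) := by
        rw [← Complex.exp_add]
        congr 1
        push_cast
        ring
      rw [this]
      ring
    have hswap := integral_interlaces_swap hf ht (fun _ => rfl)
      (H := fun a : Fin n → ℝ => (Matrix.of fun i j : Fin n =>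
        Complex.exp (-Complex.I * a i * ((x j.succ - x 0 : ℝ) : ℂ))).det)
      (Continuous.measurable (by fun_prop)) (fun a => norm_det_cexp_le a fun j => x j.succ - x 0)
      (fun k => Complex.exp (-Complex.I * ((∑ i, k i : ℝ) : ℂ) * x 0))
      (Continuous.measurable (by fun_prop)) (fun k => (norm_cexp_neg_I_mul _ _).le)
    rw [hR, hswap]
    have hfin : ∫ k in {k : Fin (n + 1) → ℝ | StrictMono k},
        f (HermCoord.diag k) * ((Matrix.vandermonde k).det : ℂ) *
          Complex.exp (-Complex.I * ((∑ i, k i : ℝ) : ℂ) * x 0) *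
          ∫ a in {a | Interlaces a k}, (Matrix.of fun i j : Fin n =>
            Complex.exp (-Complex.I * a i * ((x j.succ - x 0 : ℝ) : ℂ))).det =
        (∏ j : Fin n, (-Complex.I * ((x j.succ - x 0 : ℝ) : ℂ))⁻¹) *
        ∫ k in {k : Fin (n + 1) → ℝ | StrictMono k},
          f (HermCoord.diag k) * ((Matrix.vandermonde k).det : ℂ) *
          (Matrix.of fun i j : Fin (n + 1) => Complex.exp (-Complex.I * k i * x j)).det := by
      rw [← integral_const_mul]
      refine setIntegral_congr_fun (measurableSet_strictMono _) fun k hk => ?_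
      rw [mul_assoc, setIntegral_interlaces_det_shift hk hx]
      ring
    rw [hfin]
    -- The factors of `Δ{x}` that involve `x_0` cancel the denominators from the box integral. Each
    -- step contributes `(-iπ)^n`, and the exponents add up to `n(n+1)/2` at size `n + 1`.
    have hprod : ((∏ j : Fin n, (x 0 - x j.succ) : ℝ) : ℂ) *
        (∏ j : Fin n, (-Complex.I * ((x j.succ - x 0 : ℝ) : ℂ))⁻¹) = (-Complex.I) ^ n := by
      rw [Complex.ofReal_prod, ← Finset.prod_mul_distrib]
      rw [Finset.prod_congr rfl fun j _ => ?_, Finset.prod_const, Finset.card_univ,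
        Fintype.card_fin]
      have h0 : ((x 0 - x j.succ : ℝ) : ℂ) ≠ 0 := by
        exact_mod_cast sub_ne_zero.mpr fun h => Fin.succ_ne_zero j (hx h).symm
      have h1 : -Complex.I * ((x j.succ - x 0 : ℝ) : ℂ) =
          Complex.I * ((x 0 - x j.succ : ℝ) : ℂ) := by
        push_cast
        ring
      rw [h1, mul_inv, Complex.inv_I, mul_comm, mul_assoc, inv_mul_cancel₀ h0, mul_one]
    have hN : (n + 1) * (n + 1 - 1) / 2 = n * (n - 1) / 2 + n := by
      rw [← Finset.sum_range_id, Finset.sum_range_succ, Finset.sum_range_id]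
    rw [hN, pow_add, mul_pow _ _ n, ← hprod]
    ring

/-! ### The Cauchy density as a function of the eigenvalues -/

theorem det_cauchy_conj {n : ℕ} (lam ε : ℝ) {V : Matrix (Fin n) (Fin n) ℂ}
    (hV : V ∈ Matrix.unitaryGroup (Fin n) ℂ) (A : Matrix (Fin n) (Fin n) ℂ) :
    ((lam : ℂ) ^ 2 • (1 : Matrix (Fin n) (Fin n) ℂ) +
      (V * A * star V - (ε : ℂ) • (1 : Matrix (Fin n) (Fin n) ℂ)) ^ 2).det =
    ((lam : ℂ) ^ 2 • (1 : Matrix (Fin n) (Fin n) ℂ) +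
      (A - (ε : ℂ) • (1 : Matrix (Fin n) (Fin n) ℂ)) ^ 2).det := by
  have h1 : star V * V = 1 := hV.1
  have h2 : V * star V = 1 := hV.2
  have e : (lam : ℂ) ^ 2 • (1 : Matrix (Fin n) (Fin n) ℂ) +
      (V * A * star V - (ε : ℂ) • (1 : Matrix (Fin n) (Fin n) ℂ)) ^ 2 =
      V * ((lam : ℂ) ^ 2 • (1 : Matrix (Fin n) (Fin n) ℂ) +
        (A - (ε : ℂ) • (1 : Matrix (Fin n) (Fin n) ℂ)) ^ 2) * star V := by
    have e1 : V * A * star V - (ε : ℂ) • (1 : Matrix (Fin n) (Fin n) ℂ) =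
        V * (A - (ε : ℂ) • (1 : Matrix (Fin n) (Fin n) ℂ)) * star V := by
      rw [mul_sub, sub_mul, mul_smul_comm, smul_mul_assoc, mul_one, h2]
    rw [e1, mul_add, add_mul, mul_smul_comm, smul_mul_assoc, mul_one, h2, pow_two (V * _ * _), pow_two (A - _)]
    congr 1
    simp only [mul_assoc]
    rw [← mul_assoc (star V) V, h1, one_mul]
  rw [e, Matrix.det_mul, Matrix.det_mul, mul_right_comm, ← Matrix.det_mul, h2, Matrix.det_one,
    one_mul]

theorem cauchyDet_eq_of_charpoly_eq {n : ℕ} (lam ε : ℝ) {X Y : HermMat n}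
    (h : (X : Matrix (Fin n) (Fin n) ℂ).charpoly = (Y : Matrix (Fin n) (Fin n) ℂ).charpoly) :
    cauchyDet lam ε X = cauchyDet lam ε Y := by
  obtain ⟨V, hV, hY⟩ := exists_unitary_of_charpoly_eq X.isHermitian Y.isHermitian h
  rw [cauchyDet, cauchyDet, hY, det_cauchy_conj lam ε hV]

theorem cauchyDet_diag {n : ℕ} (lam ε : ℝ) (a : Fin n → ℝ) :
    cauchyDet lam ε (HermCoord.diag a).toHerm = ((∏ i, (lam ^ 2 + (a i - ε) ^ 2) : ℝ) : ℂ) := by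
  change ((lam : ℂ) ^ 2 • (1 : Matrix (Fin n) (Fin n) ℂ) +
    ((HermCoord.diag a).toMatrix - (ε : ℂ) • (1 : Matrix (Fin n) (Fin n) ℂ)) ^ 2).det = _
  rw [HermCoord.toMatrix_diagonal, Matrix.smul_one_eq_diagonal, Matrix.smul_one_eq_diagonal,
    Matrix.diagonal_sub, Matrix.diagonal_pow, Matrix.diagonal_add, Matrix.det_diagonal]
  push_cast
  rfl

theorem charpoly_diag_eig {n : ℕ} (X : HermMat n) :
    (HermCoord.diag X.eig).toMatrix.charpoly = (X : Matrix (Fin n) (Fin n) ℂ).charpoly := by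
  rw [X.isHermitian.charpoly_eq, HermCoord.toMatrix_diagonal, Matrix.charpoly_diagonal]
  rfl

theorem cauchyDet_eq_prod_eig {n : ℕ} (lam ε : ℝ) (X : HermMat n) :
    cauchyDet lam ε X = ((∏ i, (lam ^ 2 + (X.eig i - ε) ^ 2) : ℝ) : ℂ) := by
  rw [← cauchyDet_diag]
  exact cauchyDet_eq_of_charpoly_eq lam ε (charpoly_diag_eig X).symm

theorem cauchyDet_re_pos {n : ℕ} {lam : ℝ} (hl : 0 < lam) (ε : ℝ) (X : HermMat n) :
    0 < (cauchyDet lam ε X).re := by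
  rw [cauchyDet_eq_prod_eig, Complex.ofReal_re]
  exact Finset.prod_pos fun i _ => by positivity

theorem ofReal_cauchyDet_re {n : ℕ} (lam ε : ℝ) (X : HermMat n) :
    ((cauchyDet lam ε X).re : ℂ) = cauchyDet lam ε X := by
  rw [cauchyDet_eq_prod_eig, Complex.ofReal_re]

theorem continuous_cauchyDet (n : ℕ) (lam ε : ℝ) :
    Continuous (cauchyDet lam ε : HermMat n → ℂ) := by
  unfold cauchyDet
  fun_prop

/-- The unnormalized density of the matrix Cauchy distribution. -/
def cauchyDensity {n : ℕ} (lam ε : ℝ) (X : HermMat n) : ℝ := ((cauchyDet lam ε X).re ^ n)⁻¹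

theorem cauchyDensity_pos {n : ℕ} {lam : ℝ} (hl : 0 < lam) (ε : ℝ) (X : HermMat n) :
    0 < cauchyDensity lam ε X :=
  inv_pos.mpr (pow_pos (cauchyDet_re_pos hl ε X) n)

theorem continuous_cauchyDensity (n : ℕ) {lam : ℝ} (hl : 0 < lam) (ε : ℝ) :
    Continuous (cauchyDensity lam ε : HermMat n → ℝ) :=
  ((Complex.continuous_re.comp (continuous_cauchyDet n lam ε)).pow n).inv₀ fun X =>
    (pow_pos (cauchyDet_re_pos hl ε X) n).ne'

theorem ofReal_cauchyDensity {n : ℕ} (lam ε : ℝ) (X : HermMat n) :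
    (cauchyDensity lam ε X : ℂ) = (cauchyDet lam ε X ^ n)⁻¹ := by
  rw [cauchyDensity]
  push_cast
  rw [ofReal_cauchyDet_re]

theorem cauchyDensity_diag {n : ℕ} (lam ε : ℝ) (a : Fin n → ℝ) :
    cauchyDensity lam ε (HermCoord.diag a).toHerm = eigWeight lam ε a := by
  rw [cauchyDensity, cauchyDet_diag, Complex.ofReal_re, eigWeight, ← Finset.prod_pow,
    Finset.prod_inv_distrib]

theorem cauchyDensity_eq_of_charpoly_eq {n : ℕ} (lam ε : ℝ) {X Y : HermMat n}
    (h : (X : Matrix (Fin n) (Fin n) ℂ).charpoly = (Y : Matrix (Fin n) (Fin n) ℂ).charpoly) :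
    cauchyDensity lam ε X = cauchyDensity lam ε Y := by
  rw [cauchyDensity, cauchyDensity, cauchyDet_eq_of_charpoly_eq lam ε h]

/-! ### Truncation to Frobenius balls and absolute convergence -/

theorem HermCoord.frob_eq_of_charpoly_eq {n : ℕ} {c c' : HermCoord n}
    (h : c.toMatrix.charpoly = c'.toMatrix.charpoly) : c.frob = c'.frob := by
  obtain ⟨V, hV, hV'⟩ := exists_unitary_of_charpoly_eq c.toMatrix_isHermitian
    c'.toMatrix_isHermitian h
  have h1 : star V * V = 1 := hV.1
  rw [frob, frob, hV']
  have : V * c.toMatrix * star V * (V * c.toMatrix * star V) =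
      V * (c.toMatrix * c.toMatrix) * star V := by
    simp only [mul_assoc]
    rw [← mul_assoc (star V) V, h1, one_mul]
  rw [this, mul_assoc V, Matrix.trace_mul_comm V, mul_assoc (c.toMatrix * c.toMatrix), h1, mul_one]

theorem HermCoord.isCompact_frob_le (n : ℕ) {R : ℝ} (hR : 0 ≤ R) :
    IsCompact {c : HermCoord n | c.frob ≤ R ^ 2} := by
  refine Metric.isCompact_of_isClosed_isBounded
    (isClosed_le (continuous_frob n) continuous_const) ?_
  refine (Metric.isBounded_closedBall (x := (0 : HermCoord n)) (r := R)).subset fun c hc => ?_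
  rw [mem_closedBall_zero_iff]
  exact norm_le_of_frob_le hR hc

theorem aecover_frob {α : Type*} [MeasurableSpace α] (μ : Measure α) {N : α → ℝ}
    (hN : Measurable N) : AECover μ atTop fun R : ℕ => {c | N c ≤ (R : ℝ) ^ 2} where
  ae_eventually_mem := Eventually.of_forall fun c => by
    -- The maximum with `1` ensures `R ≤ R²`.
    filter_upwards [eventually_ge_atTop ⌈max (N c) 1⌉₊] with R hR
    have h : max (N c) 1 ≤ R := Nat.ceil_le.mp hR
    have h1 := (le_max_left _ _).trans h
    have h2 := (le_max_right _ _).trans h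
    exact h1.trans (by nlinarith)
  measurableSet R := measurableSet_le hN measurable_const

/-- The Cauchy density cut off to a ball. -/
def truncDensity {n : ℕ} (lam ε R : ℝ) : HermCoord n → ℂ :=
  {c | c.frob ≤ R ^ 2}.indicator fun c => (cauchyDensity lam ε c.toHerm : ℂ)

theorem measurableSet_frob_le (n : ℕ) (R : ℝ) :
    MeasurableSet {c : HermCoord n | c.frob ≤ R ^ 2} :=
  measurableSet_le (HermCoord.continuous_frob n).measurable measurable_const

theorem continuous_cauchyDensity_toHerm (n : ℕ) {lam : ℝ} (hl : 0 < lam) (ε : ℝ) :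
    Continuous fun c : HermCoord n => (cauchyDensity lam ε c.toHerm : ℂ) :=
  Complex.continuous_ofReal.comp
    ((continuous_cauchyDensity n hl ε).comp HermCoord.continuous_toHerm)

theorem measurable_truncDensity (n : ℕ) {lam : ℝ} (hl : 0 < lam) (ε R : ℝ) :
    Measurable (truncDensity lam ε R : HermCoord n → ℂ) :=
  (continuous_cauchyDensity_toHerm n hl ε).measurable.indicator (measurableSet_frob_le n R)

theorem spectralInvariant_truncDensity (n : ℕ) (lam ε R : ℝ) :
    SpectralInvariant (truncDensity lam ε R : HermCoord n → ℂ) := fun c c' h => by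
  have h1 := HermCoord.frob_eq_of_charpoly_eq h
  have h2 : cauchyDensity lam ε c.toHerm = cauchyDensity lam ε c'.toHerm :=
    cauchyDensity_eq_of_charpoly_eq lam ε h
  simp only [truncDensity, Set.indicator, Set.mem_ofPred_eq, h1, h2]

theorem integrable_truncDensity (n : ℕ) {lam : ℝ} (hl : 0 < lam) (ε : ℝ) {R : ℝ} (hR : 0 ≤ R) :
    Integrable (truncDensity lam ε R : HermCoord n → ℂ) := by
  rw [truncDensity, integrable_indicator_iff (measurableSet_frob_le n R)]
  exact (continuous_cauchyDensity_toHerm n hl ε).continuousOn.integrableOn_compact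
    (HermCoord.isCompact_frob_le n hR)

theorem truncDensity_diag {n : ℕ} (lam ε R : ℝ) (a : Fin n → ℝ) :
    truncDensity lam ε R (HermCoord.diag a) =
      {a : Fin n → ℝ | (HermCoord.diag a).frob ≤ R ^ 2}.indicator
        (fun a => (eigWeight lam ε a : ℂ)) a := by
  simp only [truncDensity, Set.indicator, Set.mem_ofPred_eq, cauchyDensity_diag]

/-- Inside the ball every `|a i|` is at most `R`, and a continuous function is bounded on that box.
The size of `C` is irrelevant: it enters the induction only to justify exchanging integrals. -/
theorem tameOnDiag_truncDensity (n : ℕ) {lam : ℝ} (hl : 0 < lam) (ε : ℝ) {R : ℝ} (hR : 0 ≤ R) :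
    ∃ C, TameOnDiag (truncDensity lam ε R : HermCoord n → ℂ) C R := by
  have hc : Continuous fun a : Fin n → ℝ =>
      (eigWeight lam ε a : ℂ) * ((Matrix.vandermonde a).det : ℂ) :=
    (Complex.continuous_ofReal.comp (continuous_eigWeight hl ε)).mul
      (Complex.continuous_ofReal.comp (continuous_det_vandermonde n))
  obtain ⟨C, hC⟩ := (isCompact_Icc (a := fun _ : Fin n => -R) (b := fun _ => R)).exists_bound_of_continuousOn
    hc.continuousOn
  have hbox : ∀ a : Fin n → ℝ, (HermCoord.diag a).frob ≤ R ^ 2 → ∀ i, |a i| ≤ R := fun a h i =>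
    (norm_le_pi_norm a i).trans
      ((norm_fst_le (HermCoord.diag a)).trans (HermCoord.norm_le_of_frob_le hR h))
  have hC0 : 0 ≤ C := (norm_nonneg _).trans
    (hC 0 (mem_Icc_const_iff.mpr fun i => by simpa using hR))
  refine ⟨C, fun a _ => ?_⟩
  rw [truncDensity_diag]
  by_cases ha : (HermCoord.diag a).frob ≤ R ^ 2
  · rw [Set.indicator_of_mem (s := {a : Fin n → ℝ | (HermCoord.diag a).frob ≤ R ^ 2}) ha]
    exact ⟨hC a (mem_Icc_const_iff.mpr (hbox a ha)), fun _ => hbox a ha⟩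
  · rw [Set.indicator_of_notMem (s := {a : Fin n → ℝ | (HermCoord.diag a).frob ≤ R ^ 2}) ha]
    simpa using hC0

/-- For frequencies in arithmetic progression the determinant is a Vandermonde determinant in the
points `exp(-iε a_i)` of the unit circle, and a chord is no longer than its arc. -/
theorem norm_det_cexp_arith_le {n : ℕ} (a : Fin n → ℝ) {ε : ℝ} (hε : 0 ≤ ε) :
    ‖(Matrix.of fun i j : Fin n =>
      Complex.exp (-Complex.I * a i * ((ε * (j : ℕ) : ℝ) : ℂ))).det‖ ≤
      ε ^ (n * (n - 1) / 2) * |(Matrix.vandermonde a).det| := by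
  have h : (Matrix.of fun i j : Fin n =>
      Complex.exp (-Complex.I * a i * ((ε * (j : ℕ) : ℝ) : ℂ))) =
      Matrix.vandermonde fun i => Complex.exp (Complex.I * ((-(ε * a i) : ℝ) : ℂ)) := by
    ext i j
    rw [Matrix.of_apply, Matrix.vandermonde_apply, ← Complex.exp_nat_mul]
    congr 1
    push_cast
    ring
  rw [h, Matrix.det_vandermonde, Matrix.det_vandermonde, norm_prod, Finset.abs_prod]
  simp_rw [norm_prod, Finset.abs_prod]
  rw [← prod_prod_Ioi_mul]
  refine Finset.prod_le_prod (fun _ _ => Finset.prod_nonneg fun _ _ => norm_nonneg _) fun i _ =>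
    Finset.prod_le_prod (fun _ _ => norm_nonneg _) fun j _ => ?_
  have hs : Complex.exp (Complex.I * ((-(ε * a j) : ℝ) : ℂ)) -
      Complex.exp (Complex.I * ((-(ε * a i) : ℝ) : ℂ)) =
      Complex.exp (Complex.I * ((-(ε * a i) : ℝ) : ℂ)) *
        (Complex.exp (Complex.I * ((ε * (a i - a j) : ℝ) : ℂ)) - 1) := by
    rw [mul_sub, mul_one, ← Complex.exp_add]
    congr 2
    push_cast
    ring
  rw [hs, norm_mul, mul_comm Complex.I, Complex.norm_exp_ofReal_mul_I, one_mul]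
  refine (Real.norm_exp_I_mul_ofReal_sub_one_le).trans ?_
  rw [Real.norm_eq_abs, abs_mul, abs_of_nonneg hε, abs_sub_comm]

theorem vandermondeProd_smul {n : ℕ} (t : ℝ) (x : Fin n → ℝ) :
    vandermondeProd (fun i => t * x i) = t ^ (n * (n - 1) / 2) * vandermondeProd x := by
  simp_rw [vandermondeProd, ← mul_sub]
  exact prod_prod_Ioi_mul t fun i j => x i - x j

theorem vandermondeProd_ne_zero {n : ℕ} {x : Fin n → ℝ} (hx : Function.Injective x) :
    vandermondeProd x ≠ 0 :=
  Finset.prod_ne_zero_iff.mpr fun _ _ => Finset.prod_ne_zero_iff.mpr fun _ hj =>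
    sub_ne_zero.mpr fun h => (Finset.mem_Ioi.mp hj).ne (hx h)

theorem norm_truncDensity_diag_le {n : ℕ} (lam ε R : ℝ) (a : Fin n → ℝ) :
    ‖truncDensity lam ε R (HermCoord.diag a)‖ ≤ eigWeight lam ε a := by
  rw [truncDensity_diag]
  refine (norm_indicator_le_norm_self _ _).trans ?_
  rw [Complex.norm_real, Real.norm_of_nonneg (eigWeight_nonneg _ _ _)]

theorem norm_prod_cexp {n : ℕ} (a x : Fin n → ℝ) :
    ‖∏ i, Complex.exp (-Complex.I * a i * x i)‖ = 1 := by
  rw [norm_prod]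
  exact Finset.prod_eq_one fun i _ => norm_cexp_neg_I_mul _ _

/-- At `x = t(0, 1, ..., n-1)` both `Δ{x}` and the bound for the exponential determinant carry the
factor `t^(n(n-1)/2)`. It cancels, leaving a bound independent of both `t` and the truncation
radius. -/
theorem norm_integral_truncDensity_arith_le {n : ℕ} (hn : 1 ≤ n) {lam : ℝ} (hl : 0 < lam) (ε : ℝ)
    {R : ℝ} (hR : 0 ≤ R) {t : ℝ} (ht : 0 < t) :
    ‖∫ c : HermCoord n, truncDensity lam ε R c *
      ∏ i, Complex.exp (-Complex.I * c.1 i * ((t * (i : ℕ) : ℝ) : ℂ))‖ *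
      |vandermondeProd fun i : Fin n => ((i : ℕ) : ℝ)| ≤
    Real.pi ^ (n * (n - 1) / 2) *
      ∫ k : Fin n → ℝ, eigWeight lam ε k * (Matrix.vandermonde k).det ^ 2 := by
  obtain ⟨C, hC⟩ := tameOnDiag_truncDensity n hl ε hR
  have hinj : Function.Injective fun i : Fin n => t * ((i : ℕ) : ℝ) := fun i j h => by
    have : ((i : ℕ) : ℝ) = (j : ℕ) := mul_left_cancel₀ ht.ne' h
    exact Fin.ext (by exact_mod_cast this)
  have h := congrArg norm (integral_spectral_cexp n _ (measurable_truncDensity n hl ε R)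
    (spectralInvariant_truncDensity n lam ε R) (integrable_truncDensity n hl ε hR) C R hC _ hinj)
  have hI := integrable_eigWeight_mul_vandermonde_sq hn hl ε
  have hpi : ‖-Complex.I * (Real.pi : ℂ)‖ = Real.pi := by
    rw [norm_mul, norm_neg, Complex.norm_I, one_mul, Complex.norm_real,
      Real.norm_of_nonneg Real.pi_pos.le]
  have htN : 0 < t ^ (n * (n - 1) / 2) := pow_pos ht _
  have hb : ‖∫ a in {a : Fin n → ℝ | StrictMono a},
      truncDensity lam ε R (HermCoord.diag a) * ((Matrix.vandermonde a).det : ℂ) *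
        (Matrix.of fun i j : Fin n =>
          Complex.exp (-Complex.I * a i * ((t * (j : ℕ) : ℝ) : ℂ))).det‖ ≤
      t ^ (n * (n - 1) / 2) *
        ∫ k : Fin n → ℝ, eigWeight lam ε k * (Matrix.vandermonde k).det ^ 2 := by
    have h1 : ‖∫ a in {a : Fin n → ℝ | StrictMono a},
      truncDensity lam ε R (HermCoord.diag a) * ((Matrix.vandermonde a).det : ℂ) *
        (Matrix.of fun i j : Fin n =>
          Complex.exp (-Complex.I * a i * ((t * (j : ℕ) : ℝ) : ℂ))).det‖ ≤
        ∫ a in {a : Fin n → ℝ | StrictMono a},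
          t ^ (n * (n - 1) / 2) * (eigWeight lam ε a * (Matrix.vandermonde a).det ^ 2) := by
      refine norm_integral_le_of_norm_le (hI.const_mul _).integrableOn
        (Eventually.of_forall fun a => ?_)
      rw [norm_mul, norm_mul, Complex.norm_real, Real.norm_eq_abs, ← sq_abs]
      have e1 := norm_truncDensity_diag_le lam ε R a
      have e2 := norm_det_cexp_arith_le a ht.le
      calc _ ≤ eigWeight lam ε a * |(Matrix.vandermonde a).det| *
            (t ^ (n * (n - 1) / 2) * |(Matrix.vandermonde a).det|) := by
            gcongr
            exact mul_nonneg (eigWeight_nonneg _ _ _) (abs_nonneg _)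
        _ = _ := by ring
    refine h1.trans ?_
    rw [integral_const_mul]
    refine mul_le_mul_of_nonneg_left (setIntegral_le_integral hI (Eventually.of_forall fun a =>
      mul_nonneg (eigWeight_nonneg _ _ _) (sq_nonneg _))) htN.le
  rw [vandermondeProd_smul, norm_mul, norm_mul, norm_pow, hpi, Complex.norm_real, Real.norm_eq_abs,
    abs_mul, abs_of_pos htN] at h
  have h3 := h.le.trans (mul_le_mul_of_nonneg_left hb (pow_nonneg Real.pi_pos.le _))
  refine le_of_mul_le_mul_left ?_ htN
  linarith

/-- Let `t → 0` in the preceding bound; the truncated density is integrable, so its Fourier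
transform is continuous in `t`. -/
theorem integral_truncDensity_le {n : ℕ} (hn : 1 ≤ n) {lam : ℝ} (hl : 0 < lam) (ε : ℝ)
    {R : ℝ} (hR : 0 ≤ R) :
    ‖∫ c : HermCoord n, truncDensity lam ε R c‖ *
      |vandermondeProd fun i : Fin n => ((i : ℕ) : ℝ)| ≤
    Real.pi ^ (n * (n - 1) / 2) *
      ∫ k : Fin n → ℝ, eigWeight lam ε k * (Matrix.vandermonde k).det ^ 2 := by
  have hint := integrable_truncDensity n hl ε hR
  have hc : Continuous fun t : ℝ => ∫ c : HermCoord n, truncDensity lam ε R c *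
      ∏ i, Complex.exp (-Complex.I * c.1 i * ((t * (i : ℕ) : ℝ) : ℂ)) := by
    refine continuous_of_dominated (bound := fun c => ‖truncDensity lam ε R c‖) (fun t => ?_)
      (fun t => Eventually.of_forall fun c => ?_) hint.norm (Eventually.of_forall fun c => ?_)
    · exact hint.aestronglyMeasurable.mul (Continuous.aestronglyMeasurable (by fun_prop))
    · rw [norm_mul, norm_prod_cexp c.1 fun i => t * (i : ℕ), mul_one]
    · fun_prop
  have h0 : ∫ c : HermCoord n, truncDensity lam ε R c *
      ∏ i, Complex.exp (-Complex.I * c.1 i * (((0 : ℝ) * (i : ℕ) : ℝ) : ℂ)) =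
      ∫ c : HermCoord n, truncDensity lam ε R c := by
    simp
  have ht := ((hc.norm.mul_const |vandermondeProd fun i : Fin n => ((i : ℕ) : ℝ)|).tendsto
    0).mono_left (nhdsWithin_le_nhds (s := Set.Ioi 0))
  simp only [h0] at ht
  refine le_of_tendsto ht ?_
  filter_upwards [self_mem_nhdsWithin] with t ht
  exact norm_integral_truncDensity_arith_le hn hl ε hR ht

/-- The truncated masses are bounded uniformly in the radius and the balls exhaust the space. -/
theorem integrable_cauchyDensity_toHerm {n : ℕ} (hn : 1 ≤ n) {lam : ℝ} (hl : 0 < lam) (ε : ℝ) :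
    Integrable fun c : HermCoord n => (cauchyDensity lam ε c.toHerm : ℂ) := by
  have hδ : Function.Injective fun i : Fin n => ((i : ℕ) : ℝ) := fun _ _ h =>
    Fin.ext (Nat.cast_injective h)
  have hv := abs_pos.mpr (vandermondeProd_ne_zero hδ)
  refine (aecover_frob volume (HermCoord.continuous_frob n).measurable).integrable_of_integral_norm_bounded
    ((Real.pi ^ (n * (n - 1) / 2) *
      ∫ k : Fin n → ℝ, eigWeight lam ε k * (Matrix.vandermonde k).det ^ 2) /
      |vandermondeProd fun i : Fin n => ((i : ℕ) : ℝ)|) (fun R => ?_)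
    (Eventually.of_forall fun R => ?_)
  · exact (continuous_cauchyDensity_toHerm n hl ε).continuousOn.integrableOn_compact
      (HermCoord.isCompact_frob_le n R.cast_nonneg)
  · rw [le_div_iff₀ hv]
    refine le_of_eq_of_le (congrArg (· * _) ?_) (integral_truncDensity_le hn hl ε R.cast_nonneg)
    simp_rw [truncDensity]
    rw [integral_indicator (measurableSet_frob_le n R), integral_complex_ofReal,
      Complex.norm_real, Real.norm_of_nonneg (integral_nonneg fun c => (cauchyDensity_pos hl ε _).le)]
    refine integral_congr_ae (Eventually.of_forall fun c => ?_)
    change ‖(cauchyDensity lam ε c.toHerm : ℂ)‖ = _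
    rw [Complex.norm_real, Real.norm_of_nonneg (cauchyDensity_pos hl ε _).le]

/-- Both sides are now known to converge absolutely, so the identity for truncated densities passes
to the limit of infinite radius. -/
theorem integral_cauchyDensity_cexp {n : ℕ} (hn : 1 ≤ n) {lam : ℝ} (hl : 0 < lam) (ε : ℝ)
    {x : Fin n → ℝ} (hx : Function.Injective x) :
    (∫ c : HermCoord n, (cauchyDensity lam ε c.toHerm : ℂ) *
      ∏ i, Complex.exp (-Complex.I * c.1 i * x i)) * (vandermondeProd x : ℂ) =
    (-Complex.I * Real.pi) ^ (n * (n - 1) / 2) * ∫ a in {a : Fin n → ℝ | StrictMono a},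
      ((eigWeight lam ε a * (Matrix.vandermonde a).det : ℝ) : ℂ) *
        (Matrix.of fun i j : Fin n => Complex.exp (-Complex.I * a i * x j)).det := by
  have hL : Integrable fun c : HermCoord n => (cauchyDensity lam ε c.toHerm : ℂ) *
      ∏ i, Complex.exp (-Complex.I * c.1 i * x i) :=
    (integrable_cauchyDensity_toHerm hn hl ε).mul_bdd (c := 1)
      (Continuous.aestronglyMeasurable (by fun_prop))
      (Eventually.of_forall fun c => (norm_prod_cexp c.1 x).le)
  have hR := (integrableOn_strictMono_eigWeight hl ε x).integrableOn
    (s := {a : Fin n → ℝ | StrictMono a})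
  have hNd : Measurable fun a : Fin n → ℝ => (HermCoord.diag a).frob :=
    (HermCoord.continuous_frob n).measurable.comp (HermCoord.measurable_diag n)
  have h1 := ((aecover_frob volume
    (HermCoord.continuous_frob n).measurable).integral_tendsto_of_countably_generated hL).mul_const
      (vandermondeProd x : ℂ)
  have h2 := ((aecover_frob (volume.restrict {a : Fin n → ℝ | StrictMono a})
    hNd).integral_tendsto_of_countably_generated hR).const_mul
      ((-Complex.I * (Real.pi : ℂ)) ^ (n * (n - 1) / 2))
  refine tendsto_nhds_unique h1 (h2.congr fun R => ?_)
  obtain ⟨C, hC⟩ := tameOnDiag_truncDensity n hl ε R.cast_nonneg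
  have h := integral_spectral_cexp n _ (measurable_truncDensity n hl ε R)
    (spectralInvariant_truncDensity n lam ε R) (integrable_truncDensity n hl ε R.cast_nonneg)
    C R hC x hx
  rw [← integral_indicator (measurableSet_frob_le n R),
    ← integral_indicator (measurableSet_le hNd measurable_const)]
  have e1 : ∀ c : HermCoord n, {c : HermCoord n | c.frob ≤ (R : ℝ) ^ 2}.indicator
      (fun c => (cauchyDensity lam ε c.toHerm : ℂ) *
        ∏ i, Complex.exp (-Complex.I * c.1 i * x i)) c =
      truncDensity lam ε R c * ∏ i, Complex.exp (-Complex.I * c.1 i * x i) := fun c =>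
    Set.indicator_mul_left _ _ _
  have e2 : ∀ a : Fin n → ℝ, {a : Fin n → ℝ | (HermCoord.diag a).frob ≤ (R : ℝ) ^ 2}.indicator
      (fun a => ((eigWeight lam ε a * (Matrix.vandermonde a).det : ℝ) : ℂ) *
        (Matrix.of fun i j : Fin n => Complex.exp (-Complex.I * a i * x j)).det) a =
      truncDensity lam ε R (HermCoord.diag a) * ((Matrix.vandermonde a).det : ℂ) *
        (Matrix.of fun i j : Fin n => Complex.exp (-Complex.I * a i * x j)).det := fun a => by
    rw [truncDensity_diag]
    by_cases ha : a ∈ {a : Fin n → ℝ | (HermCoord.diag a).frob ≤ (R : ℝ) ^ 2}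
    · rw [Set.indicator_of_mem ha, Set.indicator_of_mem ha, Complex.ofReal_mul]
    · rw [Set.indicator_of_notMem ha, Set.indicator_of_notMem ha, zero_mul, zero_mul]
  simp_rw [e1, e2]
  exact h.symm

/-! ### Reduction to diagonal matrices and the constants -/

theorem exists_unitary_diag_eig {n : ℕ} (X : HermMat n) :
    ∃ V ∈ Matrix.unitaryGroup (Fin n) ℂ,
      (X : Matrix (Fin n) (Fin n) ℂ) = V * (HermCoord.diag X.eig).toMatrix * star V :=
  exists_unitary_of_charpoly_eq (HermCoord.toMatrix_isHermitian _) X.isHermitian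
    (charpoly_diag_eig X)

theorem cauchyDensity_conj {n : ℕ} (lam ε : ℝ) {V : Matrix (Fin n) (Fin n) ℂ}
    (hV : V ∈ Matrix.unitaryGroup (Fin n) ℂ) (c : HermCoord n) :
    cauchyDensity lam ε (HermCoord.conj V c).toHerm = cauchyDensity lam ε c.toHerm := by
  have : cauchyDet lam ε (HermCoord.conj V c).toHerm = cauchyDet lam ε c.toHerm := by
    change ((lam : ℂ) ^ 2 • (1 : Matrix (Fin n) (Fin n) ℂ) +
      ((HermCoord.conj V c).toMatrix - (ε : ℂ) • (1 : Matrix (Fin n) (Fin n) ℂ)) ^ 2).det = _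
    rw [HermCoord.toMatrix_conj, det_cauchy_conj lam ε hV]
    rfl
  rw [cauchyDensity, cauchyDensity, this]

theorem trace_mul_eq_zero_im {n : ℕ} {A B : Matrix (Fin n) (Fin n) ℂ} (hA : A.IsHermitian)
    (hB : B.IsHermitian) : (Matrix.trace (A * B)).im = 0 := by
  have : star (Matrix.trace (A * B)) = Matrix.trace (A * B) := by
    rw [← Matrix.trace_conjTranspose, Matrix.conjTranspose_mul, hA.eq, hB.eq, Matrix.trace_mul_comm]
  exact Complex.conj_eq_iff_im.mp this

theorem norm_cexp_trace {n : ℕ} (K X : HermMat n) :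
    ‖Complex.exp (-Complex.I * Matrix.trace
      ((K : Matrix (Fin n) (Fin n) ℂ) * (X : Matrix (Fin n) (Fin n) ℂ)))‖ = 1 := by
  rw [Complex.norm_exp]
  simp [trace_mul_eq_zero_im K.isHermitian X.isHermitian]

theorem continuous_cexp_trace {α : Type*} [TopologicalSpace α] {n : ℕ} {f g : α → HermMat n}
    (hf : Continuous f) (hg : Continuous g) :
    Continuous fun p => Complex.exp (-Complex.I * Matrix.trace
      ((f p : Matrix (Fin n) (Fin n) ℂ) * (g p : Matrix (Fin n) (Fin n) ℂ))) := by
  have h := (continuous_subtype_val.comp hf).matrix_mul (continuous_subtype_val.comp hg)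
  exact Complex.continuous_exp.comp (continuous_const.mul h.matrix_trace)

theorem trace_mul_diag {n : ℕ} (c : HermCoord n) (x : Fin n → ℝ) :
    Matrix.trace (c.toMatrix * (HermCoord.diag x).toMatrix) = ∑ i, (c.1 i : ℂ) * x i := by
  rw [HermCoord.toMatrix_diagonal, Matrix.trace]
  refine Finset.sum_congr rfl fun i _ => ?_
  rw [Matrix.diag_apply, Matrix.mul_diagonal, HermCoord.toMatrix_diag]

theorem cexp_trace_conj {n : ℕ} {V : Matrix (Fin n) (Fin n) ℂ}
    (hV : V ∈ Matrix.unitaryGroup (Fin n) ℂ) (x : Fin n → ℝ) (c : HermCoord n) :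
    Complex.exp (-Complex.I * Matrix.trace ((HermCoord.conj V c).toMatrix *
      (V * (HermCoord.diag x).toMatrix * star V))) =
    ∏ i, Complex.exp (-Complex.I * c.1 i * x i) := by
  have h1 : star V * V = 1 := hV.1
  have : V * c.toMatrix * star V * (V * (HermCoord.diag x).toMatrix * star V) =
      V * (c.toMatrix * (HermCoord.diag x).toMatrix * star V) := by
    simp only [mul_assoc]
    rw [← mul_assoc (star V) V, h1, one_mul]
  rw [HermCoord.toMatrix_conj, this, Matrix.trace_mul_comm V, mul_assoc, h1, mul_one,
    trace_mul_diag, ← Complex.exp_sum, Finset.mul_sum]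
  simp only [mul_assoc]

/-- Unitary invariance reduces the Fourier transform to diagonal matrices. -/
theorem integral_cauchyDensity_cexp_trace {n : ℕ} {lam : ℝ} (hl : 0 < lam) (ε : ℝ)
    {V : Matrix (Fin n) (Fin n) ℂ} (hV : V ∈ Matrix.unitaryGroup (Fin n) ℂ) (x : Fin n → ℝ) :
    ∫ c : HermCoord n, (cauchyDensity lam ε c.toHerm : ℂ) *
      Complex.exp (-Complex.I * Matrix.trace
        (c.toMatrix * (V * (HermCoord.diag x).toMatrix * star V))) =
    ∫ c : HermCoord n, (cauchyDensity lam ε c.toHerm : ℂ) *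
      ∏ i, Complex.exp (-Complex.I * c.1 i * x i) := by
  have hmp := HermCoord.measurePreserving_conj hV
  have hc : Continuous fun c : HermCoord n => (cauchyDensity lam ε c.toHerm : ℂ) *
      Complex.exp (-Complex.I * Matrix.trace
        (c.toMatrix * (V * (HermCoord.diag x).toMatrix * star V))) :=
    (continuous_cauchyDensity_toHerm n hl ε).mul (Complex.continuous_exp.comp
      (continuous_const.mul
        ((HermCoord.continuous_toMatrix n).matrix_mul continuous_const).matrix_trace))
  have h := integral_map (μ := volume) hmp.measurable.aemeasurable hc.aestronglyMeasurable
  rw [hmp.map_eq] at h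
  rw [h]
  simp_rw [cauchyDensity_conj lam ε hV, cexp_trace_conj hV]

/-- The normalization constant in `hermMeasure`. -/
def hermConst (M : ℕ) : ℝ :=
  (∏ j ∈ Finset.Icc 1 M, (j.factorial : ℝ)) / Real.pi ^ (M * (M - 1) / 2)

theorem hermConst_pos (M : ℕ) : 0 < hermConst M :=
  div_pos (Finset.prod_pos fun j _ => by positivity) (pow_pos Real.pi_pos _)

theorem integral_hermMeasure {M : ℕ} {g : HermMat M → ℂ} (hg : Continuous g) :
    ∫ K, g K ∂(hermMeasure M) = hermConst M * ∫ c : HermCoord M, g c.toHerm := by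
  rw [hermMeasure, integral_smul_measure, flatHermMeasure,
    integral_map HermCoord.measurable_toHerm.aemeasurable hg.aestronglyMeasurable,
    ← hermConst, ENNReal.toReal_ofReal (hermConst_pos M).le, Complex.real_smul]

theorem integrable_hermMeasure {M : ℕ} {g : HermMat M → ℂ} (hg : Continuous g)
    (hi : Integrable fun c : HermCoord M => g c.toHerm) : Integrable g (hermMeasure M) := by
  rw [hermMeasure]
  refine Integrable.smul_measure ?_ ENNReal.ofReal_ne_top
  rw [flatHermMeasure, integrable_map_measure hg.aestronglyMeasurable
    HermCoord.measurable_toHerm.aemeasurable]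
  exact hi

/-- The total mass of the Cauchy weight. -/
def cauchyMass (M : ℕ) (γ : ℝ) : ℝ :=
  Real.pi ^ M * (M.factorial : ℝ) / (γ ^ (M ^ 2) * 2 ^ (M * (M - 1)))

theorem cauchyMass_pos (M : ℕ) {γ : ℝ} (hγ : 0 < γ) : 0 < cauchyMass M γ := by
  have := Real.pi_pos
  unfold cauchyMass
  positivity

theorem prod_Icc_factorial (M : ℕ) :
    ∏ j ∈ Finset.Icc 1 M, (j.factorial : ℂ) =
      (M.factorial : ℂ) * ∏ n : Fin M, ((n : ℕ).factorial : ℂ) := by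
  rw [Fin.prod_univ_eq_prod_range fun n => ((n.factorial : ℕ) : ℂ)]
  induction M with
  | zero => simp
  | succ k ih =>
    rw [Finset.prod_Icc_succ_top (by omega), ih, Finset.prod_range_succ]
    ring

/-- The sign in `F` is `(-i)^N / i^N = (-1)^N` with `N = M(M-1)/2`. The powers `π^N` cancel, the
factorials `n!` with `n < M` cancel and leave `M!`, and `2^M / 2^(M²)` leaves `2^(-M(M-1))`. -/
theorem hermConst_mul_eq {M : ℕ} (hM : 1 ≤ M) {γ : ℝ} (hγ : 0 < γ) :
    (hermConst M : ℂ) * ((-Complex.I * Real.pi) ^ (M * (M - 1) / 2) *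
      ((2 * Real.pi) ^ M / ((2 * γ) ^ (M ^ 2) * Complex.I ^ (M * (M - 1) / 2) *
      ∏ n : Fin M, ((n : ℕ).factorial : ℂ)))) =
    (cauchyMass M γ : ℂ) * (-1) ^ (M * (M - 1) / 2) := by
  have hpi : (Real.pi : ℂ) ≠ 0 := by exact_mod_cast Real.pi_ne_zero
  have hg : (γ : ℂ) ≠ 0 := by exact_mod_cast hγ.ne'
  have hP : ∏ n : Fin M, ((n : ℕ).factorial : ℂ) ≠ 0 :=
    Finset.prod_ne_zero_iff.mpr fun n _ => by exact_mod_cast (n : ℕ).factorial_ne_zero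
  have h2 : (2 : ℂ) ^ (M ^ 2) = 2 ^ (M * (M - 1)) * 2 ^ M := by
    rw [← pow_add]
    congr 1
    obtain ⟨k, rfl⟩ := Nat.exists_eq_add_of_le hM
    rw [Nat.add_sub_cancel_left]
    ring
  rw [hermConst, cauchyMass]
  push_cast
  rw [prod_Icc_factorial, mul_pow, mul_pow, mul_pow, neg_pow Complex.I, h2]
  have hI := Complex.I_ne_zero
  field_simp

/-- Diagonalize `X` and divide by `Δ`, which is nonzero because the eigenvalues are distinct. -/
theorem integral_hermMeasure_of_mem_simpleSpectrum {M : ℕ} (hM : 1 ≤ M) {γ : ℝ} (hγ : 0 < γ)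
    (α : ℝ) {X : HermMat M} (hX : X ∈ simpleSpectrum M) :
    ∫ K : HermMat M, (cauchyDensity γ (γ * α) K : ℂ) * Complex.exp (-Complex.I * Matrix.trace
      ((K : Matrix (Fin M) (Fin M) ℂ) * (X : Matrix (Fin M) (Fin M) ℂ))) ∂(hermMeasure M) =
    cauchyMass M γ * limitCharFormula γ α X := by
  have hc : Continuous fun K : HermMat M => (cauchyDensity γ (γ * α) K : ℂ) *
      Complex.exp (-Complex.I * Matrix.trace
        ((K : Matrix (Fin M) (Fin M) ℂ) * (X : Matrix (Fin M) (Fin M) ℂ))) :=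
    (Complex.continuous_ofReal.comp (continuous_cauchyDensity M hγ _)).mul
      (continuous_cexp_trace continuous_id continuous_const)
  have hv : (vandermondeProd X.eig : ℂ) ≠ 0 :=
    Complex.ofReal_ne_zero.mpr (vandermondeProd_ne_zero hX)
  obtain ⟨V, hV, hXV⟩ := exists_unitary_diag_eig X
  have hJ : ∫ c : HermCoord M, (cauchyDensity γ (γ * α) c.toHerm : ℂ) *
      Complex.exp (-Complex.I * Matrix.trace
        ((c.toHerm : Matrix (Fin M) (Fin M) ℂ) * (X : Matrix (Fin M) (Fin M) ℂ))) = _ :=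
    hXV ▸ integral_cauchyDensity_cexp_trace hγ (γ * α) hV X.eig
  have h := integral_cauchyDensity_cexp hM hγ (γ * α) hX
  rw [integral_strictMono_eigWeight hγ] at h
  rw [integral_hermMeasure hc, hJ, eq_div_iff_mul_eq hv |>.mpr h,
    limitCharFormula]
  have htr : Matrix.trace (X : Matrix (Fin M) (Fin M) ℂ) = ∑ b, (X.eig b : ℂ) :=
    X.isHermitian.trace_eq_sum_eigenvalues
  rw [htr]
  have hk := hermConst_mul_eq hM hγ
  push_cast
  rw [← mul_assoc (-Complex.I) (γ : ℂ) (α : ℂ)]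
  linear_combination (Complex.exp (-Complex.I * γ * α * ∑ b, (X.eig b : ℂ)) *
    (((Matrix.of fun i j : Fin M => gFun M γ (M - 1 - i) (X.eig j)).det : ℝ) : ℂ) /
    (vandermondeProd X.eig : ℂ)) * hk

theorem continuous_cauchyDensity_mul_cexp {M : ℕ} {γ : ℝ} (hγ : 0 < γ) (ε : ℝ) (X : HermMat M) :
    Continuous fun K : HermMat M => (cauchyDensity γ ε K : ℂ) *
      Complex.exp (-Complex.I * Matrix.trace
        ((K : Matrix (Fin M) (Fin M) ℂ) * (X : Matrix (Fin M) (Fin M) ℂ))) :=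
  (Complex.continuous_ofReal.comp (continuous_cauchyDensity M hγ _)).mul
    (continuous_cexp_trace continuous_id continuous_const)

theorem integrable_cauchyDensity {M : ℕ} (hM : 1 ≤ M) {γ : ℝ} (hγ : 0 < γ) (ε : ℝ) :
    Integrable (fun K : HermMat M => (cauchyDensity γ ε K : ℂ)) (hermMeasure M) :=
  integrable_hermMeasure (Complex.continuous_ofReal.comp (continuous_cauchyDensity M hγ _))
    (integrable_cauchyDensity_toHerm hM hγ ε)

theorem integrable_cauchyDensity_mul_cexp {M : ℕ} (hM : 1 ≤ M) {γ : ℝ} (hγ : 0 < γ) (ε : ℝ)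
    (X : HermMat M) :
    Integrable (fun K : HermMat M => (cauchyDensity γ ε K : ℂ) *
      Complex.exp (-Complex.I * Matrix.trace
        ((K : Matrix (Fin M) (Fin M) ℂ) * (X : Matrix (Fin M) (Fin M) ℂ)))) (hermMeasure M) :=
  (integrable_cauchyDensity hM hγ ε).mul_bdd (c := 1)
    (continuous_cexp_trace continuous_id continuous_const).aestronglyMeasurable
    (Eventually.of_forall fun K => (norm_cexp_trace K X).le)

/-- The Fourier transform of the Cauchy weight. -/
def cauchyFourier {M : ℕ} (γ ε : ℝ) (X : HermMat M) : ℂ :=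
  ∫ K : HermMat M, (cauchyDensity γ ε K : ℂ) * Complex.exp (-Complex.I * Matrix.trace
    ((K : Matrix (Fin M) (Fin M) ℂ) * (X : Matrix (Fin M) (Fin M) ℂ))) ∂(hermMeasure M)

theorem continuous_cauchyFourier {M : ℕ} (hM : 1 ≤ M) {γ : ℝ} (hγ : 0 < γ) (ε : ℝ) :
    Continuous (cauchyFourier γ ε : HermMat M → ℂ) := by
  have : FirstCountableTopology (Matrix (Fin M) (Fin M) ℂ) :=
    inferInstanceAs (FirstCountableTopology (Fin M → Fin M → ℂ))
  have : FirstCountableTopology (HermMat M) :=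
    IsInducing.subtypeVal.firstCountableTopology
  refine continuous_of_dominated (bound := fun K => ‖(cauchyDensity γ ε K : ℂ)‖)
    (fun X => (continuous_cauchyDensity_mul_cexp hγ ε X).aestronglyMeasurable)
    (fun X => Eventually.of_forall fun K => ?_) (integrable_cauchyDensity hM hγ ε).norm
    (Eventually.of_forall fun K => ?_)
  · rw [norm_mul, norm_cexp_trace, mul_one]
  · exact continuous_const.mul (continuous_cexp_trace continuous_const continuous_id)

/-! ### The total mass -/

theorem gFun_smul_div {M : ℕ} (γ d : ℝ) {t : ℝ} (i : Fin M) :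
    gFun M γ (M - 1 - i) (t * d) = t ^ (i : ℕ) * (Real.exp (-γ * |t * d|) * d ^ (i : ℕ) *
      ∑ l ∈ Finset.range (M - 1 - i + 1), |γ * (t * d)| ^ l / (l.factorial : ℝ)) := by
  have h : M - 1 - (M - 1 - (i : ℕ)) = i := by omega
  rw [gFun, h, mul_pow]
  ring

/-- Row `i` carries a factor `t ^ i`, and together these make `t^(M(M-1)/2)`. In what remains only
the term `l = 0` survives at `t = 0`, leaving the entries `d_j ^ i`. -/
theorem tendsto_det_gFun (M : ℕ) (γ : ℝ) (d : Fin M → ℝ) :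
    Tendsto (fun t : ℝ => (Matrix.of fun i j : Fin M => gFun M γ (M - 1 - i) (t * d j)).det /
      t ^ (M * (M - 1) / 2)) (𝓝[>] 0) (𝓝 (Matrix.vandermonde d).det) := by
  let B : ℝ → Matrix (Fin M) (Fin M) ℝ := fun t => Matrix.of fun i j =>
    Real.exp (-γ * |t * d j|) * d j ^ (i : ℕ) *
      ∑ l ∈ Finset.range (M - 1 - i + 1), |γ * (t * d j)| ^ l / (l.factorial : ℝ)
  have hB : Continuous fun t => (B t).det := by
    refine Continuous.matrix_det (continuous_matrix fun i j => ?_)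
    simp only [B, Matrix.of_apply]
    fun_prop
  have hB0 : B 0 = (Matrix.vandermonde d).transpose := by
    ext i j
    simp only [B, Matrix.of_apply, Matrix.transpose_apply, Matrix.vandermonde_apply]
    rw [Finset.sum_range_succ']
    simp
  have h0 : (B 0).det = (Matrix.vandermonde d).det := by rw [hB0, Matrix.det_transpose]
  rw [← h0]
  refine ((hB.tendsto 0).mono_left nhdsWithin_le_nhds).congr' ?_
  filter_upwards [self_mem_nhdsWithin] with t (ht : 0 < t)
  rw [eq_div_iff (pow_pos ht _).ne', mul_comm]
  have hdet := Matrix.det_mul_column (fun i : Fin M => t ^ (i : ℕ)) (B t)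
  have hN : ∏ i : Fin M, t ^ (i : ℕ) = t ^ (M * (M - 1) / 2) := by
    rw [Finset.prod_pow_eq_pow_sum, Fin.sum_univ_eq_sum_range fun i => i, Finset.sum_range_id]
  rw [← hN, ← hdet]
  congr 1
  ext i j
  exact (gFun_smul_div γ (d j) i).symm

/-- The explicit formula is singular at `X = 0`, where all eigenvalues coincide. It is approached
along `t(0, 1, ..., M-1)`, where `Δ` and the determinant of the `g` vanish to the same order in `t`.
-/
theorem integral_cauchyDensity {M : ℕ} (hM : 1 ≤ M) {γ : ℝ} (hγ : 0 < γ) (α : ℝ) :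
    ∫ K : HermMat M, (cauchyDensity γ (γ * α) K : ℂ) ∂(hermMeasure M) = cauchyMass M γ := by
  set δ : Fin M → ℝ := fun i => ((i : ℕ) : ℝ) with hδ
  have hδi : Function.Injective δ := fun _ _ h => Fin.ext (Nat.cast_injective h)
  set s := γ * α
  rw [integral_hermMeasure (g := fun K => (cauchyDensity γ s K : ℂ))
    (Complex.continuous_ofReal.comp (continuous_cauchyDensity M hγ _))]
  have hint := integrable_cauchyDensity_toHerm hM hγ s
  have hc : Continuous fun t : ℝ => ∫ c : HermCoord M, (cauchyDensity γ s c.toHerm : ℂ) *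
      ∏ i, Complex.exp (-Complex.I * c.1 i * ((t * δ i : ℝ) : ℂ)) := by
    refine continuous_of_dominated (bound := fun c => ‖(cauchyDensity γ s c.toHerm : ℂ)‖)
      (fun t => ?_) (fun t => Eventually.of_forall fun c => ?_) hint.norm
      (Eventually.of_forall fun c => ?_)
    · exact hint.aestronglyMeasurable.mul (Continuous.aestronglyMeasurable (by fun_prop))
    · rw [norm_mul, norm_prod_cexp c.1 fun i => t * δ i, mul_one]
    · fun_prop
  have hc0 : ∫ c : HermCoord M, (cauchyDensity γ s c.toHerm : ℂ) *
      ∏ i, Complex.exp (-Complex.I * c.1 i * (((0 : ℝ) * δ i : ℝ) : ℂ)) =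
      ∫ c : HermCoord M, (cauchyDensity γ s c.toHerm : ℂ) := by
    simp
  have hL := ((hc.tendsto 0).mono_left (nhdsWithin_le_nhds (s := Set.Ioi 0))).mul_const
    (vandermondeProd δ : ℂ)
  rw [hc0] at hL
  have he : Continuous fun t : ℝ => Complex.exp (-Complex.I * s * ∑ b, ((t * δ b : ℝ) : ℂ)) := by
    fun_prop
  have he0 : Complex.exp (-Complex.I * s * ∑ b, (((0 : ℝ) * δ b : ℝ) : ℂ)) = 1 := by simp
  have heL := (he.tendsto 0).mono_left (nhdsWithin_le_nhds (s := Set.Ioi 0))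
  rw [he0] at heL
  have hdL := (Complex.continuous_ofReal.tendsto _).comp (tendsto_det_gFun M γ δ)
  have hR := (heL.mul hdL).const_mul ((-Complex.I * Real.pi) ^ (M * (M - 1) / 2) *
      ((2 * Real.pi) ^ M / ((2 * γ) ^ (M ^ 2) * Complex.I ^ (M * (M - 1) / 2) *
      ∏ n : Fin M, ((n : ℕ).factorial : ℂ))))
  have hlim := tendsto_nhds_unique (hL.congr' ?_) hR
  · have hv : (vandermondeProd δ : ℂ) ≠ 0 :=
      Complex.ofReal_ne_zero.mpr (vandermondeProd_ne_zero hδi)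
    refine mul_right_cancel₀ hv ?_
    have hk := hermConst_mul_eq hM hγ
    have hsq : ((-1 : ℂ) ^ (M * (M - 1) / 2)) * (-1) ^ (M * (M - 1) / 2) = 1 := by
      rw [← mul_pow]
      simp
    change (hermConst M : ℂ) * (∫ c : HermCoord M, (cauchyDensity γ s c.toHerm : ℂ)) * _ = _
    -- The limiting determinant is built from `x_j - x_i` and `Δ` from `x_i - x_j`; the resulting
    -- sign cancels the one in `hermConst_mul_eq`.
    rw [mul_assoc, hlim, det_vandermonde_eq_vandermondeProd]
    push_cast
    linear_combination ((-1) ^ (M * (M - 1) / 2) * (vandermondeProd δ : ℂ)) * hk +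
      (cauchyMass M γ : ℂ) * (vandermondeProd δ : ℂ) * hsq
  · filter_upwards [self_mem_nhdsWithin] with t (ht : 0 < t)
    have hinj : Function.Injective fun i => t * δ i := fun i j h =>
      hδi (mul_left_cancel₀ ht.ne' h)
    have h := integral_cauchyDensity_cexp hM hγ s hinj
    rw [integral_strictMono_eigWeight hγ, vandermondeProd_smul] at h
    have htN : (t : ℂ) ^ (M * (M - 1) / 2) ≠ 0 := pow_ne_zero _ (Complex.ofReal_ne_zero.mpr ht.ne')
    refine mul_right_cancel₀ htN ?_
    rw [Complex.ofReal_mul, Complex.ofReal_pow] at h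
    rw [mul_assoc, mul_comm (vandermondeProd δ : ℂ), h, Function.comp_apply, Complex.ofReal_div,
      Complex.ofReal_pow]
    field_simp

/-! ### Density of simple spectra and the continuous extension -/

theorem injective_eig_of_charpoly_eq {n : ℕ} {X : HermMat n} {a : Fin n → ℝ}
    (ha : Function.Injective a)
    (h : (X : Matrix (Fin n) (Fin n) ℂ).charpoly = (HermCoord.diag a).toMatrix.charpoly) :
    Function.Injective X.eig := by
  have h1 := (charpoly_diag_eig X).trans h
  have hroots : ∀ b : Fin n → ℝ, (HermCoord.diag b).toMatrix.charpoly.roots =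
      Finset.univ.val.map fun i => (b i : ℂ) := fun b => by
    rw [HermCoord.toMatrix_diagonal, Matrix.charpoly_diagonal,
      ← Polynomial.roots_multiset_prod_X_sub_C (Finset.univ.val.map fun i => (b i : ℂ)),
      Multiset.map_map]
    rfl
  have h2 := congrArg Polynomial.roots h1
  rw [hroots, hroots] at h2
  have hnd : (Finset.univ.val.map fun i => (X.eig i : ℂ)).Nodup := by
    rw [h2]
    exact Finset.univ.nodup.map fun i j hij => ha (Complex.ofReal_injective hij)
  intro i j hij
  exact Multiset.inj_on_of_nodup_map hnd i (Finset.mem_univ_val i) j (Finset.mem_univ_val j)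
    (congrArg _ hij)

theorem eventually_injective_add_mul {n : ℕ} (x : Fin n → ℝ) :
    ∀ᶠ t : ℝ in 𝓝[>] 0, Function.Injective fun i => x i + t * ((i : ℕ) : ℝ) := by
  have h : ∀ i j : Fin n, ∀ᶠ t : ℝ in 𝓝[>] 0,
      x i + t * ((i : ℕ) : ℝ) = x j + t * ((j : ℕ) : ℝ) → i = j := fun i j => by
    by_cases hij : x i = x j
    · filter_upwards [self_mem_nhdsWithin] with t (ht : 0 < t) h
      rw [hij, add_right_inj] at h
      exact Fin.ext (Nat.cast_injective (mul_left_cancel₀ ht.ne' h))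
    · have hc : Continuous fun t : ℝ =>
          x i + t * ((i : ℕ) : ℝ) - (x j + t * ((j : ℕ) : ℝ)) := by fun_prop
      have h0 : x i + 0 * ((i : ℕ) : ℝ) - (x j + 0 * ((j : ℕ) : ℝ)) ≠ 0 := by
        simpa using sub_ne_zero.mpr hij
      filter_upwards [nhdsWithin_le_nhds (hc.continuousAt.eventually_ne h0)] with t ht h
      exact absurd (sub_eq_zero.mpr h) ht
  filter_upwards [eventually_all.mpr fun i => eventually_all.mpr fun j => h i j] with t ht i j hij
  exact ht i j hij

/-- Keep the eigenvectors and replace the eigenvalue `x_i` by `x_i + t i`. For small `t > 0` equal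
eigenvalues have separated and distinct ones have not met. -/
theorem dense_simpleSpectrum (M : ℕ) : Dense (simpleSpectrum M) := by
  intro X
  obtain ⟨V, hV, hX⟩ := exists_unitary_diag_eig X
  let Y : ℝ → HermMat M := fun t =>
    (HermCoord.conj V (HermCoord.diag fun i => X.eig i + t * ((i : ℕ) : ℝ))).toHerm
  have hd : Continuous fun t : ℝ =>
      HermCoord.diag (fun i : Fin M => X.eig i + t * ((i : ℕ) : ℝ)) := by
    unfold HermCoord.diag
    fun_prop
  have hY : Continuous Y := HermCoord.continuous_toHerm.comp
    ((HermCoord.conj V).continuous_of_finiteDimensional.comp hd)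
  have hY0 : Y 0 = X := by
    refine Subtype.ext ?_
    change (HermCoord.conj V _).toMatrix = _
    rw [HermCoord.toMatrix_conj, hX]
    simp
  have ht := (hY.tendsto 0).mono_left (nhdsWithin_le_nhds (s := Set.Ioi 0))
  rw [hY0] at ht
  refine mem_closure_of_tendsto ht ?_
  filter_upwards [eventually_injective_add_mul X.eig] with t hi
  refine injective_eig_of_charpoly_eq hi ?_
  change (HermCoord.conj V _).toMatrix.charpoly = _
  rw [HermCoord.toMatrix_conj]
  have h1 : star V * V = 1 := hV.1
  rw [Matrix.charpoly_mul_comm, ← mul_assoc, h1, one_mul]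

/-- On simple spectra the formula is the restriction of a function continuous on all Hermitian
matrices, so its limits exist everywhere and are the values of that function. -/
theorem tendsto_limitCharFormula {M : ℕ} (hM : 1 ≤ M) {γ : ℝ} (hγ : 0 < γ) (α : ℝ)
    (X : HermMat M) :
    Tendsto (limitCharFormula γ α) (𝓝[simpleSpectrum M] X)
      (𝓝 (cauchyFourier γ (γ * α) X / cauchyMass M γ)) := by
  have hZ : (cauchyMass M γ : ℂ) ≠ 0 := Complex.ofReal_ne_zero.mpr (cauchyMass_pos M hγ).ne'
  refine ((((continuous_cauchyFourier hM hγ (γ * α)).div_const _).tendsto X).mono_left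
    nhdsWithin_le_nhds).congr' ?_
  filter_upwards [self_mem_nhdsWithin] with Y hY
  rw [cauchyFourier, integral_hermMeasure_of_mem_simpleSpectrum hM hγ α hY,
    mul_div_cancel_left₀ _ hZ]

theorem limitCharFun_eq {M : ℕ} (hM : 1 ≤ M) {γ : ℝ} (hγ : 0 < γ) (α : ℝ) (X : HermMat M) :
    limitCharFun γ α X = cauchyFourier γ (γ * α) X / cauchyMass M γ :=
  extendFrom_eq (dense_simpleSpectrum M X) (tendsto_limitCharFormula hM hγ α X)

theorem cexp_trace_div_cauchyDet {M : ℕ} (γ ε : ℝ) (X K : HermMat M) :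
    Complex.exp (-Complex.I *
      Matrix.trace ((K : Matrix (Fin M) (Fin M) ℂ) * (X : Matrix (Fin M) (Fin M) ℂ))) /
      cauchyDet γ ε K ^ M = (cauchyDensity γ ε K : ℂ) * Complex.exp (-Complex.I *
      Matrix.trace ((K : Matrix (Fin M) (Fin M) ℂ) * (X : Matrix (Fin M) (Fin M) ℂ))) := by
  rw [ofReal_cauchyDensity, div_eq_inv_mul]

theorem cauchyWeightMeasure_univ {M : ℕ} (hM : 1 ≤ M) {γ : ℝ} (hγ : 0 < γ) (α : ℝ) :
    cauchyWeightMeasure M γ (γ * α) Set.univ = ENNReal.ofReal (cauchyMass M γ) := by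
  have hi : Integrable (fun K : HermMat M => cauchyDensity γ (γ * α) K) (hermMeasure M) :=
    (integrable_cauchyDensity hM hγ (γ * α)).re
  have h := integral_cauchyDensity hM hγ α
  rw [integral_complex_ofReal, Complex.ofReal_inj] at h
  rw [cauchyWeightMeasure, withDensity_apply _ MeasurableSet.univ, Measure.restrict_univ, ← h,
    ofReal_integral_eq_lintegral_ofReal hi
      (Eventually.of_forall fun K => (cauchyDensity_pos hγ _ K).le)]
  rfl

theorem integral_matrixCauchy {M : ℕ} (hM : 1 ≤ M) {γ : ℝ} (hγ : 0 < γ) (α : ℝ)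
    (g : HermMat M → ℂ) :
    ∫ K, g K ∂(matrixCauchy M γ (γ * α)) =
      (∫ K, (cauchyDensity γ (γ * α) K : ℂ) * g K ∂(hermMeasure M)) / cauchyMass M γ := by
  have hm : Measurable fun K : HermMat M => ENNReal.ofReal (cauchyDensity γ (γ * α) K) :=
    (continuous_cauchyDensity M hγ (γ * α)).measurable.ennreal_ofReal
  rw [matrixCauchy, integral_smul_measure, cauchyWeightMeasure_univ hM hγ, ENNReal.toReal_inv,
    ENNReal.toReal_ofReal (cauchyMass_pos M hγ).le, cauchyWeightMeasure]
  have h := integral_withDensity_eq_integral_toReal_smul (μ := hermMeasure M) hm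
    (Eventually.of_forall fun K => ENNReal.ofReal_lt_top) g
  have h2 : ∀ K : HermMat M, (ENNReal.ofReal (cauchyDensity γ (γ * α) K)).toReal • g K =
      (cauchyDensity γ (γ * α) K : ℂ) * g K := fun K => by
    rw [ENNReal.toReal_ofReal (cauchyDensity_pos hγ _ K).le, Complex.real_smul]
  simp_rw [h2] at h
  rw [div_eq_inv_mul, ← h, Complex.real_smul, Complex.ofReal_inv]
  rfl

end

theorem proposition2 (M : ℕ) (hM : 1 ≤ M) (γ α : ℝ) (hγ : 0 < γ) :
    -- `F` is a well-defined continuous function on Hermitian matrices, given by the formula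
    -- at matrices with distinct eigenvalues (which form a dense set)
    (Dense (simpleSpectrum M) ∧
      Continuous (limitCharFun γ α : HermMat M → ℂ) ∧
      ∀ X ∈ simpleSpectrum M, limitCharFun γ α X = limitCharFormula γ α X) ∧
    -- the Fourier transform of the Cauchy weight
    (∀ X : HermMat M,
      Integrable (fun K : HermMat M =>
        Complex.exp (-Complex.I *
          Matrix.trace ((K : Matrix (Fin M) (Fin M) ℂ) * (X : Matrix (Fin M) (Fin M) ℂ))) /
          cauchyDet γ (γ * α) K ^ M) (hermMeasure M) ∧
      ∫ K : HermMat M,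
        Complex.exp (-Complex.I *
          Matrix.trace ((K : Matrix (Fin M) (Fin M) ℂ) * (X : Matrix (Fin M) (Fin M) ℂ))) /
          cauchyDet γ (γ * α) K ^ M ∂(hermMeasure M) =
        ((Real.pi ^ M * (M.factorial : ℝ) / (γ ^ (M ^ 2) * 2 ^ (M * (M - 1))) : ℝ) : ℂ) *
          limitCharFun γ α X) ∧
    -- hence `F` is the characteristic function of a matrix Cauchy distribution
    (IsProbabilityMeasure (matrixCauchy M γ (γ * α)) ∧
      ∀ X : HermMat M,
        limitCharFun γ α X =
          ∫ K : HermMat M,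
            Complex.exp (-Complex.I *
              Matrix.trace ((K : Matrix (Fin M) (Fin M) ℂ) * (X : Matrix (Fin M) (Fin M) ℂ)))
            ∂(matrixCauchy M γ (γ * α))) := by
  have hZ : (cauchyMass M γ : ℂ) ≠ 0 := Complex.ofReal_ne_zero.mpr (cauchyMass_pos M hγ).ne'
  refine ⟨⟨dense_simpleSpectrum M, ?_, fun X hX => ?_⟩, fun X => ⟨?_, ?_⟩, ⟨⟨?_⟩, fun X => ?_⟩⟩
  · rw [show (limitCharFun γ α : HermMat M → ℂ) = _ from funext (limitCharFun_eq hM hγ α)]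
    exact (continuous_cauchyFourier hM hγ _).div_const _
  · rw [limitCharFun_eq hM hγ, cauchyFourier,
      integral_hermMeasure_of_mem_simpleSpectrum hM hγ α hX, mul_div_cancel_left₀ _ hZ]
  · simp_rw [cexp_trace_div_cauchyDet]
    exact integrable_cauchyDensity_mul_cexp hM hγ _ X
  · simp_rw [cexp_trace_div_cauchyDet]
    rw [limitCharFun_eq hM hγ]
    exact (mul_div_cancel₀ _ hZ).symm
  · rw [matrixCauchy, Measure.smul_apply, cauchyWeightMeasure_univ hM hγ, smul_eq_mul]
    exact ENNReal.inv_mul_cancel (ENNReal.ofReal_pos.mpr (cauchyMass_pos M hγ)).ne'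
      ENNReal.ofReal_ne_top
  · rw [limitCharFun_eq hM hγ, integral_matrixCauchy hM hγ]
    rfl
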